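/- **Theorem 4.1 (Condensation).** Let $d\ge 1$, $\rho\in(0,\infty)$, let $\theta=(\theta_j)_{j\ge1}$ be non-negative real numbers, not all zero, and let $V:\mathbb R^d\to[0,\infty]$ be a (Lebesgue) measurable function. A spatial partition $\lambda=(\lambda_x)_{x\in\mathbb Z^d}$ of $n\in\mathbb N$ is a family of integer partitions whose parts sum to $n$ in total. Let $r_{xj}$ be the number of parts of $\lambda_x$ equal to $j$, $R_j=\sum_x r_{xj}$, and $\eta_x=\sum_j j\,r_{xj}$, so that $\sum_x\eta_x=n$. For $L>0$ define, on the countable set $\Lambda_n$ of spatial partitions of $n$, the probability measure $$\mathbb P_{L,n}(\lambda)=\frac1{Z_{L,n}}\prod_{x\in\mathbb Z^d}\prod_{j\ge1}\frac1{r_{xj}!}\Bigl(\frac{\theta_j}{j}e^{-jV(x/L)}\Bigr)^{r_{xj}},$$ where $Z_{L,n}$ is the normalization and $e^{-\infty}=0$; the measure is defined when $0<Z_{L,n}<\infty$. Let $\mathbb E_{L,n}$ be its expectation. Assume that $V$ is continuous at $0$ with $V(0)=0$, and that for every $j\ge1$ $$\frac1{L^d}\sum_{x\in\mathbb Z^d}e^{-jV(x/L)}\longrightarrow\int_{\mathbb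 R^d}e^{-jV(x)}\,dx<\infty\qquad(L\to\infty).$$ Let $\rho(z)=\sum_{j\ge1}\theta_jz^j\int_{\mathbb R^d}e^{-jV(x)}\,dx$, let $z_c\in[0,\infty]$ be the radius of convergence of this power series, and let $\rho_c=\rho(z_c)\in[0,\infty]$. Assume that $z_c>0$. Then the measure $\mathbb P_{L,n}$ with $\rho L^d=n$ is defined for infinitely many $n$. Moreover, in the following expressions the limits as $n\to\infty$ with $\rho L^d=n$, taken along those $n$ for which $\mathbb P_{L,n}$ is defined, exist for every $K\in\mathbb N$, as do the limits as $K\to\infty$: $$\nu_\infty=\lim_{K\to\infty}\ \lim_{\substack{n\to\infty\\ \rho L^d=n}}\mathbb E_{L,n}\Bigl(\frac1n\sum_{j>K}jR_j\Bigr),\qquad \mu_\infty=\lim_{K\to\infty}\ \lim_{\substack{n\to\infty\\ \rho L^d=n}}\mathbb E_{L,n}\Bigl(\frac1n\sum_{x:\eta_x>K}\eta_x\Bigr),$$ and $$\nu_\infty=\mu_\infty=\max\Bigl(0,\,1-\frac{\rho_c}{\rho}\Bigr),$$ where the right-hand side is $0$ if $\rho_c=\infty$. -/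

import Mathlib

open Filter Topology MeasureTheory
open scoped NNReal ENNReal

noncomputable section

namespace SpatialPartition

/-- The factor `e^{-j V(x)}` for a potential `V : ℝ^d → [0, ∞]`, with `e^{-∞} = 0`. -/
def boltzmann {d : ℕ} (V : (Fin d → ℝ) → ℝ≥0∞) (j : ℕ+) (x : Fin d → ℝ) : ℝ≥0∞ :=
  EReal.exp (-(((((j : ℕ) : ℝ≥0∞) * V x : ℝ≥0∞)) : EReal))

/-- The rescaled lattice point `x / L`, for `x ∈ ℤ^d`. -/
def scaledPoint {d : ℕ} (L : ℝ) (x : Fin d → ℤ) : Fin d → ℝ := fun i => (x i : ℝ) / L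

/-- Families of integer partitions `(λ_x)`, indexed by the sites `x ∈ ℤ^d`, all but finitely many
of them empty. An integer partition is a finite multiset of positive integers. -/
abbrev Family (d : ℕ) := (Fin d → ℤ) →₀ Multiset ℕ+

/-- `r_{xj}`: the number of components of size `j` at the site `x`. -/
def mult {d : ℕ} (lam : Family d) (x : Fin d → ℤ) (j : ℕ+) : ℕ := (lam x).count j

/-- `R_j = ∑_x r_{xj}`: the number of components of size `j`. -/
def compCount {d : ℕ} (lam : Family d) (j : ℕ+) : ℕ := ∑ x ∈ lam.support, mult lam x j

/-- `η_x`: the integer of which `λ_x` is a partition, that is, the occupation of the site `x`. -/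
def siteOcc {d : ℕ} (lam : Family d) (x : Fin d → ℤ) : ℕ :=
  ((lam x).map (fun j : ℕ+ => (j : ℕ))).sum

/-- The set `Λ_n` of spatial partitions of `n`: those families with `∑_x η_x = n`. -/
abbrev Config (d n : ℕ) := {lam : Family d // ∑ x ∈ lam.support, siteOcc lam x = n}

/-- The weight `∏_x ∏_j (1 / r_{xj}!) ((θ_j / j) e^{-j V(x/L)})^{r_{xj}}`. The factors with
`r_{xj} = 0` are equal to `1`, so that the product is over the `x, j` with `r_{xj} ≠ 0`. -/
def weight {d : ℕ} (V : (Fin d → ℝ) → ℝ≥0∞) (θ : ℕ+ → ℝ≥0) (L : ℝ) (lam : Family d) : ℝ≥0∞ :=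
  ∏ x ∈ lam.support, ∏ j ∈ (lam x).toFinset,
    (((mult lam x j).factorial : ℝ≥0∞))⁻¹ *
      ((θ j : ℝ≥0∞) / ((j : ℕ) : ℝ≥0∞) * boltzmann V j (scaledPoint L x)) ^ mult lam x j

/-- The normalization `Z_{L,n}`. -/
def partitionFunction {d : ℕ} (V : (Fin d → ℝ) → ℝ≥0∞) (θ : ℕ+ → ℝ≥0) (L : ℝ) (n : ℕ) : ℝ≥0∞ :=
  ∑' lam : Config d n, weight V θ L lam.1

/-- The probability `P_{L,n}(λ)` (meaningful when `0 < Z_{L,n} < ∞`). -/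
def prob {d : ℕ} (V : (Fin d → ℝ) → ℝ≥0∞) (θ : ℕ+ → ℝ≥0) (L : ℝ) (n : ℕ)
    (lam : Config d n) : ℝ≥0∞ :=
  weight V θ L lam.1 / partitionFunction V θ L n

/-- The expectation `E_{L,n}(F)` of a nonnegative function of the spatial partition. -/
def expect {d : ℕ} (V : (Fin d → ℝ) → ℝ≥0∞) (θ : ℕ+ → ℝ≥0) (L : ℝ) (n : ℕ)
    (F : Family d → ℝ≥0∞) : ℝ≥0∞ :=
  ∑' lam : Config d n, prob V θ L n lam * F lam.1

/-- `∑_{j > K} j R_j`, the mass in components larger than `K`. -/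
def largeCompMass {d : ℕ} (K : ℕ) (lam : Family d) : ℝ≥0∞ :=
  ∑' j : ℕ+, if K < (j : ℕ) then (((j : ℕ) * compCount lam j : ℕ) : ℝ≥0∞) else 0

/-- `∑_{x : η_x > K} η_x`, the mass at sites with occupation larger than `K`. -/
def largeSiteMass {d : ℕ} (K : ℕ) (lam : Family d) : ℝ≥0∞ :=
  ∑' x : Fin d → ℤ, if K < siteOcc lam x then (siteOcc lam x : ℝ≥0∞) else 0

/-- The `L` determined by `ρ L^d = n`. -/
def sideLength (d : ℕ) (ρ : ℝ≥0) (n : ℕ) : ℝ := ((n : ℝ) / (ρ : ℝ)) ^ ((d : ℝ)⁻¹)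

/-- The filter of the thermodynamic limit: `n → ∞` with `ρ L^d = n`, through those `n` for which
the probability measure `P_{L,n}` exists, that is, `0 < Z_{L,n} < ∞`. -/
def thermoLimit {d : ℕ} (V : (Fin d → ℝ) → ℝ≥0∞) (θ : ℕ+ → ℝ≥0) (ρ : ℝ≥0) : Filter ℕ :=
  atTop ⊓ 𝓟 {n : ℕ | partitionFunction V θ (sideLength d ρ n) n ≠ 0 ∧
    partitionFunction V θ (sideLength d ρ n) n ≠ ⊤}

/-- `ν` is the iterated limit `lim_{K → ∞} lim_{n → ∞, ρ L^d = n} E_{L,n}((1/n) ∑_{j > K} j R_j)`: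
the limits over `n` exist for every `K`, and they converge to `ν` as `K → ∞`. -/
def IsNuInfty {d : ℕ} (V : (Fin d → ℝ) → ℝ≥0∞) (θ : ℕ+ → ℝ≥0) (ρ : ℝ≥0) (ν : ℝ≥0∞) : Prop :=
  ∃ νK : ℕ → ℝ≥0∞,
    (∀ K : ℕ, Tendsto (fun n : ℕ => expect V θ (sideLength d ρ n) n
        (fun lam => (n : ℝ≥0∞)⁻¹ * largeCompMass K lam)) (thermoLimit V θ ρ) (𝓝 (νK K))) ∧
    Tendsto νK atTop (𝓝 ν)

/-- `μ` is the iterated limit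
`lim_{K → ∞} lim_{n → ∞, ρ L^d = n} E_{L,n}((1/n) ∑_{x : η_x > K} η_x)`:
the limits over `n` exist for every `K`, and they converge to `μ` as `K → ∞`. -/
def IsMuInfty {d : ℕ} (V : (Fin d → ℝ) → ℝ≥0∞) (θ : ℕ+ → ℝ≥0) (ρ : ℝ≥0) (μ : ℝ≥0∞) : Prop :=
  ∃ μK : ℕ → ℝ≥0∞,
    (∀ K : ℕ, Tendsto (fun n : ℕ => expect V θ (sideLength d ρ n) n
        (fun lam => (n : ℝ≥0∞)⁻¹ * largeSiteMass K lam)) (thermoLimit V θ ρ) (𝓝 (μK K))) ∧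
    Tendsto μK atTop (𝓝 μ)

/-- The density `ρ(z) = ∑_{j ≥ 1} θ_j z^j ∫ e^{-j V}`, for `z ∈ [0, ∞]`, with values in `[0, ∞]`. -/
def density {d : ℕ} (V : (Fin d → ℝ) → ℝ≥0∞) (θ : ℕ+ → ℝ≥0) (z : ℝ≥0∞) : ℝ≥0∞ :=
  ∑' j : ℕ+, (θ j : ℝ≥0∞) * z ^ (j : ℕ) * ∫⁻ x, boltzmann V j x

/-- The radius of convergence `z_c ∈ [0, ∞]` of the power series `ρ(z)`: as its coefficients are
nonnegative, it is the supremum of the `z ≥ 0` at which the series converges. -/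
def criticalFugacity {d : ℕ} (V : (Fin d → ℝ) → ℝ≥0∞) (θ : ℕ+ → ℝ≥0) : ℝ≥0∞ :=
  sSup {z : ℝ≥0∞ | density V θ z ≠ ⊤}

/-- The transition density `ρ_c = ρ(z_c) ∈ [0, ∞]`. -/
def criticalDensity {d : ℕ} (V : (Fin d → ℝ) → ℝ≥0∞) (θ : ℕ+ → ℝ≥0) : ℝ≥0∞ :=
  density V θ (criticalFugacity V θ)

/-- The assumption on the potential `V : ℝ^d → [0, ∞]`: it is (Lebesgue) measurable, continuous at
`0`, `V(0) = 0`, and for every `j ≥ 1` the integral `∫ e^{-j V}` is finite and is the limit, as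
`L → ∞`, of the Riemann sums `L^{-d} ∑_{x ∈ ℤ^d} e^{-j V(x/L)}`. -/
structure PotentialAssumption {d : ℕ} (V : (Fin d → ℝ) → ℝ≥0∞) : Prop where
  aemeasurable : AEMeasurable V volume
  continuousAt_zero : ContinuousAt V 0
  map_zero : V 0 = 0
  integral_ne_top : ∀ j : ℕ+, ∫⁻ x, boltzmann V j x ≠ ⊤
  riemann_sum : ∀ j : ℕ+,
    Tendsto (fun L : ℝ => (∑' x : Fin d → ℤ, boltzmann V j (scaledPoint L x)) /
      ENNReal.ofReal (L ^ d)) atTop (𝓝 (∫⁻ x, boltzmann V j x))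

end SpatialPartition

end

/-!
The weight of a spatial partition factorizes over the pairs `(x, j)`, and it also factorizes over
the sites. Both factorizations give bounds on partition functions.

Write `u = e^{-V}`, `I_j = ∫ u^j`, and let `z` be the largest fugacity with `ρ(z) ≤ ρ`
(`PotentialAssumption.exists_fugacity`). Then `ρ(z) = ρ`, unless `z` is the radius of convergence
`z_c`. In both cases `1 - ρ(z) / ρ` is the claimed limit, and the proof shows that the local
statistics of the system are those of independent sites at fugacity `z`.

*Lower bound.* By superposition of Poisson weights, the partition function is at least
`∏_j (θ_j S_j / j)^{R_j} / R_j!` for any counts `R_j` with `∑_j j R_j = n`, where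
`S_j = ∑_x u(x/L)^j` (`poissonWeight_le_partitionFunction`). The choice `R_j ≈ n θ_j I_j z^j / (j ρ)`
for the small `j` uses up a part `ρ(z) / ρ` of the mass. If `ρ(z) < ρ`, the remainder is put into
components of one large size `J` such that `θ_J I_J z^J` is not exponentially small; such sizes
exist as `z` is the radius of convergence. With Stirling's formula, the exponential rate of the
partition function is at least `-log z + ρ⁻¹ ∑_j (θ_j / j) z^j I_j` (`eventually_rate_le`). If the
sizes `j` with `θ_j ≠ 0` have a common divisor, only some `n` are possible, and a bounded number of
components corrects the residue of `n` (`exists_counts`).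

*Upper bound.* For an observable `∑_x ξ(λ_x)`, the partition function tilted by `e^{tξ}` is at most
`y^{-n}` times a product over the sites, for every `y < z` (`tsum_weight_tilt_le`). The exponent of
this bound is a Riemann sum of `u φ(u)` with `φ` continuous, which converges by the assumption on
the power sums and Weierstrass approximation (`PotentialAssumption.tendsto_riemann`).

By Jensen's inequality, `t E(∑_x ξ(λ_x))` is at most the difference between the logarithm of the
tilted partition function and the logarithm of the partition function. As the upper bound at
`t = 0`, `y → z` agrees with the lower bound, dividing by `n` and letting `n → ∞`, `y → z`, and
`t → 0` from both sides gives the limit of `E(∑_x ξ(λ_x)) / n`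
(`PotentialAssumption.tendsto_expect`). It is `ρ⁻¹ ∫ m(z u)`, where `m(w)` is the mean of `ξ` for
one site at fugacity `w`. This is applied to the mass in components of size at most `K` and to the
occupation of a site cut off at `K`; as `K → ∞`, both limits tend to `ρ(z) / ρ`, because the mean
occupation of a site at fugacity `w` is `∑_j θ_j w^j` (`hasSum_size_siteSeries`).
-/

noncomputable section

namespace SpatialPartition

/-! ### Poisson weights on finitely supported families -/

/-- The unnormalized weight `∏_i b_i^{r_i} / r_i!` of the family `(r_i)`: up to the factor
`exp (∑_i b_i)`, the probability that independent Poisson variables of parameters `b_i` take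
the values `r_i`. -/
def poissonWeight {ι : Type*} (b : ι → ℝ≥0∞) (r : ι →₀ ℕ) : ℝ≥0∞ :=
  r.prod fun i k => (k.factorial : ℝ≥0∞)⁻¹ * b i ^ k

@[simp] lemma poissonWeight_zero {ι : Type*} (b : ι → ℝ≥0∞) : poissonWeight b 0 = 1 := by
  simp [poissonWeight]

lemma poissonWeight_eq_prod {ι : Type*} (b : ι → ℝ≥0∞) (r : ι →₀ ℕ) {s : Finset ι}
    (hs : r.support ⊆ s) :
    poissonWeight b r = ∏ i ∈ s, ((r i).factorial : ℝ≥0∞)⁻¹ * b i ^ r i :=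
  Finsupp.prod_of_support_subset r hs _ (by simp)

lemma poissonWeight_add_single {ι : Type*} (b : ι → ℝ≥0∞) (r : ι →₀ ℕ) (i : ι) :
    ((r i + 1 : ℕ) : ℝ≥0∞) * poissonWeight b (r + Finsupp.single i 1) =
      b i * poissonWeight b r := by
  classical
  rw [poissonWeight_eq_prod b (r + Finsupp.single i 1) (s := insert i r.support),
    poissonWeight_eq_prod b r (Finset.subset_insert i r.support),
    ← Finset.mul_prod_erase _ _ (Finset.mem_insert_self i _),
    ← Finset.mul_prod_erase _ _ (Finset.mem_insert_self i _)]
  · have : ∏ x ∈ (insert i r.support).erase i,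
        ((((r + Finsupp.single i 1 : ι →₀ ℕ) x).factorial : ℝ≥0∞)⁻¹ *
          b x ^ ((r + Finsupp.single i 1 : ι →₀ ℕ) x)) =
        ∏ x ∈ (insert i r.support).erase i, (((r x).factorial : ℝ≥0∞)⁻¹ * b x ^ (r x)) := by
      refine Finset.prod_congr rfl fun x hx => ?_
      have hxi : x ≠ i := (Finset.mem_erase.1 hx).1
      simp [hxi.symm]
    rw [this]
    have h2 : ((r i + 1 : ℕ) : ℝ≥0∞) * (((r + Finsupp.single i 1 : ι →₀ ℕ) i).factorial : ℝ≥0∞)⁻¹ =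
        ((r i).factorial : ℝ≥0∞)⁻¹ := by
      simp only [Finsupp.add_apply, Finsupp.single_eq_same, Nat.factorial_succ, Nat.cast_mul]
      rw [ENNReal.mul_inv (by simp) (by simp), ← mul_assoc,
        ENNReal.mul_inv_cancel (by simp) (by simp), one_mul]
    simp only [Finsupp.add_apply, Finsupp.single_eq_same] at h2 ⊢
    rw [← mul_assoc, ← mul_assoc, h2, pow_succ]
    ring
  · intro x hx
    by_contra hn
    simp only [Finset.mem_insert, not_or, Finsupp.mem_support_iff, not_not] at hn
    simp [hn.2, Ne.symm hn.1] at hx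

/-- The Mecke identity: weighting by `r_i` amounts to adding one point at `i`. -/
lemma tsum_mul_poissonWeight {ι : Type*} (b : ι → ℝ≥0∞) (i : ι) (F : (ι →₀ ℕ) → ℝ≥0∞) :
    ∑' r : ι →₀ ℕ, (r i : ℝ≥0∞) * poissonWeight b r * F r =
      b i * ∑' r : ι →₀ ℕ, poissonWeight b r * F (r + Finsupp.single i 1) := by
  rw [← ENNReal.tsum_mul_left]
  rw [← Function.Injective.tsum_eq (g := fun r : ι →₀ ℕ => r + Finsupp.single i 1)
    (add_left_injective _)]
  · refine tsum_congr fun r => ?_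
    rw [← mul_assoc, ← poissonWeight_add_single b r i]
    simp
  · intro r hr
    have hri : r i ≠ 0 := by
      rintro h
      simp [h] at hr
    refine ⟨r - Finsupp.single i 1, ?_⟩
    ext j
    by_cases hj : i = j
    · subst hj
      simp only [Finsupp.add_apply, Finsupp.tsub_apply, Finsupp.single_eq_same]
      omega
    · simp [hj]

/-- Poisson superposition: when points with marks `j` are placed at the sites `x` with
intensities `b (x, j)`, the total number of points with mark `j` has intensity `∑_x b (x, j)`. -/
lemma tsum_poissonWeight_mapDomain {X J : Type*} [DecidableEq J] (b : X × J → ℝ≥0∞)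
    (R : J →₀ ℕ) :
    (∑' r : X × J →₀ ℕ, if r.mapDomain Prod.snd = R then poissonWeight b r else 0) =
      poissonWeight (fun j => ∑' x, b (x, j)) R := by
  classical
  induction hN : R.degree generalizing R with
  | zero =>
    obtain rfl : R = 0 := (Finsupp.degree_eq_zero_iff R).1 hN
    rw [tsum_eq_single 0]
    · simp
    · intro r hr
      rw [if_neg]
      intro h
      apply hr
      have h1 := Finsupp.degree_mapDomain (Prod.snd : X × J → J) r
      rw [h] at h1
      exact (Finsupp.degree_eq_zero_iff r).1 (by simpa using h1.symm)
  | succ N ih =>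
    obtain ⟨j, hj⟩ : ∃ j, R j ≠ 0 := by
      by_contra! h
      have : R = 0 := Finsupp.ext h
      simp [this] at hN
    obtain ⟨R', rfl⟩ : ∃ R', R = R' + Finsupp.single j 1 := by
      refine ⟨R - Finsupp.single j 1, ?_⟩
      ext k
      by_cases hk : j = k
      · subst hk
        simp only [Finsupp.add_apply, Finsupp.tsub_apply, Finsupp.single_eq_same]
        omega
      · simp [hk]
    have hN' : R'.degree = N := by simpa using hN
    have key : ((R' j + 1 : ℕ) : ℝ≥0∞) *
        (∑' r : X × J →₀ ℕ, if r.mapDomain Prod.snd = R' + Finsupp.single j 1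
          then poissonWeight b r else 0) =
        (∑' x, b (x, j)) * poissonWeight (fun j => ∑' x, b (x, j)) R' := by
      rw [← ENNReal.tsum_mul_left]
      have h1 : ∀ r : X × J →₀ ℕ, ((R' j + 1 : ℕ) : ℝ≥0∞) *
          (if r.mapDomain Prod.snd = R' + Finsupp.single j 1 then poissonWeight b r else 0) =
          ∑' x, (r (x, j) : ℝ≥0∞) * poissonWeight b r *
            (if r.mapDomain Prod.snd = R' + Finsupp.single j 1 then 1 else 0) := by
        intro r
        split_ifs with h
        · have h2 : ((R' j + 1 : ℕ) : ℝ≥0∞) = ∑' x, (r (x, j) : ℝ≥0∞) := by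
            have h3 : R' j + 1 = r.mapDomain Prod.snd j := by rw [h]; simp
            rw [h3, Finsupp.mapDomain, Finsupp.sum_apply, Finsupp.sum,
              tsum_eq_sum (s := r.support.image Prod.fst)]
            · rw [Nat.cast_sum]
              have h4 : r.support ⊆ (r.support.image Prod.fst) ×ˢ (r.support.image Prod.snd) :=
                Finset.subset_product
              rw [Finset.sum_subset h4, Finset.sum_product]
              · refine Finset.sum_congr rfl fun x _ => ?_
                simp only [Finsupp.single_apply]
                by_cases hjm : j ∈ r.support.image Prod.snd
                · rw [Finset.sum_eq_single_of_mem j hjm]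
                  · simp
                  · intro k _ hk
                    simp [hk]
                · rw [Finset.sum_eq_zero]
                  · have : (x, j) ∉ r.support := fun hm =>
                      hjm (Finset.mem_image.2 ⟨_, hm, rfl⟩)
                    simp only [Finsupp.mem_support_iff, not_not] at this
                    simp [this]
                  · intro k hk
                    rw [if_neg]
                    · simp
                    · rintro rfl
                      exact hjm hk
              · intro x _ hx
                simp only [Finsupp.mem_support_iff, not_not] at hx
                simp [hx]
            · intro x hx
              have : (x, j) ∉ r.support := fun hm => hx (Finset.mem_image.2 ⟨_, hm, rfl⟩)
              simp only [Finsupp.mem_support_iff, not_not] at this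
              simp [this]
          rw [h2, ← ENNReal.tsum_mul_right]
          simp
        · simp
      rw [tsum_congr h1, ENNReal.tsum_comm]
      have h5 : ∀ x, ∑' r : X × J →₀ ℕ, (r (x, j) : ℝ≥0∞) * poissonWeight b r *
            (if r.mapDomain Prod.snd = R' + Finsupp.single j 1 then 1 else 0) =
          b (x, j) * poissonWeight (fun j => ∑' x, b (x, j)) R' := by
        intro x
        rw [tsum_mul_poissonWeight b (x, j)
          (fun r => if r.mapDomain Prod.snd = R' + Finsupp.single j 1 then 1 else 0), ← ih R' hN']
        congr 1
        refine tsum_congr fun r => ?_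
        simp [Finsupp.mapDomain_add, Finsupp.mapDomain_single]
      rw [tsum_congr h5, ENNReal.tsum_mul_right]
    rw [← poissonWeight_add_single (fun j => ∑' x, b (x, j)) R' j] at key
    exact (ENNReal.mul_right_inj (by simp) (by simp)).1 key

/-- An infinite product of sums, bounded by an exponential: the sum over finitely supported
families is a supremum of finite sums, and each of these involves finitely many sites only. -/
lemma tsum_finsupp_prod_le {ι M : Type*} [Zero M] (f : ι → M → ℝ≥0∞) (hf : ∀ i, f i 0 = 1)
    (a : ι → ℝ) (ha : ∀ i, 0 ≤ a i) (hs : Summable a)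
    (h : ∀ i, ∑' m, f i m ≤ ENNReal.ofReal (Real.exp (a i))) :
    ∑' r : ι →₀ M, r.prod f ≤ ENNReal.ofReal (Real.exp (∑' i, a i)) := by
  classical
  rw [ENNReal.tsum_eq_iSup_sum]
  refine iSup_le fun s => ?_
  set F : Finset ι := s.biUnion Finsupp.support with hF
  set T : ι → Finset M := fun i => s.image (fun r => r i) with hT
  have h1 : ∀ r ∈ s, r.prod f = ∏ i ∈ F, f i (r i) := fun r hr =>
    Finsupp.prod_of_support_subset r (Finset.subset_biUnion_of_mem Finsupp.support hr) _
      (fun i _ => hf i)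
  calc ∑ r ∈ s, r.prod f = ∑ r ∈ s, ∏ i ∈ F, f i (r i) := Finset.sum_congr rfl h1
    _ = ∑ r ∈ s, ∏ i ∈ F.attach, f i (r i) := by
        refine Finset.sum_congr rfl fun r _ => ?_
        exact (Finset.prod_attach F fun i => f i (r i)).symm
    _ = ∑ p ∈ s.image (fun (r : ι →₀ M) (i : ι) (_ : i ∈ F) => r i),
          ∏ i ∈ F.attach, f i (p i i.2) := by
        rw [Finset.sum_image]
        intro r hr r' hr' hrr
        ext i
        by_cases hi : i ∈ F
        · exact congrFun (congrFun hrr i) hi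
        · have e1 : i ∉ r.support := fun hm => hi (Finset.mem_biUnion.2 ⟨r, hr, hm⟩)
          have e2 : i ∉ r'.support := fun hm => hi (Finset.mem_biUnion.2 ⟨r', hr', hm⟩)
          simp only [Finsupp.mem_support_iff, not_not] at e1 e2
          rw [e1, e2]
    _ ≤ ∑ p ∈ F.pi T, ∏ i ∈ F.attach, f i (p i i.2) := by
        refine Finset.sum_le_sum_of_subset ?_
        intro p hp
        obtain ⟨r, hr, rfl⟩ := Finset.mem_image.1 hp
        exact Finset.mem_pi.2 fun i _ => Finset.mem_image.2 ⟨r, hr, rfl⟩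
    _ = ∏ i ∈ F, ∑ m ∈ T i, f i m := (Finset.prod_sum F T f).symm
    _ ≤ ∏ i ∈ F, ENNReal.ofReal (Real.exp (a i)) :=
        Finset.prod_le_prod' fun i _ => (ENNReal.sum_le_tsum _).trans (h i)
    _ = ENNReal.ofReal (Real.exp (∑ i ∈ F, a i)) := by
        rw [Real.exp_sum, ENNReal.ofReal_prod_of_nonneg fun i _ => (Real.exp_pos _).le]
    _ ≤ ENNReal.ofReal (Real.exp (∑' i, a i)) :=
        ENNReal.ofReal_le_ofReal (Real.exp_le_exp.2 (hs.sum_le_tsum _ fun i _ => ha i))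

lemma tsum_poissonWeight_le {ι : Type*} (b : ι → ℝ) (hb : ∀ i, 0 ≤ b i) (hs : Summable b) :
    ∑' r : ι →₀ ℕ, poissonWeight (fun i => ENNReal.ofReal (b i)) r ≤
      ENNReal.ofReal (Real.exp (∑' i, b i)) := by
  refine tsum_finsupp_prod_le _ (by simp) b hb hs fun i => le_of_eq ?_
  have h := NormedSpace.expSeries_div_hasSum_exp (b i)
  rw [← Real.exp_eq_exp_ℝ] at h
  rw [← h.tsum_eq, ENNReal.ofReal_tsum_of_nonneg (fun n => by have := hb i; positivity) h.summable]
  refine tsum_congr fun n => ?_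
  rw [ENNReal.ofReal_div_of_pos (by positivity), ENNReal.ofReal_pow (hb i), div_eq_mul_inv,
    ENNReal.ofReal_natCast, mul_comm]

/-! ### Spatial partitions as marked point configurations -/

lemma boltzmann_eq_pow {d : ℕ} (V : (Fin d → ℝ) → ℝ≥0∞) (j : ℕ+) (x : Fin d → ℝ) :
    boltzmann V j x = boltzmann V 1 x ^ (j : ℕ) := by
  simp only [boltzmann, EReal.exp_neg]
  rw [← ENNReal.inv_pow, ← EReal.exp_nmul]
  simp only [PNat.one_coe, Nat.cast_one, one_mul, EReal.coe_ennreal_mul]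
  rfl

/-- The integer of which the multiset is a partition. -/
def size (μ : Multiset ℕ+) : ℕ := (μ.map (fun j : ℕ+ => (j : ℕ))).sum

/-- The weight `∏_j (θ_j / j)^{r_j} / r_j!` of an integer partition. -/
def siteWeight (θ : ℕ+ → ℝ≥0) (μ : Multiset ℕ+) : ℝ≥0∞ :=
  poissonWeight (fun j : ℕ+ => (θ j : ℝ≥0∞) / ((j : ℕ) : ℝ≥0∞)) (Multiset.toFinsupp μ)

@[simp] lemma size_zero : size 0 = 0 := rfl

@[simp] lemma siteWeight_zero (θ : ℕ+ → ℝ≥0) : siteWeight θ 0 = 1 := by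
  simp [siteWeight]

lemma size_eq_sum (μ : Multiset ℕ+) : size μ = ∑ j ∈ μ.toFinset, μ.count j * (j : ℕ) := by
  simp [size, Finset.sum_multiset_map_count]

lemma poissonWeight_mul_pow (c : ℕ+ → ℝ≥0∞) (w : ℝ≥0∞) (μ : Multiset ℕ+) :
    poissonWeight (fun j => c j * w ^ (j : ℕ)) (Multiset.toFinsupp μ) =
      poissonWeight c (Multiset.toFinsupp μ) * w ^ size μ := by
  rw [poissonWeight_eq_prod _ _ subset_rfl, poissonWeight_eq_prod _ _ subset_rfl, size_eq_sum,
    ← Finset.prod_pow_eq_pow_sum]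
  simp only [Multiset.toFinsupp_support]
  rw [← Finset.prod_mul_distrib]
  refine Finset.prod_congr rfl fun j _ => ?_
  simp only [Multiset.toFinsupp_apply]
  rw [mul_pow, ← pow_mul, mul_comm (j : ℕ), mul_assoc]

/-- The weight as a product over the sites. -/
lemma weight_eq_prod_sites {d : ℕ} (V : (Fin d → ℝ) → ℝ≥0∞) (θ : ℕ+ → ℝ≥0) (L : ℝ)
    (lam : Family d) :
    weight V θ L lam = lam.prod fun x μ =>
      siteWeight θ μ * boltzmann V 1 (scaledPoint L x) ^ size μ := by
  refine Finset.prod_congr rfl fun x _ => ?_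
  beta_reduce
  rw [siteWeight, ← poissonWeight_mul_pow, poissonWeight_eq_prod _ _ subset_rfl,
    Multiset.toFinsupp_support]
  refine Finset.prod_congr rfl fun j _ => ?_
  rw [boltzmann_eq_pow, mult, Multiset.toFinsupp_apply]

/-- A spatial partition, seen as the family `(r_{xj})` of its multiplicities. -/
def familyEquiv (d : ℕ) : Family d ≃ ((Fin d → ℤ) × ℕ+ →₀ ℕ) :=
  (Finsupp.mapRange.equiv Multiset.toFinsupp.toEquiv (by simp)).trans Finsupp.curryEquiv.symm

lemma familyEquiv_apply {d : ℕ} (lam : Family d) (p : (Fin d → ℤ) × ℕ+) :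
    familyEquiv d lam p = (lam p.1).count p.2 := rfl

lemma familyEquiv_support_subset {d : ℕ} (lam : Family d) :
    (familyEquiv d lam).support ⊆
      lam.support ×ˢ (lam.support.biUnion fun x => (lam x).toFinset) := by
  intro p hp
  rw [Finsupp.mem_support_iff, familyEquiv_apply] at hp
  have hp1 : p.2 ∈ lam p.1 := Multiset.count_ne_zero.1 hp
  have hp2 : p.1 ∈ lam.support := by
    rw [Finsupp.mem_support_iff]
    intro h
    simp [h] at hp1
  exact Finset.mem_product.2 ⟨hp2, Finset.mem_biUnion.2 ⟨_, hp2, by simpa using hp1⟩⟩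

lemma weight_eq_poissonWeight {d : ℕ} (V : (Fin d → ℝ) → ℝ≥0∞) (θ : ℕ+ → ℝ≥0) (L : ℝ)
    (lam : Family d) :
    weight V θ L lam = poissonWeight (fun p : (Fin d → ℤ) × ℕ+ =>
      (θ p.2 : ℝ≥0∞) / ((p.2 : ℕ) : ℝ≥0∞) * boltzmann V 1 (scaledPoint L p.1) ^ (p.2 : ℕ))
      (familyEquiv d lam) := by
  rw [poissonWeight_eq_prod _ _ (familyEquiv_support_subset lam), Finset.prod_product]
  refine Finset.prod_congr rfl fun x hx => ?_
  refine (Finset.prod_subset (Finset.subset_biUnion_of_mem (fun x => (lam x).toFinset) hx)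
    ?_).trans ?_
  · intro j _ hj
    have : mult lam x j = 0 := Multiset.count_eq_zero.2 (by simpa using hj)
    simp [this]
  · refine Finset.prod_congr rfl fun j _ => ?_
    rw [boltzmann_eq_pow]
    rfl

/-- The total mass `∑_j j R_j` of a family of component counts. -/
def mass (R : ℕ+ →₀ ℕ) : ℕ := R.sum fun j k => k * (j : ℕ)

lemma mass_add (R R' : ℕ+ →₀ ℕ) : mass (R + R') = mass R + mass R' :=
  Finsupp.sum_add_index' (by simp) (by intros; ring)

@[simp] lemma mass_single (j : ℕ+) (k : ℕ) : mass (Finsupp.single j k) = k * j := by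
  simp [mass]

lemma mass_mapDomain_familyEquiv {d : ℕ} (lam : Family d) :
    mass ((familyEquiv d lam).mapDomain Prod.snd) = ∑ x ∈ lam.support, siteOcc lam x := by
  rw [mass, Finsupp.sum_mapDomain_index (by simp) (by intros; ring),
    Finsupp.sum_of_support_subset _ (familyEquiv_support_subset lam) _ (by simp),
    Finset.sum_product]
  refine Finset.sum_congr rfl fun x hx => ?_
  change _ = size (lam x)
  rw [size_eq_sum]
  symm
  refine Finset.sum_subset (Finset.subset_biUnion_of_mem (fun x => (lam x).toFinset) hx) ?_
  intro j _ hj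
  rw [Multiset.count_eq_zero.2 (by simpa using hj), zero_mul]

lemma partitionFunction_eq_tsum {d : ℕ} (V : (Fin d → ℝ) → ℝ≥0∞) (θ : ℕ+ → ℝ≥0) (L : ℝ) (n : ℕ) :
    partitionFunction V θ L n = ∑' r : (Fin d → ℤ) × ℕ+ →₀ ℕ,
      if mass (r.mapDomain Prod.snd) = n then poissonWeight (fun p : (Fin d → ℤ) × ℕ+ =>
      (θ p.2 : ℝ≥0∞) / ((p.2 : ℕ) : ℝ≥0∞) * boltzmann V 1 (scaledPoint L p.1) ^ (p.2 : ℕ)) r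
      else 0 := by
  rw [← (familyEquiv d).tsum_eq]
  simp only [mass_mapDomain_familyEquiv, ← weight_eq_poissonWeight]
  rw [partitionFunction]
  exact (tsum_subtype {lam : Family d | ∑ x ∈ lam.support, siteOcc lam x = n}
    (fun lam => weight V θ L lam)).trans (tsum_congr fun lam => by simp [Set.indicator_apply])

/-- The sum `∑_x e^{-j V(x/L)}`. -/
def latticeSum {d : ℕ} (V : (Fin d → ℝ) → ℝ≥0∞) (L : ℝ) (j : ℕ) : ℝ≥0∞ :=
  ∑' x : Fin d → ℤ, boltzmann V 1 (scaledPoint L x) ^ j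

/-- The partition function is at least the contribution of any prescribed family of component
counts `R_j`. -/
lemma poissonWeight_le_partitionFunction {d : ℕ} (V : (Fin d → ℝ) → ℝ≥0∞) (θ : ℕ+ → ℝ≥0) (L : ℝ)
    (R : ℕ+ →₀ ℕ) :
    poissonWeight (fun j : ℕ+ => (θ j : ℝ≥0∞) / ((j : ℕ) : ℝ≥0∞) * latticeSum V L j) R ≤
      partitionFunction V θ L (mass R) := by
  rw [partitionFunction_eq_tsum]
  simp only [latticeSum, ← ENNReal.tsum_mul_left]
  rw [← tsum_poissonWeight_mapDomain (fun p : (Fin d → ℤ) × ℕ+ =>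
      (θ p.2 : ℝ≥0∞) / ((p.2 : ℕ) : ℝ≥0∞) * boltzmann V 1 (scaledPoint L p.1) ^ (p.2 : ℕ)) R]
  refine ENNReal.tsum_le_tsum fun r => ?_
  split_ifs with h1 h2
  · rfl
  · exact absurd (by rw [h1]) h2
  · exact zero_le
  · rfl

lemma exists_counts_of_partitionFunction_ne_zero {d : ℕ} {V : (Fin d → ℝ) → ℝ≥0∞}
    {θ : ℕ+ → ℝ≥0} {L : ℝ} {n : ℕ} (h : partitionFunction V θ L n ≠ 0) :
    ∃ R : ℕ+ →₀ ℕ, mass R = n ∧ ∀ j ∈ R.support, θ j ≠ 0 := by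
  rw [partitionFunction_eq_tsum, Ne, ENNReal.tsum_eq_zero] at h
  push Not at h
  obtain ⟨r, hr⟩ := h
  have hm : mass (r.mapDomain Prod.snd) = n := by
    by_contra hm
    exact hr (if_neg hm)
  rw [if_pos hm] at hr
  refine ⟨_, hm, fun j hj => ?_⟩
  classical
  obtain ⟨p, hp, rfl⟩ := Finset.mem_image.1 (Finsupp.mapDomain_support hj)
  intro h0
  apply hr
  rw [poissonWeight_eq_prod _ _ subset_rfl]
  refine Finset.prod_eq_zero hp ?_
  rw [h0]
  simp [Finsupp.mem_support_iff.1 hp]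

/-! ### Sums over the sites, and exponential tilting -/

/-- The observable `∑_x ξ(λ_x)`. -/
def siteSum {d : ℕ} (ξ : Multiset ℕ+ → ℕ) (lam : Family d) : ℕ := lam.sum fun _ μ => ξ μ

/-- The part of the size of a partition that comes from the components larger than `K`. -/
def sizeAbove (K : ℕ) (μ : Multiset ℕ+) : ℕ := size (μ.filter fun j : ℕ+ => K < (j : ℕ))

/-- The part of the size of a partition that comes from the components of size at most `K`. -/
def sizeUpTo (K : ℕ) (μ : Multiset ℕ+) : ℕ := size (μ.filter fun j : ℕ+ => ¬ K < (j : ℕ))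

lemma sizeUpTo_add_sizeAbove (K : ℕ) (μ : Multiset ℕ+) :
    sizeUpTo K μ + sizeAbove K μ = size μ := by
  conv_rhs => rw [← Multiset.filter_add_not (fun j : ℕ+ => K < (j : ℕ)) μ]
  rw [sizeUpTo, sizeAbove, add_comm]
  simp only [size, Multiset.map_add, Multiset.sum_add]

lemma siteSum_size {d n : ℕ} (lam : Config d n) : siteSum size lam.1 = n := lam.2

lemma siteSum_add {d : ℕ} (ξ ζ : Multiset ℕ+ → ℕ) (lam : Family d) :
    siteSum ξ lam + siteSum ζ lam = siteSum (fun μ => ξ μ + ζ μ) lam :=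
  Finset.sum_add_distrib.symm

lemma largeSiteMass_eq {d : ℕ} (K : ℕ) (lam : Family d) :
    largeSiteMass K lam = siteSum (fun μ => if K < size μ then size μ else 0) lam := by
  rw [largeSiteMass, tsum_eq_sum (s := lam.support)]
  · rw [siteSum, Finsupp.sum, Nat.cast_sum]
    refine Finset.sum_congr rfl fun x _ => ?_
    rw [Nat.cast_ite, Nat.cast_zero]
    rfl
  · intro x hx
    have : siteOcc lam x = 0 := by
      change size (lam x) = 0
      rw [Finsupp.notMem_support_iff.1 hx, size_zero]
    simp [this]

lemma sizeAbove_eq_tsum (K : ℕ) (μ : Multiset ℕ+) :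
    (sizeAbove K μ : ℝ≥0∞) =
      ∑' j : ℕ+, if K < (j : ℕ) then (((j : ℕ) * μ.count j : ℕ) : ℝ≥0∞) else 0 := by
  refine Eq.trans ?_ (tsum_eq_sum (s := (μ.filter fun j : ℕ+ => K < (j : ℕ)).toFinset) ?_).symm
  · rw [sizeAbove, size_eq_sum, Nat.cast_sum]
    refine Finset.sum_congr rfl fun j hj => ?_
    have : K < (j : ℕ) := by
      simp only [Multiset.mem_toFinset, Multiset.mem_filter] at hj
      exact hj.2
    rw [if_pos this, Multiset.count_filter_of_pos (p := fun j : ℕ+ => K < (j : ℕ)) this, mul_comm]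
  · intro j hj
    split_ifs with h
    · simp only [Multiset.mem_toFinset, Multiset.mem_filter, not_and] at hj
      have : μ.count j = 0 := Multiset.count_eq_zero.2 fun hm => hj hm h
      simp [this]
    · rfl

lemma largeCompMass_eq {d : ℕ} (K : ℕ) (lam : Family d) :
    largeCompMass K lam = siteSum (sizeAbove K) lam := by
  rw [largeCompMass, siteSum, Finsupp.sum, Nat.cast_sum]
  simp only [sizeAbove_eq_tsum]
  rw [← Summable.tsum_finsetSum fun _ _ => ENNReal.summable]
  refine tsum_congr fun j => ?_
  split_ifs
  · simp [compCount, mult, Finset.mul_sum]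
  · simp

lemma expect_eq_one_sub {d n : ℕ} (V : (Fin d → ℝ) → ℝ≥0∞) (θ : ℕ+ → ℝ≥0) (L : ℝ) (hn : n ≠ 0)
    (h0 : partitionFunction V θ L n ≠ 0) (h1 : partitionFunction V θ L n ≠ ⊤)
    {ξ ζ : Multiset ℕ+ → ℕ} (h : ∀ μ, ξ μ + ζ μ = size μ) :
    expect V θ L n (fun lam => (n : ℝ≥0∞)⁻¹ * siteSum ζ lam) =
      1 - expect V θ L n (fun lam => (n : ℝ≥0∞)⁻¹ * siteSum ξ lam) ∧
    expect V θ L n (fun lam => (n : ℝ≥0∞)⁻¹ * siteSum ξ lam) ≤ 1 := by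
  have hsum : expect V θ L n (fun lam => (n : ℝ≥0∞)⁻¹ * siteSum ξ lam) +
      expect V θ L n (fun lam => (n : ℝ≥0∞)⁻¹ * siteSum ζ lam) = 1 := by
    simp only [expect]
    rw [← ENNReal.tsum_add]
    have : ∀ lam : Config d n, prob V θ L n lam * ((n : ℝ≥0∞)⁻¹ * siteSum ξ lam.1) +
        prob V θ L n lam * ((n : ℝ≥0∞)⁻¹ * siteSum ζ lam.1) =
        weight V θ L lam.1 * (partitionFunction V θ L n)⁻¹ := by
      intro lam
      rw [← mul_add, ← mul_add, ← Nat.cast_add, siteSum_add, funext h, siteSum_size,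
        ENNReal.inv_mul_cancel (by simpa using hn) (by simp), mul_one, prob, div_eq_mul_inv]
    rw [tsum_congr this, ENNReal.tsum_mul_right]
    exact ENNReal.mul_inv_cancel h0 h1
  have hle : expect V θ L n (fun lam => (n : ℝ≥0∞)⁻¹ * siteSum ξ lam) ≤ 1 := by
    rw [← hsum]; exact le_self_add
  exact ⟨ENNReal.eq_sub_of_add_eq (ne_top_of_le_ne_top ENNReal.one_ne_top hle)
    (by rw [add_comm]; exact hsum), hle⟩

/-- Chernoff bound for the partition function with an exponential tilt: the sum over the
partitions of `n` is at most `z^{-n}` times the grand-canonical sum, which factorizes over the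
sites. -/
lemma tsum_weight_tilt_le {d : ℕ} (V : (Fin d → ℝ) → ℝ≥0∞) (θ : ℕ+ → ℝ≥0) (L : ℝ) (n : ℕ)
    {ξ : Multiset ℕ+ → ℕ} (hξ : ξ 0 = 0) (t : ℝ) {z : ℝ} (hz : 0 < z)
    (a : (Fin d → ℤ) → ℝ) (ha : ∀ x, 0 ≤ a x) (has : Summable a)
    (h : ∀ x, ∑' μ : Multiset ℕ+, siteWeight θ μ *
      (ENNReal.ofReal z * boltzmann V 1 (scaledPoint L x)) ^ size μ *
        ENNReal.ofReal (Real.exp (t * ξ μ)) ≤ ENNReal.ofReal (Real.exp (a x))) :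
    ∑' lam : Config d n, weight V θ L lam.1 * ENNReal.ofReal (Real.exp (t * siteSum ξ lam.1)) ≤
      ENNReal.ofReal (Real.exp (-(n * Real.log z) + ∑' x, a x)) := by
  have key := tsum_finsupp_prod_le (fun x μ => siteWeight θ μ *
      (ENNReal.ofReal z * boltzmann V 1 (scaledPoint L x)) ^ size μ *
        ENNReal.ofReal (Real.exp (t * ξ μ))) (by simp [hξ]) a ha has h
  have h1 := (ENNReal.tsum_comp_le_tsum_of_injective
    (f := (Subtype.val : Config d n → Family d)) Subtype.val_injective _).trans key
  have h2 : ∀ lam : Config d n, (lam.1.prod fun x μ => siteWeight θ μ *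
      (ENNReal.ofReal z * boltzmann V 1 (scaledPoint L x)) ^ size μ *
        ENNReal.ofReal (Real.exp (t * ξ μ))) =
      ENNReal.ofReal z ^ n *
        (weight V θ L lam.1 * ENNReal.ofReal (Real.exp (t * siteSum ξ lam.1))) := by
    intro lam
    have e1 : ENNReal.ofReal z ^ n = lam.1.prod fun _ μ => ENNReal.ofReal z ^ size μ := by
      conv_lhs => rw [← siteSum_size lam]
      exact (Finset.prod_pow_eq_pow_sum _ _ _).symm
    have e2 : ENNReal.ofReal (Real.exp (t * siteSum ξ lam.1)) =
        lam.1.prod fun _ μ => ENNReal.ofReal (Real.exp (t * ξ μ)) := by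
      rw [siteSum, Finsupp.sum, Nat.cast_sum, Finset.mul_sum, Real.exp_sum,
        ENNReal.ofReal_prod_of_nonneg fun i _ => (Real.exp_pos _).le]
      rfl
    rw [e1, e2, weight_eq_prod_sites, ← Finsupp.prod_mul, ← Finsupp.prod_mul]
    refine Finset.prod_congr rfl fun x _ => ?_
    beta_reduce
    rw [mul_pow]
    ring
  rw [tsum_congr h2, ENNReal.tsum_mul_left] at h1
  have hzn : ENNReal.ofReal (Real.exp (-(n * Real.log z))) * ENNReal.ofReal z ^ n = 1 := by
    rw [← ENNReal.ofReal_pow hz.le, ← ENNReal.ofReal_mul (Real.exp_pos _).le, Real.exp_neg,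
      mul_comm (n : ℝ), Real.exp_mul, Real.exp_log hz, Real.rpow_natCast,
      inv_mul_cancel₀ (by positivity), ENNReal.ofReal_one]
  rw [Real.exp_add, ENNReal.ofReal_mul (Real.exp_pos _).le]
  calc _ = ENNReal.ofReal (Real.exp (-(n * Real.log z))) * (ENNReal.ofReal z ^ n *
        ∑' lam : Config d n,
          weight V θ L lam.1 * ENNReal.ofReal (Real.exp (t * siteSum ξ lam.1))) := by
        rw [← mul_assoc, hzn, one_mul]
    _ ≤ _ := by gcongr

/-- A bound on an exponential moment bounds the mean. -/
lemma mul_mean_le_of_exp_moment_le {α : Type*} (p : α → ℝ≥0∞) (hp : ∑' i, p i = 1) (X : α → ℕ)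
    {n : ℕ} (hX : ∀ i, X i ≤ n) {t c : ℝ}
    (h : ∑' i, p i * ENNReal.ofReal (Real.exp (t * X i)) ≤ ENNReal.ofReal (Real.exp c)) :
    t * (∑' i, p i * X i).toReal ≤ c := by
  have hpt : ∀ i, p i ≠ ⊤ := ENNReal.ne_top_of_tsum_ne_top (by rw [hp]; simp)
  have hps : Summable fun i => (p i).toReal := ENNReal.summable_toReal (by rw [hp]; simp)
  have hps1 : ∑' i, (p i).toReal = 1 := by
    rw [← ENNReal.tsum_toReal_eq hpt, hp, ENNReal.toReal_one]
  have hmean : (∑' i, p i * X i).toReal = ∑' i, (p i).toReal * X i := by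
    rw [ENNReal.tsum_toReal_eq fun i => ENNReal.mul_ne_top (hpt i) (by simp)]
    simp
  have hXs : Summable fun i => (p i).toReal * (X i : ℝ) := by
    refine Summable.of_nonneg_of_le (fun i => by positivity) (fun i => ?_) (hps.mul_right (n : ℝ))
    have : (X i : ℝ) ≤ n := by exact_mod_cast hX i
    gcongr
  have hes : ∀ i, (p i * ENNReal.ofReal (Real.exp (t * X i))).toReal =
      (p i).toReal * Real.exp (t * X i) := fun i => by
    rw [ENNReal.toReal_mul, ENNReal.toReal_ofReal (Real.exp_pos _).le]
  have hE : Summable fun i => (p i).toReal * Real.exp (t * X i) := by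
    simp only [← hes]
    exact ENNReal.summable_toReal (ne_top_of_le_ne_top ENNReal.ofReal_ne_top h)
  have hEle : ∑' i, (p i).toReal * Real.exp (t * X i) ≤ Real.exp c := by
    simp only [← hes]
    rw [← ENNReal.tsum_toReal_eq fun i => ENNReal.mul_ne_top (hpt i) ENNReal.ofReal_ne_top]
    exact ENNReal.toReal_le_of_le_ofReal (Real.exp_pos _).le h
  -- sum `1 + y ≤ exp y` with `y = t X - c` against `p`
  have hsum : ∑' i, ((p i).toReal * (1 - c) + t * ((p i).toReal * X i)) ≤
      ∑' i, Real.exp (-c) * ((p i).toReal * Real.exp (t * X i)) := by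
    refine Summable.tsum_le_tsum (fun i => ?_) ((hps.mul_right _).add (hXs.mul_left _))
      (hE.mul_left _)
    have h1 := Real.add_one_le_exp (t * X i - c)
    have h2 : Real.exp (t * X i - c) = Real.exp (-c) * Real.exp (t * X i) := by
      rw [← Real.exp_add]; ring_nf
    have h3 : 0 ≤ (p i).toReal := ENNReal.toReal_nonneg
    calc _ = (p i).toReal * (t * X i - c + 1) := by ring
      _ ≤ (p i).toReal * Real.exp (t * X i - c) := by gcongr
      _ = _ := by rw [h2]; ring
  rw [(hps.mul_right (1 - c)).tsum_add (hXs.mul_left t), tsum_mul_right, tsum_mul_left,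
    tsum_mul_left, hps1] at hsum
  have : Real.exp (-c) * ∑' i, (p i).toReal * Real.exp (t * X i) ≤ 1 := by
    calc _ ≤ Real.exp (-c) * Real.exp c := by gcongr
      _ = 1 := by rw [← Real.exp_add]; simp
  rw [hmean]
  linarith

/-- The tilted partition function bounds the mean of `∑_x ξ(λ_x)`, by convexity. -/
lemma mul_expect_le {d n : ℕ} (V : (Fin d → ℝ) → ℝ≥0∞) (θ : ℕ+ → ℝ≥0) (L : ℝ)
    (h0 : partitionFunction V θ L n ≠ 0) (h1 : partitionFunction V θ L n ≠ ⊤)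
    {ξ : Multiset ℕ+ → ℕ} (hξ : ∀ μ, ξ μ ≤ size μ) {t b : ℝ}
    (h : ∑' lam : Config d n, weight V θ L lam.1 *
      ENNReal.ofReal (Real.exp (t * siteSum ξ lam.1)) ≤ ENNReal.ofReal (Real.exp b)) :
    t * (n * (expect V θ L n (fun lam => (n : ℝ≥0∞)⁻¹ * siteSum ξ lam)).toReal) ≤
      b - Real.log (partitionFunction V θ L n).toReal := by
  set Z := partitionFunction V θ L n with hZ
  have hZpos : 0 < Z.toReal := ENNReal.toReal_pos h0 h1
  have hp : ∑' lam : Config d n, prob V θ L n lam = 1 := by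
    simp only [prob, div_eq_mul_inv]
    rw [ENNReal.tsum_mul_right]
    exact ENNReal.mul_inv_cancel h0 h1
  have hX : ∀ lam : Config d n, siteSum ξ lam.1 ≤ n := fun lam =>
    (Finset.sum_le_sum fun x _ => hξ (lam.1 x)).trans (siteSum_size lam).le
  have hb : ∑' lam : Config d n, prob V θ L n lam *
      ENNReal.ofReal (Real.exp (t * siteSum ξ lam.1)) ≤
      ENNReal.ofReal (Real.exp (b - Real.log Z.toReal)) := by
    have e : ∀ lam : Config d n, prob V θ L n lam *
        ENNReal.ofReal (Real.exp (t * siteSum ξ lam.1)) = Z⁻¹ * (weight V θ L lam.1 *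
          ENNReal.ofReal (Real.exp (t * siteSum ξ lam.1))) := fun lam => by
      rw [prob, div_eq_mul_inv]; ring
    rw [tsum_congr e, ENNReal.tsum_mul_left, Real.exp_sub, Real.exp_log hZpos,
      ENNReal.ofReal_div_of_pos hZpos, ENNReal.ofReal_toReal h1, div_eq_mul_inv, mul_comm]
    gcongr
  have key := mul_mean_le_of_exp_moment_le _ hp _ hX hb
  refine le_trans (le_of_eq ?_) key
  congr 1
  rw [expect]
  have e : ∀ lam : Config d n, prob V θ L n lam * ((n : ℝ≥0∞)⁻¹ * siteSum ξ lam.1) =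
      (n : ℝ≥0∞)⁻¹ * (prob V θ L n lam * siteSum ξ lam.1) := fun lam => by ring
  rw [tsum_congr e, ENNReal.tsum_mul_left, ENNReal.toReal_mul, ENNReal.toReal_inv,
    ENNReal.toReal_natCast]
  rcases Nat.eq_zero_or_pos n with rfl | hn
  · have : ∀ lam : Config d 0, siteSum ξ lam.1 = 0 := fun lam => Nat.le_zero.1 (hX lam)
    simp [this]
  · rw [← mul_assoc, mul_inv_cancel₀ (by positivity), one_mul]

/-! ### Lower bound for the partition function -/

/-- Stirling's upper bound, in a form that holds for `R = 0` too. -/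
lemma log_factorial_le (R : ℕ) :
    Real.log (R.factorial : ℝ) ≤ R * Real.log R - R + Real.log R + 1 := by
  rcases Nat.eq_zero_or_pos R with rfl | hR
  · simp
  obtain ⟨m, rfl⟩ : ∃ m, R = m + 1 := ⟨R - 1, by omega⟩
  have h1 := Stirling.stirlingSeq'_antitone (Nat.zero_le m)
  simp only [Function.comp] at h1
  have h2 : Real.log (Stirling.stirlingSeq (m + 1)) ≤ Real.log (Stirling.stirlingSeq 1) :=
    Real.log_le_log (Stirling.stirlingSeq'_pos m) h1
  rw [Stirling.log_stirlingSeq_formula, Stirling.log_stirlingSeq_formula] at h2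
  have hpos : (0 : ℝ) < ((m + 1 : ℕ) : ℝ) := by positivity
  have h3 : 0 ≤ Real.log ((m + 1 : ℕ) : ℝ) :=
    Real.log_nonneg (by exact_mod_cast Nat.succ_le_succ (Nat.zero_le m))
  rw [Real.log_div hpos.ne' (Real.exp_ne_zero _), Real.log_exp,
    Real.log_mul (by norm_num) hpos.ne'] at h2
  simp only [Nat.factorial_one, Nat.cast_one, Real.log_one, mul_one, one_mul, one_div,
    Real.log_inv, Real.log_exp] at h2
  nlinarith

/-- The exponential rate of `σ^R / R!` when `R / n → α` and `σ / n → κ`. -/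
lemma tendsto_log_poisson_rate {l : Filter ℕ} (hl : l ≤ atTop) {R : ℕ → ℕ} {σ : ℕ → ℝ} {α κ : ℝ}
    (hκ : 0 < κ) (hR : ∀ᶠ n in l, R n ≤ n)
    (hα : Tendsto (fun n => (R n : ℝ) / n) l (𝓝 α))
    (hσ : Tendsto (fun n => σ n / n) l (𝓝 κ)) :
    Tendsto (fun n => (R n * Real.log (σ n) -
      (R n * Real.log (R n) - R n + Real.log (R n) + 1)) / n) l
      (𝓝 (α * Real.log κ + Real.negMulLog α + α)) := by
  have hn : Tendsto (fun n : ℕ => (n : ℝ)) l atTop := tendsto_natCast_atTop_atTop.mono_left hl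
  have hlogn : Tendsto (fun n : ℕ => Real.log n / n) l (𝓝 0) :=
    (Real.isLittleO_log_id_atTop.tendsto_div_nhds_zero).comp hn
  have hlogR : Tendsto (fun n : ℕ => Real.log (R n) / n) l (𝓝 0) := by
    refine squeeze_zero' (Eventually.of_forall fun n => ?_) ?_ hlogn
    · exact div_nonneg (Real.log_natCast_nonneg _) (Nat.cast_nonneg _)
    · filter_upwards [hR] with n hn
      rcases Nat.eq_zero_or_pos (R n) with h | h
      · rw [h, Nat.cast_zero, Real.log_zero, zero_div]
        exact div_nonneg (Real.log_natCast_nonneg _) (Nat.cast_nonneg _)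
      · gcongr
  have h1 : Tendsto (fun n : ℕ => (1 : ℝ) / n) l (𝓝 0) := tendsto_const_nhds.div_atTop hn
  have hmain : Tendsto (fun n => (R n : ℝ) / n * Real.log (σ n / n) +
      Real.negMulLog ((R n : ℝ) / n) + (R n : ℝ) / n - Real.log (R n) / n - 1 / n) l
      (𝓝 (α * Real.log κ + Real.negMulLog α + α - 0 - 0)) :=
    ((((hα.mul ((Real.continuousAt_log hκ.ne').tendsto.comp hσ)).add
      (Real.continuous_negMulLog.continuousAt.tendsto.comp hα)).add hα).sub hlogR).sub h1
  rw [sub_zero, sub_zero] at hmain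
  refine hmain.congr' ?_
  filter_upwards [hn.eventually_gt_atTop 0, hσ.eventually_const_lt hκ] with n hn0 hσn
  have hσ0 : 0 < σ n := by
    by_contra h
    exact absurd hσn (not_lt.2 (div_nonpos_of_nonpos_of_nonneg (not_lt.1 h) hn0.le))
  rw [Real.log_div hσ0.ne' hn0.ne', Real.negMulLog]
  rcases Nat.eq_zero_or_pos (R n) with h | h
  · simp [h, neg_div]
  · have : (0 : ℝ) < R n := by exact_mod_cast h
    rw [Real.log_div this.ne' hn0.ne']
    field_simp
    ring

lemma mass_eq_sum (R : ℕ+ →₀ ℕ) {s : Finset ℕ+} (h : R.support ⊆ s) :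
    mass R = ∑ j ∈ s, R j * (j : ℕ) :=
  Finsupp.sum_of_support_subset _ h _ (by simp)

lemma mass_sum {s : Finset ℕ+} (f : ℕ+ → ℕ) :
    mass (∑ j ∈ s, Finsupp.single j (f j)) = ∑ j ∈ s, f j * (j : ℕ) := by
  classical
  induction s using Finset.induction_on with
  | empty => rfl
  | insert a s ha ih => rw [Finset.sum_insert ha, Finset.sum_insert ha, mass_add, ih, mass_single]

/-- Component counts with prescribed asymptotic frequencies `α_j` and with total mass exactly `n`.
The sizes are in a set `D`, and `n` is a sum of elements of `D`. All counts but that of `J` are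
multiples of `J`, up to a bounded correction that depends on the residue of `n` modulo `J`. -/
lemma exists_counts {D : Set ℕ+} {T : Finset ℕ+} (hT : ∀ j ∈ T, j ∈ D) {α : ℕ+ → ℝ}
    (hα : ∀ j, 0 ≤ α j) (hαT : ∀ j, j ∉ T → α j = 0) {J : ℕ+} (hJ : J ∈ T) (hJα : 0 < α J)
    (hsum : ∑ j ∈ T, (j : ℝ) * α j = 1) {l : Filter ℕ} (hl : l ≤ atTop)
    (hS : ∀ᶠ n in l, ∃ R : ℕ+ →₀ ℕ, mass R = n ∧ ∀ j ∈ R.support, j ∈ D) :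
    ∃ (R : ℕ → ℕ+ →₀ ℕ) (T' : Finset ℕ+), T ⊆ T' ∧ (∀ j ∈ T', j ∈ D) ∧
      (∀ᶠ n in l, mass (R n) = n ∧ (R n).support ⊆ T') ∧
      ∀ j ∈ T', Tendsto (fun n => (R n j : ℝ) / n) l (𝓝 (α j)) := by
  classical
  have hJpos : (0 : ℝ) < (J : ℕ) := by exact_mod_cast J.pos
  have hc : ∃ c : ℕ → ℕ+ →₀ ℕ, (∀ r, ∀ j ∈ (c r).support, j ∈ D) ∧
      ∀ n, (∃ R : ℕ+ →₀ ℕ, mass R = n ∧ ∀ j ∈ R.support, j ∈ D) →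
        mass (c (n % J)) ≡ n [MOD J] := by
    refine ⟨fun r => if h : ∃ R : ℕ+ →₀ ℕ, mass R ≡ r [MOD J] ∧ ∀ j ∈ R.support, j ∈ D then
      h.choose else 0, fun r => ?_, fun n ⟨R, hR, hRD⟩ => ?_⟩
    · dsimp only
      split_ifs with h
      · exact h.choose_spec.2
      · simp
    · have h : ∃ R : ℕ+ →₀ ℕ, mass R ≡ n % J [MOD J] ∧ ∀ j ∈ R.support, j ∈ D :=
        ⟨R, by rw [hR]; exact (Nat.mod_modEq n J).symm, hRD⟩
      beta_reduce
      rw [dif_pos h]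
      exact h.choose_spec.1.trans (Nat.mod_modEq n J)
  obtain ⟨c, hcD, hcn⟩ := hc
  set T' : Finset ℕ+ := T ∪ (Finset.range J).biUnion fun r => (c r).support with hT'
  have hcT' : ∀ n, (c (n % J)).support ⊆ T' := fun n =>
    (Finset.subset_biUnion_of_mem (fun r => (c r).support)
      (Finset.mem_range.2 (Nat.mod_lt n J.pos))).trans Finset.subset_union_right
  set f : ℕ → ℕ+ → ℕ := fun n j => J * ⌊α j / (J : ℕ) * n⌋₊ with hf
  set B : ℕ → ℕ+ →₀ ℕ := fun n =>
    c (n % J) + ∑ j ∈ T.erase J, Finsupp.single j (f n j) with hB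
  set R : ℕ → ℕ+ →₀ ℕ := fun n => B n + Finsupp.single J ((n - mass (B n)) / J) with hR
  have hn : Tendsto (fun n : ℕ => (n : ℝ)) l atTop := tendsto_natCast_atTop_atTop.mono_left hl
  have hmB : ∀ n, mass (B n) = mass (c (n % J)) + ∑ j ∈ T.erase J, f n j * (j : ℕ) := fun n => by
    simp only [hB, mass_add, mass_sum]
  have hfle : ∀ n j, (f n j : ℝ) ≤ α j * n := fun n j => by
    have h1 : (⌊α j / (J : ℕ) * n⌋₊ : ℝ) ≤ α j / (J : ℕ) * n :=
      Nat.floor_le (by have := hα j; positivity)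
    calc (f n j : ℝ) = (J : ℕ) * (⌊α j / (J : ℕ) * n⌋₊ : ℝ) := by simp [hf]
      _ ≤ (J : ℕ) * (α j / (J : ℕ) * n) := by gcongr
      _ = α j * n := by field_simp
  set Cm : ℕ := ∑ r ∈ Finset.range J, mass (c r) with hCm
  have hcm : ∀ n, mass (c (n % J)) ≤ Cm := fun n =>
    Finset.single_le_sum (f := fun r => mass (c r)) (fun _ _ => Nat.zero_le _)
      (Finset.mem_range.2 (Nat.mod_lt n J.pos))
  have hsum' : ∑ j ∈ T.erase J, (j : ℝ) * α j = 1 - (J : ℝ) * α J := by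
    rw [← hsum, ← Finset.add_sum_erase _ _ hJ]; ring
  have hle : ∀ᶠ n in l, mass (B n) ≤ n := by
    filter_upwards [hn.eventually_ge_atTop ((Cm : ℝ) / ((J : ℝ) * α J))] with n hn
    have h1 : (mass (B n) : ℝ) ≤ Cm + ∑ j ∈ T.erase J, (j : ℝ) * α j * n := by
      rw [hmB, Nat.cast_add, Nat.cast_sum]
      gcongr with j hj
      · exact hcm n
      · rw [Nat.cast_mul]
        calc (f n j : ℝ) * (j : ℕ) ≤ α j * n * (j : ℕ) := by gcongr; exact hfle n j
          _ = _ := by ring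
    rw [← Finset.sum_mul, hsum'] at h1
    rw [div_le_iff₀ (by positivity)] at hn
    have : (mass (B n) : ℝ) ≤ n := by nlinarith
    exact_mod_cast this
  have hmR : ∀ᶠ n in l, mass (R n) = n := by
    filter_upwards [hle, hS] with n h1 h2
    have hmod : mass (B n) ≡ n [MOD J] := by
      have h3 : (J : ℕ) ∣ ∑ j ∈ T.erase J, f n j * (j : ℕ) :=
        Finset.dvd_sum fun j _ => Dvd.dvd.mul_right (Dvd.intro _ rfl) _
      rw [hmB]
      exact ((Nat.ModEq.rfl.add (Nat.modEq_zero_iff_dvd.2 h3)).trans (by rw [add_zero])).trans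
        (hcn n h2)
    have hdvd : (J : ℕ) ∣ n - mass (B n) := (Nat.modEq_iff_dvd' h1).1 hmod
    simp only [hR, mass_add, mass_single, Nat.div_mul_cancel hdvd]
    omega
  have hRT : ∀ n, (R n).support ⊆ T' := by
    intro n j hj
    rcases Finset.mem_union.1 (Finsupp.support_add hj) with h | h
    · rcases Finset.mem_union.1 (Finsupp.support_add h) with h | h
      · exact hcT' n h
      · obtain ⟨k, hk, hk'⟩ := Finset.mem_biUnion.1 (Finsupp.support_finsetSum h)
        have := Finset.mem_singleton.1 (Finsupp.support_single_subset hk')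
        subst this
        exact Finset.mem_union_left _ (Finset.mem_of_mem_erase hk)
    · have := Finset.mem_singleton.1 (Finsupp.support_single_subset h)
      subst this
      exact Finset.mem_union_left _ hJ
  have hlim : ∀ j ∈ T', j ≠ J → Tendsto (fun n => (R n j : ℝ) / n) l (𝓝 (α j)) := by
    intro j _ hjJ
    have h1 : ∀ n, (R n j : ℝ) / n = (c (n % J) j : ℝ) / n +
        (J : ℕ) * ((⌊α j / (J : ℕ) * n⌋₊ : ℝ) / n) := by
      intro n
      have : R n j = c (n % J) j + f n j := by
        simp only [hR, hB, Finsupp.add_apply, Finsupp.single_apply, if_neg hjJ.symm,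
          Finsupp.coe_finsetSum, Finset.sum_apply, add_zero]
        by_cases hjT : j ∈ T
        · rw [Finset.sum_eq_single_of_mem j (Finset.mem_erase.2 ⟨hjJ, hjT⟩)]
          · simp
          · intro k _ hk
            simp [hk]
        · rw [Finset.sum_eq_zero]
          · simp [hf, hαT j hjT]
          · intro k hk
            rw [if_neg]
            rintro rfl
            exact hjT (Finset.mem_of_mem_erase hk)
      rw [this]
      simp only [hf]
      push_cast
      ring
    have h2 : Tendsto (fun n : ℕ => (c (n % J) j : ℝ) / n) l (𝓝 0) := by
      refine squeeze_zero (fun n => by positivity) (fun n => ?_)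
        ((tendsto_const_nhds (x := ((∑ r ∈ Finset.range J, c r j : ℕ) : ℝ))).div_atTop hn)
      gcongr
      exact Finset.single_le_sum (f := fun r => c r j) (fun _ _ => Nat.zero_le _)
        (Finset.mem_range.2 (Nat.mod_lt n J.pos))
    have h3 : Tendsto (fun n : ℕ => ((J : ℕ) : ℝ) * ((⌊α j / (J : ℕ) * n⌋₊ : ℝ) / n)) l
        (𝓝 ((J : ℕ) * (α j / (J : ℕ)))) :=
      ((tendsto_nat_floor_mul_div_atTop (div_nonneg (hα j) hJpos.le)).comp hn).const_mul _
    have h4 := h2.add h3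
    rw [zero_add, mul_div_cancel₀ _ hJpos.ne'] at h4
    exact h4.congr fun n => (h1 n).symm
  have hJT' : J ∈ T' := Finset.mem_union_left _ hJ
  refine ⟨R, T', Finset.subset_union_left, ?_, ?_, ?_⟩
  · intro j hj
    rcases Finset.mem_union.1 hj with h | h
    · exact hT j h
    · obtain ⟨r, _, hr⟩ := Finset.mem_biUnion.1 h
      exact hcD r j hr
  · filter_upwards [hmR] with n h using ⟨h, hRT n⟩
  · intro j hj
    by_cases hjJ : j = J
    · subst hjJ
      -- the count of `J` is determined by the total mass
      have h1 : Tendsto (fun n => (1 - ∑ k ∈ T'.erase j, (k : ℝ) * ((R n k : ℝ) / n)) / (j : ℕ)) l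
          (𝓝 ((1 - ∑ k ∈ T'.erase j, (k : ℝ) * α k) / (j : ℕ))) :=
        (tendsto_const_nhds.sub (tendsto_finsetSum _ fun k hk =>
          (hlim k (Finset.mem_of_mem_erase hk) (Finset.ne_of_mem_erase hk)).const_mul _)).div_const _
      have h2 : ∑ k ∈ T'.erase j, (k : ℝ) * α k = 1 - (j : ℝ) * α j := by
        rw [← hsum']
        refine (Finset.sum_subset (Finset.erase_subset_erase _ Finset.subset_union_left) ?_).symm
        intro k hk hkT
        rw [hαT k, mul_zero]
        exact fun h => hkT (Finset.mem_erase.2 ⟨Finset.ne_of_mem_erase hk, h⟩)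
      have h3 : (1 - ∑ k ∈ T'.erase j, (k : ℝ) * α k) / (j : ℕ) = α j := by
        rw [h2]; field_simp; ring
      rw [h3] at h1
      refine h1.congr' ?_
      filter_upwards [hmR, hn.eventually_gt_atTop 0] with n hm hn0
      rw [mass_eq_sum _ (hRT n), ← Finset.add_sum_erase _ _ hJT'] at hm
      have hm' : (R n j : ℝ) * (j : ℕ) + ∑ k ∈ T'.erase j, (R n k : ℝ) * (k : ℕ) = n := by
        exact_mod_cast hm
      have h5 : ∑ k ∈ T'.erase j, (k : ℝ) * ((R n k : ℝ) / n) =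
          (∑ k ∈ T'.erase j, (R n k : ℝ) * (k : ℕ)) / n := by
        rw [Finset.sum_div]
        exact Finset.sum_congr rfl fun k _ => by ring
      rw [h5]
      field_simp
      linarith
    · exact hlim j hj hjJ

/-- The exponential growth rate of the partition function is at least the entropy of any
finitely supported family of frequencies `α_j` with `∑_j j α_j = 1`. -/
lemma eventually_entropy_le {D : Set ℕ+} {T : Finset ℕ+} (hT : ∀ j ∈ T, j ∈ D) {α : ℕ+ → ℝ}
    (hα : ∀ j, 0 ≤ α j) (hαT : ∀ j, j ∉ T → α j = 0) {J : ℕ+} (hJ : J ∈ T) (hJα : 0 < α J)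
    (hsum : ∑ j ∈ T, (j : ℝ) * α j = 1) {l : Filter ℕ} (hl : l ≤ atTop)
    (hS : ∀ᶠ n in l, ∃ R : ℕ+ →₀ ℕ, mass R = n ∧ ∀ j ∈ R.support, j ∈ D)
    {σ : ℕ+ → ℕ → ℝ} {β : ℕ+ → ℝ} (hβ : ∀ j ∈ D, 0 < β j)
    (hσ : ∀ j ∈ D, Tendsto (fun n => σ j n / n) l (𝓝 (β j))) {logZ : ℕ → ℝ}
    (hZ : ∀ᶠ n in l, ∀ R : ℕ+ →₀ ℕ, mass R = n → (∀ j ∈ R.support, j ∈ D) →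
      ∑ j ∈ R.support, (R j * Real.log (σ j n) - Real.log ((R j).factorial : ℝ)) ≤ logZ n)
    {ε : ℝ} (hε : 0 < ε) :
    ∀ᶠ n in l, ∑ j ∈ T, (α j * Real.log (β j) + Real.negMulLog (α j) + α j) - ε ≤ logZ n / n := by
  obtain ⟨R, T', hTT', hT'D, hR, hlim⟩ := exists_counts hT hα hαT hJ hJα hsum hl hS
  have hRn : ∀ j, ∀ᶠ n in l, R n j ≤ n := by
    intro j
    filter_upwards [hR] with n ⟨hm, hs⟩
    by_cases hj : j ∈ (R n).support
    · calc R n j ≤ R n j * (j : ℕ) := Nat.le_mul_of_pos_right _ j.pos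
        _ ≤ ∑ k ∈ (R n).support, R n k * (k : ℕ) :=
          Finset.single_le_sum (f := fun k => R n k * (k : ℕ)) (fun _ _ => Nat.zero_le _) hj
        _ = n := hm
    · rw [Finsupp.notMem_support_iff.1 hj]
      exact Nat.zero_le _
  have h1 : Tendsto (fun n : ℕ => ∑ j ∈ T', ((R n j * Real.log (σ j n) -
      (R n j * Real.log (R n j) - R n j + Real.log (R n j) + 1)) / (n : ℝ))) l
      (𝓝 (∑ j ∈ T', (α j * Real.log (β j) + Real.negMulLog (α j) + α j))) :=
    tendsto_finsetSum _ fun j hj => tendsto_log_poisson_rate hl (hβ j (hT'D j hj)) (hRn j)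
      (hlim j hj) (hσ j (hT'D j hj))
  have h2 : ∑ j ∈ T', (α j * Real.log (β j) + Real.negMulLog (α j) + α j) =
      ∑ j ∈ T, (α j * Real.log (β j) + Real.negMulLog (α j) + α j) :=
    (Finset.sum_subset hTT' fun j _ hj => by simp [hαT j hj]).symm
  rw [h2] at h1
  filter_upwards [h1.eventually_const_lt (sub_lt_self _ hε), hR, hZ] with n hlt ⟨hm, hs⟩ hZn
  refine hlt.le.trans ?_
  rw [← Finset.sum_div]
  refine div_le_div_of_nonneg_right ?_ (Nat.cast_nonneg n)
  refine le_trans ?_ (hZn (R n) hm fun j hj => hT'D j (hs hj))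
  have h3 : ∑ j ∈ (R n).support, (R n j * Real.log (σ j n) - Real.log ((R n j).factorial : ℝ)) =
      ∑ j ∈ T', (R n j * Real.log (σ j n) - Real.log ((R n j).factorial : ℝ)) :=
    Finset.sum_subset hs fun j _ hj => by simp [Finsupp.notMem_support_iff.1 hj]
  rw [h3]
  refine Finset.sum_le_sum fun j _ => ?_
  have := log_factorial_le (R n j)
  linarith

/-- The optimal frequencies are `a_j = β_j z^j` for the components of microscopic size. The
missing mass `1 - ∑_j j a_j`, if any, is carried by the components of one large size `J`, for
which `J a_J` is not exponentially small. -/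
lemma eventually_rate_le {D : Set ℕ+} {l : Filter ℕ} (hl : l ≤ atTop)
    (hS : ∀ᶠ n in l, ∃ R : ℕ+ →₀ ℕ, mass R = n ∧ ∀ j ∈ R.support, j ∈ D)
    {σ : ℕ+ → ℕ → ℝ} {β : ℕ+ → ℝ} (hβ : ∀ j ∈ D, 0 < β j) (hβD : ∀ j ∉ D, β j = 0)
    (hσ : ∀ j ∈ D, Tendsto (fun n => σ j n / n) l (𝓝 (β j))) {logZ : ℕ → ℝ}
    (hZ : ∀ᶠ n in l, ∀ R : ℕ+ →₀ ℕ, mass R = n → (∀ j ∈ R.support, j ∈ D) →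
      ∑ j ∈ R.support, (R j * Real.log (σ j n) - Real.log ((R j).factorial : ℝ)) ≤ logZ n)
    {z : ℝ} (hz : 0 < z) {M : ℝ}
    (hM : HasSum (fun j : ℕ+ => (j : ℝ) * (β j * z ^ (j : ℕ))) M)
    (hcase : M = 1 ∨ (M < 1 ∧ ∀ ε : ℝ, 0 < ε → ∀ N : ℕ, ∃ J : ℕ+, N < J ∧
      Real.exp (-(ε * (J : ℕ))) ≤ (J : ℝ) * (β J * z ^ (J : ℕ))))
    {ε : ℝ} (hε : 0 < ε) :
    ∀ᶠ n in l, -Real.log z + ∑' j : ℕ+, β j * z ^ (j : ℕ) - ε ≤ logZ n / n := by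
  classical
  set a : ℕ+ → ℝ := fun j => β j * z ^ (j : ℕ) with ha
  have hβ0 : ∀ j, 0 ≤ β j := fun j => by
    by_cases hj : j ∈ D
    · exact (hβ j hj).le
    · exact (hβD j hj).ge
  have ha0 : ∀ j, 0 ≤ a j := fun j => mul_nonneg (hβ0 j) (by positivity)
  have haj : ∀ j : ℕ+, a j ≤ (j : ℝ) * a j := fun j =>
    le_mul_of_one_le_left (ha0 j) (by exact_mod_cast (one_le : 1 ≤ j))
  have has : Summable a := Summable.of_nonneg_of_le ha0 haj hM.summable
  have hM1 : M ≤ 1 := by rcases hcase with h | h; exacts [h.le, h.1.le]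
  -- it is enough to find `J ∈ D` and a finite set `F ⊆ D` with `J ∉ F`
  suffices h : ∃ J ∈ D, ∃ F : Finset ℕ+, (∀ j ∈ F, j ∈ D) ∧ J ∉ F ∧
      0 < 1 - ∑ j ∈ F, (j : ℝ) * a j ∧
      ∑' j, a j - ε / 2 ≤ ∑ j ∈ F, a j + (1 - ∑ j ∈ F, (j : ℝ) * a j) / (J : ℕ) *
        (Real.log (a J) - Real.log ((1 - ∑ j ∈ F, (j : ℝ) * a j) / (J : ℕ)) + 1) by
    obtain ⟨J, hJD, F, hF, hJF, hq, hle⟩ := h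
    set q : ℝ := 1 - ∑ j ∈ F, (j : ℝ) * a j with hqdef
    have hJpos : (0 : ℝ) < (J : ℕ) := by exact_mod_cast J.pos
    set α : ℕ+ → ℝ := fun j => if j = J then q / (J : ℕ) else if j ∈ F then a j else 0 with hα
    have hαJ : α J = q / (J : ℕ) := if_pos rfl
    have hαF : ∀ j ∈ F, α j = a j := fun j hj => by
      simp only [hα]
      rw [if_neg (by rintro rfl; exact hJF hj), if_pos hj]
    have hsum : ∑ j ∈ insert J F, (j : ℝ) * α j = 1 := by
      rw [Finset.sum_insert hJF, hαJ, Finset.sum_congr rfl fun j hj => by rw [hαF j hj],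
        mul_div_cancel₀ _ hJpos.ne', hqdef]
      ring
    have key := eventually_entropy_le (T := insert J F) (α := α) (J := J) (D := D)
      (fun j hj => by
        rcases Finset.mem_insert.1 hj with rfl | h
        exacts [hJD, hF j h])
      (fun j => by
        simp only [hα]
        split_ifs
        exacts [by positivity, ha0 j, le_rfl])
      (fun j hj => by
        simp only [Finset.mem_insert, not_or] at hj
        simp [hα, hj.1, hj.2])
      (Finset.mem_insert_self _ _) (by rw [hαJ]; positivity) hsum hl hS hβ hσ hZ (half_pos hε)
    filter_upwards [key] with n hn
    refine le_trans ?_ hn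
    rw [Finset.sum_insert hJF, hαJ]
    have hFsum : ∑ j ∈ F, (α j * Real.log (β j) + Real.negMulLog (α j) + α j) =
        ∑ j ∈ F, a j - Real.log z * ∑ j ∈ F, (j : ℝ) * a j := by
      rw [Finset.mul_sum, ← Finset.sum_sub_distrib]
      refine Finset.sum_congr rfl fun j hj => ?_
      have hb := hβ j (hF j hj)
      rw [hαF j hj, Real.negMulLog]
      have : Real.log (a j) = Real.log (β j) + (j : ℕ) * Real.log z := by
        simp only [ha]
        rw [Real.log_mul hb.ne' (by positivity), Real.log_pow]
      rw [this]
      ring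
    have hJlog : Real.log (a J) = Real.log (β J) + (J : ℕ) * Real.log z := by
      simp only [ha]
      rw [Real.log_mul (hβ J hJD).ne' (by positivity), Real.log_pow]
    have hqz : q / (J : ℕ) * ((J : ℕ) * Real.log z) = q * Real.log z := by field_simp
    rw [hFsum, Real.negMulLog]
    rw [hJlog] at hle
    have hq' : ∑ j ∈ F, (j : ℝ) * a j = 1 - q := by rw [hqdef]; ring
    rw [hq']
    nlinarith
  rcases hcase with rfl | ⟨hM1', hbig⟩
  · -- no missing mass: `J` is any fixed element of `D`
    obtain ⟨J, hJD⟩ : ∃ J, J ∈ D := by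
      by_contra! h
      have : (fun j : ℕ+ => (j : ℝ) * (β j * z ^ (j : ℕ))) = fun _ => 0 :=
        funext fun j => by rw [hβD j (h j)]; ring
      rw [this] at hM
      exact zero_ne_one (hasSum_zero.unique hM)
    have hJpos : (0 : ℝ) < (J : ℕ) := by exact_mod_cast J.pos
    have haJ : 0 < a J := mul_pos (hβ J hJD) (by positivity)
    have h1 : Tendsto (fun s : Finset ℕ+ => 1 - (∑ j ∈ s, (j : ℝ) * a j - (J : ℝ) * a J)) atTop
        (𝓝 ((J : ℝ) * a J)) := by
      have := (tendsto_const_nhds (x := (1 : ℝ))).sub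
        (Tendsto.sub_const (show Tendsto _ _ _ from hM) ((J : ℝ) * a J))
      rwa [sub_sub_cancel] at this
    have h2 : Tendsto (fun s : Finset ℕ+ => ∑ j ∈ s, a j - a J) atTop
        (𝓝 (∑' j, a j - a J)) := Tendsto.sub_const (show Tendsto _ _ _ from has.hasSum) _
    have h3 : Tendsto (fun s : Finset ℕ+ =>
        (∑ j ∈ s, a j - a J) + (1 - (∑ j ∈ s, (j : ℝ) * a j - (J : ℝ) * a J)) / (J : ℕ) *
        (Real.log (a J) -
          Real.log ((1 - (∑ j ∈ s, (j : ℝ) * a j - (J : ℝ) * a J)) / (J : ℕ)) + 1)) atTop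
        (𝓝 ((∑' j, a j - a J) + (J : ℝ) * a J / (J : ℕ) *
          (Real.log (a J) - Real.log ((J : ℝ) * a J / (J : ℕ)) + 1))) := by
      have h4 := h1.div_const ((J : ℕ) : ℝ)
      refine h2.add (h4.mul ((tendsto_const_nhds.sub
        ((Real.continuousAt_log ?_).tendsto.comp h4)).add_const 1))
      positivity
    have h5 : (∑' j, a j - a J) + (J : ℝ) * a J / (J : ℕ) *
          (Real.log (a J) - Real.log ((J : ℝ) * a J / (J : ℕ)) + 1) = ∑' j, a j := by
      rw [mul_div_cancel_left₀ _ hJpos.ne']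
      ring
    rw [h5] at h3
    obtain ⟨s, hs1, hs2, hs3⟩ := ((h3.eventually_const_lt (sub_lt_self _ (half_pos hε))).and
      ((h1.eventually_const_lt (by positivity : 0 < (J : ℝ) * a J)).and
        (eventually_ge_atTop {J}))).exists
    have hJs : J ∈ s := hs3 (Finset.mem_singleton_self J)
    have hsub : ∀ g : ℕ+ → ℝ, (∀ j, j ∉ D → g j = 0) →
        ∑ j ∈ (s.erase J).filter (· ∈ D), g j = ∑ j ∈ s, g j - g J := fun g hg => by
      rw [Finset.sum_filter_of_ne, ← Finset.add_sum_erase _ _ hJs]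
      · ring
      · intro j _ hj
        by_contra h
        exact hj (hg j h)
    have haD : ∀ j, j ∉ D → a j = 0 := fun j hj => by simp [ha, hβD j hj]
    refine ⟨J, hJD, (s.erase J).filter (· ∈ D), fun j hj => (Finset.mem_filter.1 hj).2, by simp,
      ?_, ?_⟩
    · rw [hsub (fun j => (j : ℝ) * a j) fun j hj => by rw [haD j hj, mul_zero]]
      exact hs2
    · rw [hsub (fun j => (j : ℝ) * a j) fun j hj => by rw [haD j hj, mul_zero], hsub a haD]
      exact hs1.le
  · -- missing mass: `J` is large
    have h2 : Tendsto (fun s : Finset ℕ+ => ∑ j ∈ s, a j) atTop (𝓝 (∑' j, a j)) := has.hasSum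
    obtain ⟨s, hs⟩ := (eventually_atTop.1
      (h2.eventually_const_lt (sub_lt_self _ (by linarith : (0 : ℝ) < ε / 4))))
    obtain ⟨J, hJN, hJ⟩ := hbig (ε / 4) (by linarith) (∑ j ∈ s, (j : ℕ))
    have hJpos : (0 : ℝ) < (J : ℕ) := by exact_mod_cast J.pos
    have hJa : 0 < (J : ℝ) * a J := lt_of_lt_of_le (Real.exp_pos _) hJ
    have hJD : J ∈ D := by
      by_contra h
      simp only [ha, hβD J h] at hJa
      simp at hJa
    have hJs : J ∉ s := fun h => absurd hJN (not_lt.2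
      (Finset.single_le_sum (f := fun j : ℕ+ => (j : ℕ)) (fun _ _ => Nat.zero_le _) h))
    have haD : ∀ j, j ∉ D → a j = 0 := fun j hj => by simp [ha, hβD j hj]
    have hsub : ∀ g : ℕ+ → ℝ, (∀ j, j ∉ D → g j = 0) →
        ∑ j ∈ s.filter (· ∈ D), g j = ∑ j ∈ s, g j := fun g hg => by
      rw [Finset.sum_filter_of_ne]
      intro j _ hj
      by_contra h
      exact hj (hg j h)
    refine ⟨J, hJD, s.filter (· ∈ D), fun j hj => (Finset.mem_filter.1 hj).2,
      fun h => hJs (Finset.mem_filter.1 h).1, ?_⟩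
    rw [hsub (fun j => (j : ℝ) * a j) fun j hj => by rw [haD j hj, mul_zero], hsub a haD]
    have hsM : ∑ j ∈ s, (j : ℝ) * a j ≤ M :=
      sum_le_hasSum s (fun j _ => mul_nonneg (by positivity) (ha0 j)) hM
    have hs0 : 0 ≤ ∑ j ∈ s, (j : ℝ) * a j :=
      Finset.sum_nonneg fun j _ => mul_nonneg (by positivity) (ha0 j)
    set q : ℝ := 1 - ∑ j ∈ s, (j : ℝ) * a j with hq
    have hq0 : 0 < q := by linarith
    have hq1 : q ≤ 1 := by linarith
    refine ⟨hq0, ?_⟩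
    have haJ : 0 < a J := pos_of_mul_pos_right hJa hJpos.le
    have h3 : Real.log (a J) - Real.log (q / (J : ℕ)) + 1 ≥ -(ε / 4 * (J : ℕ)) := by
      have h4 : -(ε / 4 * (J : ℕ)) ≤ Real.log ((J : ℝ) * a J) :=
        (Real.le_log_iff_exp_le hJa).2 hJ
      rw [Real.log_mul hJpos.ne' haJ.ne'] at h4
      rw [Real.log_div hq0.ne' hJpos.ne']
      have := Real.log_nonpos hq0.le hq1
      linarith
    have h5 : q / (J : ℕ) * (Real.log (a J) - Real.log (q / (J : ℕ)) + 1) ≥ -(ε / 4) := by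
      calc q / (J : ℕ) * (Real.log (a J) - Real.log (q / (J : ℕ)) + 1)
          ≥ q / (J : ℕ) * (-(ε / 4 * (J : ℕ))) := by
            exact mul_le_mul_of_nonneg_left h3 (by positivity)
        _ = q * -(ε / 4) := by field_simp
        _ ≥ -(ε / 4) := by nlinarith
    have h6 := hs s le_rfl
    linarith

/-! ### Riemann sums of functions of the Boltzmann factor -/

/-- The Boltzmann factor `e^{-V(x)}` as a real number. -/
def boltzFactor {d : ℕ} (V : (Fin d → ℝ) → ℝ≥0∞) (x : Fin d → ℝ) : ℝ := (boltzmann V 1 x).toReal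

lemma boltzmann_le_one {d : ℕ} (V : (Fin d → ℝ) → ℝ≥0∞) (j : ℕ+) (x : Fin d → ℝ) :
    boltzmann V j x ≤ 1 := by
  rw [boltzmann, EReal.exp_le_one_iff, EReal.neg_le_zero]
  exact EReal.coe_ennreal_nonneg _

lemma boltzmann_ne_top {d : ℕ} (V : (Fin d → ℝ) → ℝ≥0∞) (j : ℕ+) (x : Fin d → ℝ) :
    boltzmann V j x ≠ ⊤ := ne_top_of_le_ne_top ENNReal.one_ne_top (boltzmann_le_one V j x)

lemma ofReal_boltzFactor {d : ℕ} (V : (Fin d → ℝ) → ℝ≥0∞) (x : Fin d → ℝ) :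
    ENNReal.ofReal (boltzFactor V x) = boltzmann V 1 x := ENNReal.ofReal_toReal (boltzmann_ne_top V 1 x)

lemma boltzmann_eq_ofReal {d : ℕ} (V : (Fin d → ℝ) → ℝ≥0∞) (j : ℕ+) (x : Fin d → ℝ) :
    boltzmann V j x = ENNReal.ofReal (boltzFactor V x ^ (j : ℕ)) := by
  rw [boltzmann_eq_pow, ENNReal.ofReal_pow (show 0 ≤ boltzFactor V x from ENNReal.toReal_nonneg),
    ofReal_boltzFactor]

lemma boltzFactor_nonneg {d : ℕ} (V : (Fin d → ℝ) → ℝ≥0∞) (x : Fin d → ℝ) : 0 ≤ boltzFactor V x :=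
  ENNReal.toReal_nonneg

lemma boltzFactor_le_one {d : ℕ} (V : (Fin d → ℝ) → ℝ≥0∞) (x : Fin d → ℝ) : boltzFactor V x ≤ 1 :=
  ENNReal.toReal_le_of_le_ofReal zero_le_one (by simpa using boltzmann_le_one V 1 x)

lemma boltzFactor_mem {d : ℕ} (V : (Fin d → ℝ) → ℝ≥0∞) (x : Fin d → ℝ) :
    boltzFactor V x ∈ Set.Icc (0 : ℝ) 1 := ⟨boltzFactor_nonneg V x, boltzFactor_le_one V x⟩

/-- If the power sums of `u_n` converge to those of `f`, then so do the sums of `u φ(u)` for every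
continuous `φ`, by the Weierstrass approximation theorem. -/
lemma tendsto_sum_mul_comp_of_power_sums {X Ω : Type*} [MeasurableSpace Ω] {μ : Measure Ω}
    {l : Filter ℕ} {u : ℕ → X → ℝ} (hu : ∀ n x, u n x ∈ Set.Icc (0 : ℝ) 1)
    (hus : ∀ᶠ n in l, Summable (u n)) {f : Ω → ℝ} (hf : ∀ x, f x ∈ Set.Icc (0 : ℝ) 1)
    (hfi : Integrable f μ) {c : ℝ}
    (h : ∀ j : ℕ, Tendsto (fun n => (∑' x, u n x ^ (j + 1)) / (n : ℝ)) l
      (𝓝 (c * ∫ x, f x ^ (j + 1) ∂μ)))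
    {φ : ℝ → ℝ} (hφ : ContinuousOn φ (Set.Icc 0 1))
    (hφm : AEStronglyMeasurable (fun x => f x * φ (f x)) μ) :
    Tendsto (fun n => (∑' x, u n x * φ (u n x)) / (n : ℝ)) l (𝓝 (c * ∫ x, f x * φ (f x) ∂μ)) := by
  obtain ⟨Cφ, hCφ⟩ := isCompact_Icc.exists_bound_of_continuousOn hφ
  have hbd : ∀ {ψ : ℝ → ℝ} {C : ℝ}, (∀ y ∈ Set.Icc (0 : ℝ) 1, ‖ψ y‖ ≤ C) → ∀ y ∈ Set.Icc (0 : ℝ) 1,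
      ‖y * ψ y‖ ≤ y * C := fun hψ y hy => by
    rw [norm_mul, Real.norm_of_nonneg hy.1]
    exact mul_le_mul_of_nonneg_left (hψ y hy) hy.1
  have hsumm : ∀ {ψ : ℝ → ℝ} {C : ℝ}, (∀ y ∈ Set.Icc (0 : ℝ) 1, ‖ψ y‖ ≤ C) → ∀ n, Summable (u n) →
      Summable fun x => u n x * ψ (u n x) := fun hψ n hn =>
    Summable.of_norm_bounded (hn.mul_right _) fun x => hbd hψ _ (hu n x)
  -- powers are summable and integrable
  have hpow : ∀ n, Summable (u n) → ∀ j : ℕ, Summable fun x => u n x ^ (j + 1) := fun n hn j =>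
    Summable.of_nonneg_of_le (fun x => pow_nonneg (hu n x).1 _)
      (fun x => pow_le_of_le_one (hu n x).1 (hu n x).2 (by simp)) hn
  have hfpow : ∀ j : ℕ, Integrable (fun x => f x ^ (j + 1)) μ := fun j =>
    hfi.mono (hfi.1.pow _) (Eventually.of_forall fun x => by
      rw [Real.norm_of_nonneg (hf x).1, Real.norm_of_nonneg (pow_nonneg (hf x).1 _)]
      exact pow_le_of_le_one (hf x).1 (hf x).2 (by simp))
  have hfφ : Integrable (fun x => f x * φ (f x)) μ :=
    (hfi.mul_const Cφ).mono' hφm (Eventually.of_forall fun x => hbd hCφ _ (hf x))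
  -- the statement for polynomials
  have hpoly : ∀ p : Polynomial ℝ, Tendsto (fun n => (∑' x, u n x * p.eval (u n x)) / (n : ℝ)) l
      (𝓝 (c * ∫ x, f x * p.eval (f x) ∂μ)) := by
    intro p
    have e1 : ∀ y : ℝ, y * p.eval y = ∑ i ∈ Finset.range (p.natDegree + 1),
        p.coeff i * y ^ (i + 1) := fun y => by
      rw [Polynomial.eval_eq_sum_range, Finset.mul_sum]
      exact Finset.sum_congr rfl fun i _ => by ring
    simp only [e1]
    rw [integral_finsetSum _ fun i _ => (hfpow i).const_mul _, Finset.mul_sum]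
    have h1 : Tendsto (fun n => ∑ i ∈ Finset.range (p.natDegree + 1),
        p.coeff i * ((∑' x, u n x ^ (i + 1)) / (n : ℝ))) l
        (𝓝 (∑ i ∈ Finset.range (p.natDegree + 1), p.coeff i * (c * ∫ x, f x ^ (i + 1) ∂μ))) :=
      tendsto_finsetSum _ fun i _ => (h i).const_mul _
    refine (h1.congr' ?_).trans_eq ?_
    · filter_upwards [hus] with n hn
      rw [Summable.tsum_finsetSum fun i _ => (hpow n hn i).mul_left _, Finset.sum_div]
      exact Finset.sum_congr rfl fun i _ => by rw [tsum_mul_left, mul_div_assoc]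
    · congr 1
      exact Finset.sum_congr rfl fun i _ => by rw [integral_const_mul]; ring
  rw [Metric.tendsto_nhds]
  intro ε hε
  set A : ℝ := |c| * ∫ x, f x ∂μ with hA
  have hf0 : 0 ≤ ∫ x, f x ∂μ := integral_nonneg fun x => (hf x).1
  have hA0 : 0 ≤ A := mul_nonneg (abs_nonneg c) hf0
  have hh0 := h 0
  simp only [zero_add, pow_one] at hh0
  set δ : ℝ := ε / (3 * (A + 1)) with hδ
  have hδ0 : 0 < δ := by positivity
  have hδA : δ * (A + 1) = ε / 3 := by rw [hδ]; field_simp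
  obtain ⟨p, hp⟩ := exists_polynomial_near_of_continuousOn 0 1 φ hφ δ hδ0
  have hp' : ∀ y ∈ Set.Icc (0 : ℝ) 1, ‖φ y - p.eval y‖ ≤ δ := fun y hy => by
    rw [norm_sub_rev]
    exact (hp y hy).le
  obtain ⟨Cp, hCp⟩ := isCompact_Icc.exists_bound_of_continuousOn (s := Set.Icc (0 : ℝ) 1)
    p.continuous.continuousOn
  have hfp : Integrable (fun x => f x * p.eval (f x)) μ :=
    (hfi.mul_const Cp).mono' (hfi.1.mul (p.continuous.comp_aestronglyMeasurable hfi.1))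
      (Eventually.of_forall fun x => hbd hCp _ (hf x))
  have hI : |c * ∫ x, f x * φ (f x) ∂μ - c * ∫ x, f x * p.eval (f x) ∂μ| ≤ δ * A := by
    rw [← mul_sub, ← integral_sub hfφ hfp, abs_mul, hA]
    have : |∫ x, (f x * φ (f x) - f x * p.eval (f x)) ∂μ| ≤ ∫ x, f x * δ ∂μ := by
      rw [← Real.norm_eq_abs]
      refine norm_integral_le_of_norm_le (hfi.mul_const δ) (Eventually.of_forall fun x => ?_)
      rw [← mul_sub]
      exact hbd hp' _ (hf x)
    rw [integral_mul_const] at this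
    calc _ ≤ |c| * ((∫ x, f x ∂μ) * δ) := by gcongr
      _ = _ := by ring
  have hA1 : c * ∫ x, f x ∂μ < A + 1 := by
    have : c * ∫ x, f x ∂μ ≤ A := by rw [hA]; gcongr; exact le_abs_self c
    linarith
  filter_upwards [hus, (Metric.tendsto_nhds.1 (hpoly p)) (ε / 3) (by positivity),
    hh0.eventually_lt_const hA1] with n hn h1 h2
  have hS : |(∑' x, u n x * φ (u n x)) / (n : ℝ) - (∑' x, u n x * p.eval (u n x)) / (n : ℝ)| ≤
      δ * (A + 1) := by
    rw [← sub_div, ← (hsumm hCφ n hn).tsum_sub (hsumm hCp n hn), abs_div, Nat.abs_cast]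
    have : |∑' x, (u n x * φ (u n x) - u n x * p.eval (u n x))| ≤ ∑' x, u n x * δ := by
      rw [← Real.norm_eq_abs]
      refine tsum_of_norm_bounded (hn.mul_right δ).hasSum fun x => ?_
      rw [← mul_sub]
      exact hbd hp' _ (hu n x)
    rw [tsum_mul_right] at this
    calc _ ≤ (∑' x, u n x) * δ / n := by gcongr
      _ = δ * ((∑' x, u n x) / n) := by ring
      _ ≤ _ := by gcongr
  rw [Real.dist_eq] at h1 ⊢
  have hAA : δ * A ≤ ε / 3 := by rw [← hδA]; gcongr; linarith
  rw [hδA] at hS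
  rw [abs_le] at hS hI
  rw [abs_lt] at h1 ⊢
  constructor <;> linarith [hS.1, hS.2, hI.1, hI.2, h1.1, h1.2]

section Potential

variable {d : ℕ} {V : (Fin d → ℝ) → ℝ≥0∞}

lemma PotentialAssumption.aemeasurable_boltzFactor (hV : PotentialAssumption V) :
    AEMeasurable (boltzFactor V) := by
  unfold boltzFactor boltzmann
  have := hV.aemeasurable
  fun_prop

lemma PotentialAssumption.lintegral_eq (hV : PotentialAssumption V) (j : ℕ+) :
    ∫⁻ x, boltzmann V j x = ENNReal.ofReal (∫ x, boltzFactor V x ^ (j : ℕ)) := by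
  have h1 : AEMeasurable (fun x => boltzFactor V x ^ (j : ℕ)) :=
    hV.aemeasurable_boltzFactor.pow_const _
  rw [ofReal_integral_eq_lintegral_ofReal _
    (Eventually.of_forall fun x => pow_nonneg (boltzFactor_nonneg V x) _)]
  · simp only [boltzmann_eq_ofReal]
  · refine ⟨h1.aestronglyMeasurable, ?_⟩
    rw [hasFiniteIntegral_iff_ofReal
      (Eventually.of_forall fun x => pow_nonneg (boltzFactor_nonneg V x) _)]
    simp only [← boltzmann_eq_ofReal]
    exact (hV.integral_ne_top j).lt_top

lemma PotentialAssumption.integrable_pow (hV : PotentialAssumption V) (j : ℕ+) :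
    Integrable fun x => boltzFactor V x ^ (j : ℕ) := by
  refine ⟨(hV.aemeasurable_boltzFactor.pow_const _).aestronglyMeasurable, ?_⟩
  rw [hasFiniteIntegral_iff_ofReal
    (Eventually.of_forall fun x => pow_nonneg (boltzFactor_nonneg V x) _)]
  simp only [← boltzmann_eq_ofReal]
  exact (hV.integral_ne_top j).lt_top

lemma PotentialAssumption.integrable (hV : PotentialAssumption V) :
    Integrable (boltzFactor V) := by
  simpa using hV.integrable_pow 1

lemma PotentialAssumption.aestronglyMeasurable_mul_comp (hV : PotentialAssumption V) {φ : ℝ → ℝ}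
    (hφ : ContinuousOn φ (Set.Icc 0 1)) :
    AEStronglyMeasurable (fun x => boltzFactor V x * φ (boltzFactor V x)) := by
  have hc : Continuous (fun y : ℝ => φ (max 0 (min y 1))) := by
    refine continuousOn_univ.1 (hφ.comp (by fun_prop) fun y _ => ?_)
    exact ⟨le_max_left _ _, max_le zero_le_one (min_le_right _ _)⟩
  have : (fun x => boltzFactor V x * φ (boltzFactor V x)) =
      fun x => boltzFactor V x * (fun y : ℝ => φ (max 0 (min y 1))) (boltzFactor V x) := by
    funext x
    simp only
    rw [min_eq_left (boltzFactor_le_one V x), max_eq_right (boltzFactor_nonneg V x)]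
  rw [this]
  exact hV.integrable.1.mul (hc.comp_aestronglyMeasurable hV.integrable.1)

lemma PotentialAssumption.integrable_mul_comp (hV : PotentialAssumption V) {φ : ℝ → ℝ}
    (hφ : ContinuousOn φ (Set.Icc 0 1)) :
    Integrable (fun x => boltzFactor V x * φ (boltzFactor V x)) := by
  obtain ⟨B, hB⟩ := isCompact_Icc.exists_bound_of_continuousOn hφ
  refine (hV.integrable.mul_const B).mono' (hV.aestronglyMeasurable_mul_comp hφ)
    (Eventually.of_forall fun x => ?_)
  rw [norm_mul, Real.norm_of_nonneg (boltzFactor_nonneg V x)]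
  exact mul_le_mul_of_nonneg_left (hB _ (boltzFactor_mem V x)) (boltzFactor_nonneg V x)

/-- As `V` is continuous at `0` with `V(0) = 0`, the integrals `∫ e^{-jV}` do not decay
exponentially fast. -/
lemma PotentialAssumption.exists_exp_le_integral (hV : PotentialAssumption V) {ε : ℝ}
    (hε : 0 < ε) : ∃ c : ℝ, 0 < c ∧ ∀ j : ℕ+,
      c * Real.exp (-(ε * (j : ℕ))) ≤ ∫ x, boltzFactor V x ^ (j : ℕ) := by
  have h1 : ∀ᶠ x in 𝓝 (0 : Fin d → ℝ), V x < ENNReal.ofReal ε := by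
    refine hV.continuousAt_zero.eventually_lt_const ?_
    rw [hV.map_zero]
    simpa using hε
  obtain ⟨r, hr, hb⟩ := Metric.eventually_nhds_iff_ball.1 h1
  have hvol0 : 0 < (volume (Metric.ball (0 : Fin d → ℝ) r)).toReal :=
    ENNReal.toReal_pos (Metric.measure_ball_pos volume _ hr).ne' measure_ball_lt_top.ne
  refine ⟨_, hvol0, fun j => ?_⟩
  have h2 : ∀ x ∈ Metric.ball (0 : Fin d → ℝ) r, Real.exp (-(ε * (j : ℕ))) ≤
      boltzFactor V x ^ (j : ℕ) := by
    intro x hx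
    have h3 : Real.exp (-ε) ≤ boltzFactor V x := by
      rw [← ENNReal.ofReal_le_ofReal_iff (boltzFactor_nonneg V x), ofReal_boltzFactor,
        ← EReal.exp_coe, boltzmann, EReal.exp_le_exp_iff]
      simp only [PNat.one_coe, Nat.cast_one, one_mul, EReal.coe_neg]
      rw [EReal.neg_le_neg_iff]
      have h4 : ((V x : ℝ≥0∞) : EReal) ≤ ((ENNReal.ofReal ε : ℝ≥0∞) : EReal) :=
        EReal.coe_ennreal_le_coe_ennreal_iff.2 (hb x hx).le
      rwa [EReal.coe_ennreal_ofReal, max_eq_left hε.le] at h4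
    calc Real.exp (-(ε * (j : ℕ))) = Real.exp (-ε) ^ (j : ℕ) := by
          rw [← Real.exp_nat_mul]; ring_nf
      _ ≤ _ := by gcongr
  calc (volume (Metric.ball (0 : Fin d → ℝ) r)).toReal * Real.exp (-(ε * (j : ℕ)))
      = ∫ x in Metric.ball (0 : Fin d → ℝ) r, Real.exp (-(ε * (j : ℕ))) := by
        rw [setIntegral_const, smul_eq_mul]; rfl
    _ ≤ ∫ x in Metric.ball (0 : Fin d → ℝ) r, boltzFactor V x ^ (j : ℕ) :=
        setIntegral_mono_on (integrableOn_const measure_ball_lt_top.ne)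
          (hV.integrable_pow j).integrableOn measurableSet_ball h2
    _ ≤ ∫ x, boltzFactor V x ^ (j : ℕ) :=
        setIntegral_le_integral (hV.integrable_pow j)
          (Eventually.of_forall fun x => pow_nonneg (boltzFactor_nonneg V x) _)

lemma PotentialAssumption.integral_pow_pos (hV : PotentialAssumption V) (j : ℕ+) :
    0 < ∫ x, boltzFactor V x ^ (j : ℕ) := by
  obtain ⟨c, hc, h⟩ := hV.exists_exp_le_integral one_pos
  exact lt_of_lt_of_le (by positivity) (h j)

lemma tendsto_sideLength (hd : 1 ≤ d) {ρ : ℝ≥0} (hρ : 0 < ρ) :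
    Tendsto (sideLength d ρ) atTop atTop := by
  have hρ' : (0 : ℝ) < ρ := hρ
  have hd' : (0 : ℝ) < (d : ℝ)⁻¹ := inv_pos.2 (by exact_mod_cast hd)
  exact (tendsto_rpow_atTop hd').comp (tendsto_natCast_atTop_atTop.atTop_div_const hρ')

lemma sideLength_pow (hd : 1 ≤ d) (ρ : ℝ≥0) (n : ℕ) :
    sideLength d ρ n ^ d = (n : ℝ) / ρ := by
  rw [sideLength, Real.rpow_inv_natCast_pow (by positivity) (by omega)]

lemma PotentialAssumption.tendsto_latticeSum_div (hV : PotentialAssumption V) (hd : 1 ≤ d)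
    {ρ : ℝ≥0} (hρ : 0 < ρ) (j : ℕ+) :
    Tendsto (fun n : ℕ => latticeSum V (sideLength d ρ n) j / ENNReal.ofReal ((n : ℝ) / ρ)) atTop
      (𝓝 (∫⁻ x, boltzmann V j x)) := by
  refine ((hV.riemann_sum j).comp (tendsto_sideLength hd hρ)).congr fun n => ?_
  simp only [Function.comp, sideLength_pow hd, latticeSum, boltzmann_eq_pow V j]

lemma PotentialAssumption.eventually_latticeSum_ne_top (hV : PotentialAssumption V) (hd : 1 ≤ d)
    {ρ : ℝ≥0} (hρ : 0 < ρ) :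
    ∀ᶠ n : ℕ in atTop, latticeSum V (sideLength d ρ n) 1 ≠ ⊤ := by
  filter_upwards [(hV.tendsto_latticeSum_div hd hρ 1).eventually_lt_const
    (hV.integral_ne_top 1).lt_top] with n hn h
  simp only [PNat.one_coe] at hn
  rw [h, ENNReal.top_div_of_ne_top ENNReal.ofReal_ne_top] at hn
  exact lt_irrefl _ hn

lemma PotentialAssumption.eventually_summable (hV : PotentialAssumption V) (hd : 1 ≤ d)
    {ρ : ℝ≥0} (hρ : 0 < ρ) :
    ∀ᶠ n : ℕ in atTop, Summable fun x => boltzFactor V (scaledPoint (sideLength d ρ n) x) := by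
  filter_upwards [hV.eventually_latticeSum_ne_top hd hρ] with n hn
  simp only [latticeSum, pow_one] at hn
  exact ENNReal.summable_toReal hn

lemma latticeSum_toReal (L : ℝ) (j : ℕ) :
    (latticeSum V L j).toReal = ∑' x, boltzFactor V (scaledPoint L x) ^ j := by
  rw [latticeSum, ENNReal.tsum_toReal_eq fun x => ENNReal.pow_ne_top (boltzmann_ne_top V 1 _)]
  simp [boltzFactor]

lemma PotentialAssumption.tendsto_power_sum (hV : PotentialAssumption V) (hd : 1 ≤ d)
    {ρ : ℝ≥0} (hρ : 0 < ρ) (j : ℕ+) :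
    Tendsto (fun n : ℕ => (latticeSum V (sideLength d ρ n) j).toReal / (n : ℝ)) atTop
      (𝓝 ((ρ : ℝ)⁻¹ * ∫ x, boltzFactor V x ^ (j : ℕ))) := by
  have hρ' : (0 : ℝ) < ρ := hρ
  have h1 := ((ENNReal.tendsto_toReal (hV.integral_ne_top j)).comp
    (hV.tendsto_latticeSum_div hd hρ j)).const_mul (ρ : ℝ)⁻¹
  rw [hV.lintegral_eq, ENNReal.toReal_ofReal
    (integral_nonneg fun x => pow_nonneg (boltzFactor_nonneg V x) _)] at h1
  refine h1.congr fun n => ?_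
  simp only [Function.comp, ENNReal.toReal_div]
  rw [ENNReal.toReal_ofReal (by positivity)]
  field_simp

/-- Convergence of the Riemann sums of `u φ(u)`, where `u = e^{-V}` and `φ` is continuous. -/
lemma PotentialAssumption.tendsto_riemann (hV : PotentialAssumption V) (hd : 1 ≤ d)
    {ρ : ℝ≥0} (hρ : 0 < ρ) {φ : ℝ → ℝ} (hφ : ContinuousOn φ (Set.Icc 0 1)) :
    Tendsto (fun n : ℕ => (∑' x, boltzFactor V (scaledPoint (sideLength d ρ n) x) *
        φ (boltzFactor V (scaledPoint (sideLength d ρ n) x))) / (n : ℝ)) atTop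
      (𝓝 ((ρ : ℝ)⁻¹ * ∫ x, boltzFactor V x * φ (boltzFactor V x))) := by
  refine tendsto_sum_mul_comp_of_power_sums
    (u := fun n x => boltzFactor V (scaledPoint (sideLength d ρ n) x))
    (fun n x => boltzFactor_mem V _) (hV.eventually_summable hd hρ) (boltzFactor_mem V)
    hV.integrable (fun j => ?_) hφ ?_
  · have := hV.tendsto_power_sum hd hρ (Nat.succPNat j)
    simp only [latticeSum_toReal, Nat.succPNat_coe, Nat.succ_eq_add_one] at this
    exact this
  · exact hV.aestronglyMeasurable_mul_comp hφ

end Potential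

/-! ### The limiting fugacity -/

/-- For a power series with nonnegative coefficients and without constant term, the largest `z`
at which the sum is at most `ρ`. The sum equals `ρ` there unless `z` is the radius of
convergence. -/
lemma exists_largest_fugacity {b : ℕ+ → ℝ} (hb : ∀ j, 0 ≤ b j) (hb0 : ∃ j, 0 < b j)
    {y : ℝ} (hy : 0 < y) (hys : Summable fun j : ℕ+ => b j * y ^ (j : ℕ)) {ρ : ℝ} (hρ : 0 < ρ) :
    ∃ z : ℝ, 0 < z ∧ (Summable fun j : ℕ+ => b j * z ^ (j : ℕ)) ∧
      (∑' j : ℕ+, b j * z ^ (j : ℕ) = ρ ∨ (∑' j : ℕ+, b j * z ^ (j : ℕ) < ρ ∧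
        ∀ w, z < w → ¬ Summable fun j : ℕ+ => b j * w ^ (j : ℕ))) := by
  set S : Set ℝ := {z | 0 ≤ z ∧ ∀ F : Finset ℕ+, ∑ j ∈ F, b j * z ^ (j : ℕ) ≤ ρ} with hS
  have hnn : ∀ {w : ℝ}, 0 ≤ w → ∀ j : ℕ+, 0 ≤ b j * w ^ (j : ℕ) := fun hw j =>
    mul_nonneg (hb j) (pow_nonneg hw _)
  have hmem : ∀ {w : ℝ}, 0 ≤ w → (Summable fun j : ℕ+ => b j * w ^ (j : ℕ)) →
      ∑' j : ℕ+, b j * w ^ (j : ℕ) ≤ ρ → w ∈ S := fun hw hs hle =>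
    ⟨hw, fun F => (hs.sum_le_tsum F fun j _ => hnn hw j).trans hle⟩
  have hclosed : IsClosed S := by
    have : S = Set.Ici 0 ∩ ⋂ F : Finset ℕ+, {z | ∑ j ∈ F, b j * z ^ (j : ℕ) ≤ ρ} := by
      ext z; simp [hS]
    rw [this]
    refine isClosed_Ici.inter (isClosed_iInter fun F => ?_)
    exact isClosed_le (by fun_prop) continuous_const
  have hbdd : BddAbove S := by
    obtain ⟨j, hj⟩ := hb0
    refine ⟨max 1 (ρ / b j), fun z hz => ?_⟩
    by_contra! h
    have h1 : 1 ≤ z := (le_max_left _ _).trans h.le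
    have h2 : ρ / b j < z := (le_max_right _ _).trans_lt h
    have h3 : z ≤ z ^ (j : ℕ) := le_self_pow₀ h1 j.pos.ne'
    have h4 := hz.2 {j}
    rw [Finset.sum_singleton] at h4
    rw [div_lt_iff₀ hj] at h2
    nlinarith
  have hpos : ∃ w ∈ S, 0 < w := by
    set A := ∑' j : ℕ+, b j * y ^ (j : ℕ) with hA
    have hA0 : 0 ≤ A := tsum_nonneg fun j => hnn hy.le j
    set s : ℝ := ρ / (ρ + A) with hs
    have hs0 : 0 < s := by positivity
    have hs1 : s ≤ 1 := by rw [hs, div_le_one (by positivity)]; linarith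
    have hle : ∀ j : ℕ+, b j * (s * y) ^ (j : ℕ) ≤ s * (b j * y ^ (j : ℕ)) := fun j => by
      rw [mul_pow]
      have : s ^ (j : ℕ) ≤ s := pow_le_of_le_one hs0.le hs1 j.pos.ne'
      have h2 := hnn hy.le j
      nlinarith
    have hsum : Summable fun j : ℕ+ => b j * (s * y) ^ (j : ℕ) :=
      Summable.of_nonneg_of_le (hnn (by positivity)) hle (hys.mul_left s)
    refine ⟨s * y, hmem (by positivity) hsum ?_, by positivity⟩
    refine (hsum.tsum_le_tsum hle (hys.mul_left s)).trans ?_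
    rw [tsum_mul_left, ← hA, hs, div_mul_eq_mul_div, div_le_iff₀ (by positivity)]
    nlinarith
  obtain ⟨w0, hw0S, hw0⟩ := hpos
  have hzS : sSup S ∈ S := hclosed.csSup_mem ⟨w0, hw0S⟩ hbdd
  set z := sSup S with hz
  have hz0 : 0 < z := hw0.trans_le (le_csSup hbdd hw0S)
  have hzs : Summable fun j : ℕ+ => b j * z ^ (j : ℕ) :=
    summable_of_sum_le (hnn hz0.le) hzS.2
  have hzle : ∑' j : ℕ+, b j * z ^ (j : ℕ) ≤ ρ := hzs.tsum_le_of_sum_le hzS.2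
  refine ⟨z, hz0, hzs, ?_⟩
  rcases hzle.eq_or_lt with h | h
  · exact Or.inl h
  refine Or.inr ⟨h, fun w hw hws => ?_⟩
  -- by convexity, the sum is still at most `ρ` slightly beyond `z`
  set A := ∑' j : ℕ+, b j * z ^ (j : ℕ) with hA
  set B := ∑' j : ℕ+, b j * w ^ (j : ℕ) with hB
  have hAB : A ≤ B := hzs.tsum_le_tsum
    (fun j => mul_le_mul_of_nonneg_left (pow_le_pow_left₀ hz0.le hw.le _) (hb j)) hws
  set s : ℝ := (ρ - A) / ((ρ - A) + (B - A)) with hs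
  have hden : 0 < (ρ - A) + (B - A) := by linarith
  have hs0 : 0 < s := div_pos (by linarith) hden
  have hs1 : s ≤ 1 := by rw [hs, div_le_one hden]; linarith
  have hv : z < (1 - s) * z + s * w := by nlinarith
  have hle : ∀ j : ℕ+, b j * ((1 - s) * z + s * w) ^ (j : ℕ) ≤
      (1 - s) * (b j * z ^ (j : ℕ)) + s * (b j * w ^ (j : ℕ)) := fun j => by
    have h1 := (convexOn_pow (𝕜 := ℝ) (j : ℕ)).2 (Set.mem_Ici.2 hz0.le)
      (Set.mem_Ici.2 (hz0.trans hw).le) (sub_nonneg.2 hs1) hs0.le (by ring)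
    simp only [smul_eq_mul] at h1
    calc _ ≤ b j * ((1 - s) * z ^ (j : ℕ) + s * w ^ (j : ℕ)) :=
          mul_le_mul_of_nonneg_left h1 (hb j)
      _ = _ := by ring
  have hsum2 := (hzs.mul_left (1 - s)).add (hws.mul_left s)
  have hsum : Summable fun j : ℕ+ => b j * ((1 - s) * z + s * w) ^ (j : ℕ) :=
    Summable.of_nonneg_of_le (hnn (hz0.trans hv).le) hle hsum2
  refine absurd (le_csSup hbdd (hmem (hz0.trans hv).le hsum ?_)) (not_le.2 hv)
  refine (hsum.tsum_le_tsum hle hsum2).trans ?_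
  rw [(hzs.mul_left _).tsum_add (hws.mul_left _), tsum_mul_left, tsum_mul_left, ← hA, ← hB]
  have : s * (B - A) ≤ ρ - A := by
    rw [hs, div_mul_eq_mul_div, div_le_iff₀ hden]
    nlinarith
  linarith

/-- If `z` is the radius of convergence, then the terms at `z` are not exponentially small. -/
lemma exists_exp_le_of_not_summable {b : ℕ+ → ℝ} (hb : ∀ j, 0 ≤ b j) {z : ℝ} (hz : 0 < z)
    (h : ∀ w, z < w → ¬ Summable fun j : ℕ+ => b j * w ^ (j : ℕ)) {ρ : ℝ} (hρ : 0 < ρ)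
    {ε : ℝ} (hε : 0 < ε) (N : ℕ) :
    ∃ J : ℕ+, N < J ∧ Real.exp (-(ε * (J : ℕ))) ≤ ρ⁻¹ * (b J * z ^ (J : ℕ)) := by
  by_contra! hcon
  refine h (z * Real.exp (ε / 2)) (lt_mul_of_one_lt_right hz (Real.one_lt_exp_iff.2 (by linarith)))
    ?_
  have hgeo : Summable fun j : ℕ+ => ρ * Real.exp (-(ε / 2)) ^ (j : ℕ) :=
    ((summable_geometric_of_lt_one (Real.exp_pos _).le
      (Real.exp_lt_one_iff.2 (by linarith))).comp_injective PNat.coe_injective).mul_left ρ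
  refine Summable.of_norm_bounded_eventually hgeo ?_
  have hfin : {j : ℕ+ | (j : ℕ) ≤ N}.Finite :=
    (Set.finite_le_nat N).preimage PNat.coe_injective.injOn
  filter_upwards [hfin.compl_mem_cofinite] with j hj
  have hj' : N < (j : ℕ) := not_le.1 hj
  have h1 := hcon j hj'
  rw [Real.norm_of_nonneg (mul_nonneg (hb j) (by positivity)), mul_pow, ← mul_assoc]
  rw [inv_mul_lt_iff₀ hρ] at h1
  calc b j * z ^ (j : ℕ) * Real.exp (ε / 2) ^ (j : ℕ)
      ≤ ρ * Real.exp (-(ε * (j : ℕ))) * Real.exp (ε / 2) ^ (j : ℕ) := by gcongr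
    _ = ρ * Real.exp (-(ε / 2)) ^ (j : ℕ) := by
      rw [mul_assoc, ← Real.exp_nat_mul, ← Real.exp_nat_mul, ← Real.exp_add]
      ring_nf

section Fugacity

variable {d : ℕ} {V : (Fin d → ℝ) → ℝ≥0∞} {θ : ℕ+ → ℝ≥0}

/-- The coefficient `θ_j ∫ e^{-jV}` of the power series `ρ(z)`. -/
def densityCoeff (V : (Fin d → ℝ) → ℝ≥0∞) (θ : ℕ+ → ℝ≥0) (j : ℕ+) : ℝ :=
  (θ j : ℝ) * ∫ x, boltzFactor V x ^ (j : ℕ)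

lemma densityCoeff_nonneg (j : ℕ+) : 0 ≤ densityCoeff V θ j :=
  mul_nonneg (θ j).2 (integral_nonneg fun x => pow_nonneg (boltzFactor_nonneg V x) _)

lemma PotentialAssumption.density_ofReal (hV : PotentialAssumption V) {z : ℝ} (hz : 0 ≤ z) :
    density V θ (ENNReal.ofReal z) =
      ∑' j : ℕ+, ENNReal.ofReal (densityCoeff V θ j * z ^ (j : ℕ)) := by
  refine tsum_congr fun j => ?_
  rw [hV.lintegral_eq, ENNReal.ofReal_mul (densityCoeff_nonneg j), densityCoeff,
    ENNReal.ofReal_mul (NNReal.coe_nonneg (θ j)), ENNReal.ofReal_pow hz, ENNReal.ofReal_coe_nnreal]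
  ring

lemma PotentialAssumption.density_eq_ofReal (hV : PotentialAssumption V) {z : ℝ} (hz : 0 ≤ z)
    (h : Summable fun j : ℕ+ => densityCoeff V θ j * z ^ (j : ℕ)) :
    density V θ (ENNReal.ofReal z) =
      ENNReal.ofReal (∑' j : ℕ+, densityCoeff V θ j * z ^ (j : ℕ)) := by
  rw [hV.density_ofReal hz, ENNReal.ofReal_tsum_of_nonneg _ h]
  exact fun j => mul_nonneg (densityCoeff_nonneg j) (pow_nonneg hz _)

lemma density_mono {w w' : ℝ≥0∞} (h : w ≤ w') : density V θ w ≤ density V θ w' :=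
  ENNReal.tsum_le_tsum fun j => by gcongr

lemma PotentialAssumption.summable_of_density_ne_top (hV : PotentialAssumption V) {y : ℝ}
    (hy : 0 ≤ y) {w : ℝ≥0∞} (hw : ENNReal.ofReal y ≤ w) (h : density V θ w ≠ ⊤) :
    Summable fun j : ℕ+ => densityCoeff V θ j * y ^ (j : ℕ) := by
  have h1 := ne_top_of_le_ne_top h (density_mono hw)
  rw [hV.density_ofReal hy] at h1
  have h2 := ENNReal.summable_toReal h1
  refine h2.congr fun j => ENNReal.toReal_ofReal ?_
  exact mul_nonneg (densityCoeff_nonneg j) (pow_nonneg hy _)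

/-- The fugacity `z` of the infinite system: `ρ(z) = ρ` if possible, and the radius of convergence
otherwise. The condensate fraction is `1 - ρ(z) / ρ`. -/
lemma PotentialAssumption.exists_fugacity (hV : PotentialAssumption V) (hθ : ∃ j, θ j ≠ 0)
    (hz : 0 < criticalFugacity V θ) {ρ : ℝ≥0} (hρ : 0 < ρ) :
    ∃ z : ℝ, 0 < z ∧ (Summable fun j : ℕ+ => densityCoeff V θ j * z ^ (j : ℕ)) ∧
      ((ρ : ℝ)⁻¹ * ∑' j : ℕ+, densityCoeff V θ j * z ^ (j : ℕ) = 1 ∨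
        ((ρ : ℝ)⁻¹ * ∑' j : ℕ+, densityCoeff V θ j * z ^ (j : ℕ) < 1 ∧
          ∀ ε : ℝ, 0 < ε → ∀ N : ℕ, ∃ J : ℕ+, N < J ∧
            Real.exp (-(ε * (J : ℕ))) ≤ (ρ : ℝ)⁻¹ * (densityCoeff V θ J * z ^ (J : ℕ)))) ∧
      (((1 - ENNReal.ofReal ((ρ : ℝ)⁻¹ * ∑' j : ℕ+, densityCoeff V θ j * z ^ (j : ℕ)) : ℝ≥0∞) :
        EReal) = max 0 (1 - ((criticalDensity V θ / (ρ : ℝ≥0∞) : ℝ≥0∞) : EReal))) := by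
  have hρ' : (0 : ℝ) < ρ := hρ
  have hb0 : ∃ j, 0 < densityCoeff V θ j := by
    obtain ⟨j, hj⟩ := hθ
    exact ⟨j, mul_pos (by exact_mod_cast pos_iff_ne_zero.2 hj) (hV.integral_pow_pos j)⟩
  obtain ⟨w, hw, hw0⟩ := lt_sSup_iff.1 hz
  obtain ⟨y, hy0, hyw⟩ := ENNReal.lt_iff_exists_nnreal_btwn.1 hw0
  have hy : (0 : ℝ) < y := by exact_mod_cast hy0
  have hys := hV.summable_of_density_ne_top hy.le (by
    rw [ENNReal.ofReal_coe_nnreal]; exact hyw.le) hw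
  obtain ⟨z, hz0, hzs, hcase⟩ := exists_largest_fugacity densityCoeff_nonneg hb0 hy hys hρ'
  refine ⟨z, hz0, hzs, ?_, ?_⟩
  · rcases hcase with h | ⟨h, hns⟩
    · left
      rw [h, inv_mul_cancel₀ hρ'.ne']
    · right
      refine ⟨by rwa [inv_mul_lt_iff₀ hρ', mul_one], fun ε hε N => ?_⟩
      exact exists_exp_le_of_not_summable densityCoeff_nonneg hz0 hns hρ' hε N
  · have hzd := hV.density_eq_ofReal hz0.le hzs
    have hzc : ENNReal.ofReal z ≤ criticalFugacity V θ :=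
      le_sSup (by rw [Set.mem_ofPred_eq, hzd]; exact ENNReal.ofReal_ne_top)
    set A := ∑' j : ℕ+, densityCoeff V θ j * z ^ (j : ℕ) with hA
    have hA0 : 0 ≤ A := tsum_nonneg fun j => mul_nonneg (densityCoeff_nonneg j) (by positivity)
    rcases hcase with h | ⟨h, hns⟩
    · have h1 : (1 : ℝ≥0∞) ≤ criticalDensity V θ / (ρ : ℝ≥0∞) := by
        rw [ENNReal.le_div_iff_mul_le (Or.inl (by simpa using hρ.ne')) (Or.inl (by simp)), one_mul]
        have := density_mono (V := V) (θ := θ) hzc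
        rw [hzd, h, ENNReal.ofReal_coe_nnreal] at this
        exact this
      rw [h, inv_mul_cancel₀ hρ'.ne', ENNReal.ofReal_one, tsub_self, max_eq_left]
      · rfl
      · rw [EReal.sub_nonpos]
        exact_mod_cast h1
    · have hzc' : criticalFugacity V θ = ENNReal.ofReal z := by
        refine le_antisymm (sSup_le fun w hw => ?_) hzc
        by_contra! hlt
        obtain ⟨y, hy0, hyw⟩ := ENNReal.lt_iff_exists_nnreal_btwn.1 hlt
        refine hns y ?_ (hV.summable_of_density_ne_top y.2 ?_ hw)
        · rwa [← ENNReal.ofReal_coe_nnreal, ENNReal.ofReal_lt_ofReal_iff_of_nonneg hz0.le] at hy0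
        · rw [ENNReal.ofReal_coe_nnreal]; exact hyw.le
      have h2 : criticalDensity V θ / (ρ : ℝ≥0∞) = ENNReal.ofReal ((ρ : ℝ)⁻¹ * A) := by
        rw [criticalDensity, hzc', hzd, ENNReal.ofReal_mul (by positivity),
          ENNReal.ofReal_inv_of_pos hρ', ENNReal.ofReal_coe_nnreal, div_eq_mul_inv, mul_comm]
      have h3 : (ρ : ℝ)⁻¹ * A ≤ 1 := by rw [inv_mul_le_iff₀ hρ', mul_one]; exact h.le
      have h4 : 0 ≤ (ρ : ℝ)⁻¹ * A := by positivity
      rw [h2, ← ENNReal.ofReal_one, ← ENNReal.ofReal_sub _ h4]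
      rw [EReal.coe_ennreal_ofReal, EReal.coe_ennreal_ofReal, max_eq_left (by linarith),
        max_eq_left h4, max_eq_right]
      · rfl
      · rw [← EReal.coe_one, ← EReal.coe_sub]
        exact_mod_cast sub_nonneg.2 h3

/-- Strictly below `z`, the series `∑ θ_j y^j` converges, since the integrals `∫ e^{-jV}` do not
decay exponentially. -/
lemma PotentialAssumption.summable_theta (hV : PotentialAssumption V) {y z : ℝ} (hy : 0 < y)
    (hyz : y < z) (hz : Summable fun j : ℕ+ => densityCoeff V θ j * z ^ (j : ℕ)) :
    Summable fun j : ℕ+ => (θ j : ℝ) * y ^ (j : ℕ) := by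
  have hz0 : 0 < z := hy.trans hyz
  obtain ⟨c, hc, h⟩ := hV.exists_exp_le_integral
    (Real.log_pos ((one_lt_div hy).2 hyz))
  refine Summable.of_nonneg_of_le (fun j => by positivity) (fun j => ?_) (hz.mul_left c⁻¹)
  have h1 := h j
  have h2 : Real.exp (-(Real.log (z / y) * (j : ℕ))) = (y / z) ^ (j : ℕ) := by
    rw [← neg_mul, ← Real.log_inv, inv_div, Real.exp_mul, Real.exp_log (by positivity),
      Real.rpow_natCast]
  rw [h2, div_pow, mul_div_assoc', div_le_iff₀ (by positivity)] at h1
  rw [densityCoeff, ← div_eq_inv_mul, le_div_iff₀ hc]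
  calc (θ j : ℝ) * y ^ (j : ℕ) * c = θ j * (c * y ^ (j : ℕ)) := by ring
    _ ≤ θ j * ((∫ x, boltzFactor V x ^ (j : ℕ)) * z ^ (j : ℕ)) := by gcongr
    _ = _ := by ring

end Fugacity

/-! ### Asymptotics of the partition function -/

section Asymptotics

variable {d : ℕ} {V : (Fin d → ℝ) → ℝ≥0∞} {θ : ℕ+ → ℝ≥0}

lemma PotentialAssumption.one_le_latticeSum (hV : PotentialAssumption V) (L : ℝ) (j : ℕ) :
    1 ≤ latticeSum V L j := by
  refine le_trans (le_of_eq ?_) (ENNReal.le_tsum (0 : Fin d → ℤ))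
  have : scaledPoint L (0 : Fin d → ℤ) = 0 := by
    funext i; simp [scaledPoint]
  rw [this, boltzmann, hV.map_zero]
  simp

lemma latticeSum_le {L : ℝ} (j : ℕ+) : latticeSum V L j ≤ latticeSum V L 1 :=
  ENNReal.tsum_le_tsum fun x => by
    rw [pow_one]
    exact pow_le_of_le_one zero_le (boltzmann_le_one V 1 _) j.pos.ne'

lemma thermoLimit_le (ρ : ℝ≥0) : thermoLimit V θ ρ ≤ atTop := inf_le_left

lemma eventually_thermoLimit (ρ : ℝ≥0) : ∀ᶠ n in thermoLimit V θ ρ,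
    partitionFunction V θ (sideLength d ρ n) n ≠ 0 ∧
      partitionFunction V θ (sideLength d ρ n) n ≠ ⊤ :=
  mem_inf_of_right (mem_principal_self _)

/-- The lower bound for the partition function: its exponential growth rate is at least
`-log z + ρ⁻¹ ∑_j (θ_j / j) z^j ∫ e^{-jV}`. -/
lemma PotentialAssumption.eventually_le_log_partitionFunction (hV : PotentialAssumption V)
    (hd : 1 ≤ d) {ρ : ℝ≥0} (hρ : 0 < ρ) {z : ℝ} (hz : 0 < z)
    (hzs : Summable fun j : ℕ+ => densityCoeff V θ j * z ^ (j : ℕ))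
    (hcase : (ρ : ℝ)⁻¹ * ∑' j : ℕ+, densityCoeff V θ j * z ^ (j : ℕ) = 1 ∨
        ((ρ : ℝ)⁻¹ * ∑' j : ℕ+, densityCoeff V θ j * z ^ (j : ℕ) < 1 ∧
          ∀ ε : ℝ, 0 < ε → ∀ N : ℕ, ∃ J : ℕ+, N < J ∧
            Real.exp (-(ε * (J : ℕ))) ≤ (ρ : ℝ)⁻¹ * (densityCoeff V θ J * z ^ (J : ℕ))))
    {ε : ℝ} (hε : 0 < ε) :
    ∀ᶠ n in thermoLimit V θ ρ,
      -Real.log z + ∑' j : ℕ+, (ρ : ℝ)⁻¹ * densityCoeff V θ j / (j : ℕ) * z ^ (j : ℕ) - ε ≤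
        Real.log (partitionFunction V θ (sideLength d ρ n) n).toReal / n := by
  have hρ' : (0 : ℝ) < ρ := hρ
  have hβj : ∀ j : ℕ+, (j : ℝ) * ((ρ : ℝ)⁻¹ * densityCoeff V θ j / (j : ℕ) * z ^ (j : ℕ)) =
      (ρ : ℝ)⁻¹ * (densityCoeff V θ j * z ^ (j : ℕ)) := fun j => by
    have : ((j : ℕ) : ℝ) ≠ 0 := by exact_mod_cast j.pos.ne'
    field_simp
  refine eventually_rate_le (D := {j | θ j ≠ 0}) (thermoLimit_le ρ)
    (σ := fun j n => (θ j : ℝ) / (j : ℕ) * (latticeSum V (sideLength d ρ n) j).toReal)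
    (logZ := fun n => Real.log (partitionFunction V θ (sideLength d ρ n) n).toReal)
    (M := (ρ : ℝ)⁻¹ * ∑' j : ℕ+, densityCoeff V θ j * z ^ (j : ℕ)) ?_ ?_ ?_ ?_ ?_ hz ?_ ?_ hε
  · filter_upwards [eventually_thermoLimit ρ] with n hn
    exact exists_counts_of_partitionFunction_ne_zero hn.1
  · intro j hj
    have h1 : (0 : ℝ) < θ j := by exact_mod_cast pos_iff_ne_zero.2 hj
    have h2 := hV.integral_pow_pos j
    have h3 : (0 : ℝ) < (j : ℕ) := by exact_mod_cast j.pos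
    unfold densityCoeff
    positivity
  · intro j hj
    have : θ j = 0 := by simpa using hj
    simp [densityCoeff, this]
  · intro j _
    have h1 := ((hV.tendsto_power_sum hd hρ j).const_mul ((θ j : ℝ) / (j : ℕ))).mono_left
      (thermoLimit_le (V := V) (θ := θ) ρ)
    refine (h1.congr fun n => by ring).trans_eq ?_
    rw [densityCoeff]
    congr 1
    ring
  · filter_upwards [eventually_thermoLimit ρ,
      (hV.eventually_latticeSum_ne_top hd hρ).filter_mono (thermoLimit_le (V := V) (θ := θ) ρ)]
      with n hn hS R hm hR
    have hle := poissonWeight_le_partitionFunction V θ (sideLength d ρ n) R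
    rw [hm] at hle
    have hle' := ENNReal.toReal_mono hn.2 hle
    rw [poissonWeight_eq_prod _ _ subset_rfl, ENNReal.toReal_prod] at hle'
    have hσ : ∀ j ∈ R.support, 0 < (θ j : ℝ) / (j : ℕ) *
        (latticeSum V (sideLength d ρ n) j).toReal := by
      intro j hj
      have h1 : (0 : ℝ) < θ j := by exact_mod_cast pos_iff_ne_zero.2 (hR j hj)
      have h3 : (0 : ℝ) < (j : ℕ) := by exact_mod_cast j.pos
      have h4 : 0 < (latticeSum V (sideLength d ρ n) j).toReal :=
        ENNReal.toReal_pos (zero_lt_one.trans_le (hV.one_le_latticeSum _ _)).ne'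
          (ne_top_of_le_ne_top hS (latticeSum_le j))
      positivity
    have hterm : ∀ j, ((((R j).factorial : ℝ≥0∞))⁻¹ * ((θ j : ℝ≥0∞) / ((j : ℕ) : ℝ≥0∞) *
        latticeSum V (sideLength d ρ n) j) ^ R j).toReal =
        ((R j).factorial : ℝ)⁻¹ * ((θ j : ℝ) / (j : ℕ) *
          (latticeSum V (sideLength d ρ n) j).toReal) ^ R j := fun j => by
      simp [ENNReal.toReal_mul, ENNReal.toReal_div]
    simp only [hterm] at hle'
    have hpos : ∀ j ∈ R.support, 0 < ((R j).factorial : ℝ)⁻¹ * ((θ j : ℝ) / (j : ℕ) *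
          (latticeSum V (sideLength d ρ n) j).toReal) ^ R j := fun j hj => by
      have := hσ j hj
      have := (R j).factorial_pos
      positivity
    refine le_trans (le_of_eq ?_) (Real.log_le_log (Finset.prod_pos hpos) hle')
    rw [Real.log_prod fun j hj => (hpos j hj).ne']
    refine Finset.sum_congr rfl fun j hj => ?_
    rw [Real.log_mul (by positivity) (pow_pos (hσ j hj) _).ne', Real.log_inv, Real.log_pow]
    ring
  · simp only [hβj]
    exact hzs.hasSum.mul_left _
  · simpa only [hβj] using hcase

/-- The logarithm `∑_j (θ_j / j) w^j` of the grand-canonical partition function of a site. -/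
def logSite (θ : ℕ+ → ℝ≥0) (w : ℝ) : ℝ := ∑' j : ℕ+, (θ j : ℝ) / (j : ℕ) * w ^ (j : ℕ)

lemma div_mul_pow_le {w : ℝ} (hw : 0 ≤ w) (j : ℕ+) :
    (θ j : ℝ) / (j : ℕ) * w ^ (j : ℕ) ≤ θ j * w ^ (j : ℕ) := by
  have : (1 : ℝ) ≤ (j : ℕ) := by exact_mod_cast j.pos
  gcongr
  exact div_le_self (NNReal.coe_nonneg _) this

lemma summable_div_mul_pow {w : ℝ} (hw : 0 ≤ w)
    (h : Summable fun j : ℕ+ => (θ j : ℝ) * w ^ (j : ℕ)) :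
    Summable fun j : ℕ+ => (θ j : ℝ) / (j : ℕ) * w ^ (j : ℕ) :=
  Summable.of_nonneg_of_le (fun j => by positivity) (div_mul_pow_le hw) h

lemma exists_continuousOn_logSite {y : ℝ} (hy : 0 < y)
    (h : Summable fun j : ℕ+ => (θ j : ℝ) * y ^ (j : ℕ)) :
    ∃ φ : ℝ → ℝ, ContinuousOn φ (Set.Icc 0 1) ∧
      ∀ u ∈ Set.Icc (0 : ℝ) 1, logSite θ (y * u) = u * φ u := by
  refine ⟨fun u => ∑' j : ℕ+, (θ j : ℝ) / (j : ℕ) * y ^ (j : ℕ) * u ^ ((j : ℕ) - 1), ?_, ?_⟩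
  · refine continuousOn_tsum (fun j => by fun_prop) (summable_div_mul_pow hy.le h)
      fun j u hu => ?_
    rw [Real.norm_of_nonneg (by have := hu.1; positivity)]
    exact mul_le_of_le_one_right (by positivity) (pow_le_one₀ hu.1 hu.2)
  · intro u _
    rw [logSite, ← tsum_mul_left]
    refine tsum_congr fun j => ?_
    obtain ⟨k, hk⟩ : ∃ k, (j : ℕ) = k + 1 := ⟨j - 1, by have := j.pos; omega⟩
    rw [hk, Nat.add_sub_cancel]
    ring

lemma PotentialAssumption.integral_logSite_le (hV : PotentialAssumption V) {y z : ℝ} (hy : 0 < y)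
    (hyz : y ≤ z) (hzs : Summable fun j : ℕ+ => densityCoeff V θ j * z ^ (j : ℕ)) (ρ : ℝ≥0) :
    (ρ : ℝ)⁻¹ * ∫ x, logSite θ (y * boltzFactor V x) ≤
      ∑' j : ℕ+, (ρ : ℝ)⁻¹ * densityCoeff V θ j / (j : ℕ) * z ^ (j : ℕ) := by
  have h1 : ∀ j : ℕ+, ∫ x, (θ j : ℝ) / (j : ℕ) * (y * boltzFactor V x) ^ (j : ℕ) =
      densityCoeff V θ j / (j : ℕ) * y ^ (j : ℕ) := fun j => by
    simp only [mul_pow]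
    rw [integral_const_mul, integral_const_mul, densityCoeff]
    ring
  have hd0 : ∀ j, 0 ≤ densityCoeff V θ j := densityCoeff_nonneg
  have hz : 0 < z := hy.trans_le hyz
  have hle : ∀ j : ℕ+, densityCoeff V θ j / (j : ℕ) * y ^ (j : ℕ) ≤
      densityCoeff V θ j / (j : ℕ) * z ^ (j : ℕ) := fun j => by
    have := hd0 j
    gcongr
  have hsz : Summable fun j : ℕ+ => densityCoeff V θ j / (j : ℕ) * z ^ (j : ℕ) := by
    refine Summable.of_nonneg_of_le
      (fun j => mul_nonneg (div_nonneg (hd0 j) (by positivity)) (by positivity))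
      (fun j => ?_) hzs
    have h2 : (1 : ℝ) ≤ (j : ℕ) := by exact_mod_cast j.pos
    have := div_le_self (hd0 j) h2
    gcongr
  have hsy := Summable.of_nonneg_of_le
      (fun j : ℕ+ => mul_nonneg (div_nonneg (hd0 j) (by positivity)) (pow_nonneg hy.le _)) hle hsz
  have h3 := hasSum_integral_of_summable_integral_norm (μ := (volume : Measure (Fin d → ℝ)))
    (F := fun (j : ℕ+) x => (θ j : ℝ) / (j : ℕ) * (y * boltzFactor V x) ^ (j : ℕ))
    (fun j => by
      simp only [mul_pow]
      exact ((hV.integrable_pow j).const_mul _).const_mul _)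
    (by
      refine hsy.congr fun j => ?_
      rw [← h1 j]
      refine integral_congr_ae (Eventually.of_forall fun x => ?_)
      have := boltzFactor_nonneg V x
      exact (Real.norm_of_nonneg (by positivity)).symm)
  simp only [h1] at h3
  simp only [logSite]
  rw [← h3.tsum_eq, ← tsum_mul_left]
  have e : ∀ (w : ℝ) (j : ℕ+), (ρ : ℝ)⁻¹ * (densityCoeff V θ j / (j : ℕ) * w ^ (j : ℕ)) =
      (ρ : ℝ)⁻¹ * densityCoeff V θ j / (j : ℕ) * w ^ (j : ℕ) := fun w j => by ring
  simp only [← e z]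
  exact (hsy.mul_left _).tsum_le_tsum
    (fun j => mul_le_mul_of_nonneg_left (hle j) (by positivity)) (hsz.mul_left _)

/-! ### The mean of a tilted observable -/

/-- An observable `∑_x ξ(λ_x)` whose one-site exponential moments satisfy a second-order bound has
mean density `ρ⁻¹ ∫ m(z e^{-V})`: compare the Chernoff upper bound of the tilted partition
function at fugacities `y < z` with the lower bound of the partition function, and let `y → z`,
then `t → 0`. -/
lemma PotentialAssumption.tendsto_expect (hV : PotentialAssumption V)
    (hd : 1 ≤ d) {ρ : ℝ≥0} (hρ : 0 < ρ) {z : ℝ} (hz : 0 < z)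
    (hzs : Summable fun j : ℕ+ => densityCoeff V θ j * z ^ (j : ℕ))
    (hcase : (ρ : ℝ)⁻¹ * ∑' j : ℕ+, densityCoeff V θ j * z ^ (j : ℕ) = 1 ∨
        ((ρ : ℝ)⁻¹ * ∑' j : ℕ+, densityCoeff V θ j * z ^ (j : ℕ) < 1 ∧
          ∀ ε : ℝ, 0 < ε → ∀ N : ℕ, ∃ J : ℕ+, N < J ∧
            Real.exp (-(ε * (J : ℕ))) ≤ (ρ : ℝ)⁻¹ * (densityCoeff V θ J * z ^ (J : ℕ))))
    {ξ : Multiset ℕ+ → ℕ} (hξ : ∀ μ, ξ μ ≤ size μ) {m : ℝ → ℝ} {C t₀ M : ℝ} (hC : 0 ≤ C)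
    (ht₀ : 0 < t₀)
    (hm : ∀ y, 0 < y → y < z → ∃ φ : ℝ → ℝ, ContinuousOn φ (Set.Icc 0 1) ∧
      ∀ u ∈ Set.Icc (0 : ℝ) 1, m (y * u) = u * φ u)
    (hsite : ∀ t, |t| ≤ t₀ → ∀ w, 0 ≤ w → w < z →
      ∑' μ : Multiset ℕ+, siteWeight θ μ * ENNReal.ofReal w ^ size μ *
        ENNReal.ofReal (Real.exp (t * ξ μ)) ≤
      ENNReal.ofReal (Real.exp (logSite θ w + t * m w + C * t ^ 2 * w)))
    (hM : Tendsto (fun y => ∫ x, m (y * boltzFactor V x)) (𝓝[<] z) (𝓝 M)) :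
    Tendsto (fun n : ℕ => (expect V θ (sideLength d ρ n) n
      (fun lam => (n : ℝ≥0∞)⁻¹ * siteSum ξ lam)).toReal) (thermoLimit V θ ρ)
      (𝓝 ((ρ : ℝ)⁻¹ * M)) := by
  have hρ' : (0 : ℝ) < ρ := hρ
  set Φ : ℝ := ∑' j : ℕ+, (ρ : ℝ)⁻¹ * densityCoeff V θ j / (j : ℕ) * z ^ (j : ℕ) with hΦ
  set X : ℕ → ℝ := fun n => (expect V θ (sideLength d ρ n) n
      (fun lam => (n : ℝ≥0∞)⁻¹ * siteSum ξ lam)).toReal with hX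
  set C' : ℝ := C * z * ((ρ : ℝ)⁻¹ * ∫ x, boltzFactor V x) with hC'
  have hI0 : 0 ≤ ∫ x, boltzFactor V x := integral_nonneg fun x => boltzFactor_nonneg V x
  have hC'0 : 0 ≤ C' := by positivity
  have hξ0 : ξ 0 = 0 := Nat.le_zero.1 (hξ 0)
  have key : ∀ t, |t| ≤ t₀ → t ≠ 0 → ∀ᶠ n in thermoLimit V θ ρ,
      t * (X n - (ρ : ℝ)⁻¹ * M) ≤ (C' + 1) * t ^ 2 := by
    intro t ht ht0
    have hε : 0 < t ^ 2 / 3 := by positivity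
    -- choose the fugacity `y < z`
    have hy1 : Tendsto (fun y => -Real.log y + Real.log z +
        t * ((ρ : ℝ)⁻¹ * ∫ x, m (y * boltzFactor V x))) (𝓝[<] z)
        (𝓝 (-Real.log z + Real.log z + t * ((ρ : ℝ)⁻¹ * M))) :=
      (((Real.continuousAt_log hz.ne').tendsto.mono_left nhdsWithin_le_nhds).neg.add_const _).add
        ((hM.const_mul _).const_mul _)
    rw [neg_add_cancel, zero_add] at hy1
    obtain ⟨y, hyM, hy0, hyz⟩ := ((hy1.eventually_lt_const (lt_add_of_pos_right _ hε)).and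
      (Ioo_mem_nhdsLT hz)).exists
    obtain ⟨φm, hφm, hmφ⟩ := hm y hy0 hyz
    obtain ⟨φG, hφG, hGφ⟩ := exists_continuousOn_logSite hy0 (hV.summable_theta hy0 hyz hzs)
    -- the exponent of the Chernoff bound is a Riemann sum
    set φ : ℝ → ℝ := fun u => φG u + t * φm u + C * t ^ 2 * y with hφ
    have hφc : ContinuousOn φ (Set.Icc 0 1) :=
      (hφG.add (continuousOn_const.mul hφm)).add continuousOn_const
    have hexp : ∀ u ∈ Set.Icc (0 : ℝ) 1,
        logSite θ (y * u) + t * m (y * u) + C * t ^ 2 * (y * u) = u * φ u := fun u hu => by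
      rw [hGφ u hu, hmφ u hu, hφ]; ring
    have hriem := ((hV.tendsto_riemann hd hρ hφc).mono_left
      (thermoLimit_le (V := V) (θ := θ) ρ)).eventually_lt_const (lt_add_of_pos_right _ hε)
    have hint := @hV.integrable_mul_comp
    have hintφ : (ρ : ℝ)⁻¹ * (∫ x, boltzFactor V x * φ (boltzFactor V x)) ≤
        Φ + t * ((ρ : ℝ)⁻¹ * ∫ x, m (y * boltzFactor V x)) + C' * t ^ 2 := by
      have e1 : ∫ x, boltzFactor V x * φ (boltzFactor V x) =
          (∫ x, logSite θ (y * boltzFactor V x)) + t * (∫ x, m (y * boltzFactor V x)) +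
            C * t ^ 2 * y * (∫ x, boltzFactor V x) := by
        rw [← integral_const_mul, ← integral_const_mul]
        simp only [fun x => hGφ _ (boltzFactor_mem V x), fun x => hmφ _ (boltzFactor_mem V x)]
        have hi : Integrable fun x => boltzFactor V x * φG (boltzFactor V x) +
            t * (boltzFactor V x * φm (boltzFactor V x)) :=
          (hint hφG).add ((hint hφm).const_mul t)
        rw [← integral_add (hint hφG) ((hint hφm).const_mul t),
          ← integral_add hi (hV.integrable.const_mul _)]
        refine integral_congr_ae (Eventually.of_forall fun x => ?_)
        simp only [hφ]
        ring
      have e2 := hV.integral_logSite_le hy0 hyz.le hzs ρ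
      have e3 : (ρ : ℝ)⁻¹ * (C * t ^ 2 * y * (∫ x, boltzFactor V x)) ≤ C' * t ^ 2 := by
        rw [hC']
        calc _ = C * y * ((ρ : ℝ)⁻¹ * ∫ x, boltzFactor V x) * t ^ 2 := by ring
          _ ≤ _ := by gcongr
      rw [e1, mul_add, mul_add]
      linarith
    filter_upwards [hriem, eventually_thermoLimit ρ,
      hV.eventually_le_log_partitionFunction hd hρ hz hzs hcase hε,
      (thermoLimit_le (V := V) (θ := θ) ρ) (eventually_gt_atTop 0),
      (thermoLimit_le (V := V) (θ := θ) ρ) (hV.eventually_summable hd hρ)]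
      with n h1 h2 h3 h4 h5
    have hn : (0 : ℝ) < n := by exact_mod_cast h4
    set u : (Fin d → ℤ) → ℝ := fun x => boltzFactor V (scaledPoint (sideLength d ρ n) x) with hu
    have hu01 : ∀ x, u x ∈ Set.Icc (0 : ℝ) 1 := fun x => boltzFactor_mem V _
    have hyu : ∀ x, y * u x < z := fun x =>
      (mul_le_of_le_one_right hy0.le (hu01 x).2).trans_lt hyz
    have hyu0 : ∀ x, 0 ≤ y * u x := fun x => mul_nonneg hy0.le (hu01 x).1
    have hsite' := fun x => hsite t ht (y * u x) (hyu0 x) (hyu x)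
    simp only [fun x => hexp (u x) (hu01 x)] at hsite'
    have ha : ∀ x, 0 ≤ u x * φ (u x) := fun x => by
      have h6 := (ENNReal.le_tsum (0 : Multiset ℕ+)).trans (hsite' x)
      simp only [siteWeight_zero, size_zero, pow_zero, hξ0, Nat.cast_zero, mul_zero,
        Real.exp_zero, ENNReal.ofReal_one, mul_one] at h6
      exact Real.one_le_exp_iff.1 (ENNReal.one_le_ofReal.1 h6)
    obtain ⟨B, hB⟩ := isCompact_Icc.exists_bound_of_continuousOn hφc
    have has : Summable fun x => u x * φ (u x) :=
      Summable.of_norm_bounded (h5.mul_right B) fun x => by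
        rw [norm_mul, Real.norm_of_nonneg (hu01 x).1]
        exact mul_le_mul_of_nonneg_left (hB _ (hu01 x)) (hu01 x).1
    have htilt := tsum_weight_tilt_le V θ (sideLength d ρ n) n hξ0 t hy0 _ ha has fun x => by
      rw [← ofReal_boltzFactor, ← ENNReal.ofReal_mul hy0.le]
      exact hsite' x
    have hfin := mul_expect_le V θ (sideLength d ρ n) h2.1 h2.2 hξ htilt
    have hfin' : t * X n ≤ -Real.log y + (∑' x, u x * φ (u x)) / n -
        Real.log (partitionFunction V θ (sideLength d ρ n) n).toReal / n := by
      have e : t * X n = t * (n * X n) / n := by field_simp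
      rw [e, div_le_iff₀ hn]
      refine hfin.trans (le_of_eq ?_)
      field_simp
    have h1' : (∑' x, u x * φ (u x)) / n <
        (ρ : ℝ)⁻¹ * (∫ x, boltzFactor V x * φ (boltzFactor V x)) + t ^ 2 / 3 := h1
    nlinarith
  rw [Metric.tendsto_nhds]
  intro ε hε
  set t : ℝ := min t₀ (ε / (2 * (C' + 1))) with ht
  have ht0 : 0 < t := lt_min ht₀ (by positivity)
  have htε : (C' + 1) * t < ε := by
    have : t ≤ ε / (2 * (C' + 1)) := min_le_right _ _
    rw [le_div_iff₀ (by positivity)] at this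
    nlinarith
  have htt : |t| ≤ t₀ := by rw [abs_of_pos ht0]; exact min_le_left _ _
  filter_upwards [key t htt ht0.ne', key (-t) (by rwa [abs_neg]) (neg_ne_zero.2 ht0.ne')]
    with n h1 h2
  rw [Real.dist_eq, abs_lt]
  constructor
  · have : t * (X n - (ρ : ℝ)⁻¹ * M + (C' + 1) * t) ≥ 0 := by nlinarith
    have := nonneg_of_mul_nonneg_right this ht0
    linarith
  · have : t * ((C' + 1) * t - (X n - (ρ : ℝ)⁻¹ * M)) ≥ 0 := by nlinarith
    have := nonneg_of_mul_nonneg_right this ht0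
    linarith

end Asymptotics

section Observables

variable {d : ℕ} {V : (Fin d → ℝ) → ℝ≥0∞} {θ : ℕ+ → ℝ≥0}

/-! ### Mass in the small components -/

lemma sizeUpTo_eq_sum (K : ℕ) (μ : Multiset ℕ+) :
    sizeUpTo K μ = ∑ j ∈ μ.toFinset, μ.count j * (if K < (j : ℕ) then 0 else (j : ℕ)) := by
  have h : sizeUpTo K μ = (μ.map fun j : ℕ+ => if K < (j : ℕ) then 0 else (j : ℕ)).sum := by
    unfold sizeUpTo size
    induction μ using Multiset.induction_on with
    | empty => rfl
    | cons a s ih =>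
      rw [Multiset.filter_cons]
      by_cases h : K < (a : ℕ)
      · simp only [not_lt] at ih
        simp [h, ih]
      · simp only [not_lt] at ih h
        simp [h, ih]
  rw [h, Finset.sum_multiset_map_count]
  simp

lemma siteWeight_tilt_eq {w : ℝ} (hw : 0 ≤ w) (t : ℝ) (K : ℕ) (μ : Multiset ℕ+) :
    siteWeight θ μ * ENNReal.ofReal w ^ size μ * ENNReal.ofReal (Real.exp (t * sizeUpTo K μ)) =
      poissonWeight (fun j : ℕ+ => ENNReal.ofReal ((θ j : ℝ) / (j : ℕ) * w ^ (j : ℕ) *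
        Real.exp (t * (if K < (j : ℕ) then 0 else (j : ℕ) : ℕ)))) (Multiset.toFinsupp μ) := by
  rw [siteWeight, ← poissonWeight_mul_pow, poissonWeight_eq_prod _ _ subset_rfl,
    poissonWeight_eq_prod _ _ subset_rfl, sizeUpTo_eq_sum, Nat.cast_sum, Finset.mul_sum,
    Real.exp_sum, ENNReal.ofReal_prod_of_nonneg fun i _ => (Real.exp_pos _).le,
    Multiset.toFinsupp_support, ← Finset.prod_mul_distrib]
  refine Finset.prod_congr rfl fun j _ => ?_
  have hj : (0 : ℝ) < (j : ℕ) := by exact_mod_cast j.pos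
  have e1 : (θ j : ℝ≥0∞) / ((j : ℕ) : ℝ≥0∞) * ENNReal.ofReal w ^ (j : ℕ) =
      ENNReal.ofReal ((θ j : ℝ) / (j : ℕ) * w ^ (j : ℕ)) := by
    rw [ENNReal.ofReal_mul (by positivity), ENNReal.ofReal_div_of_pos hj, ENNReal.ofReal_pow hw,
      ENNReal.ofReal_coe_nnreal, ENNReal.ofReal_natCast]
  have e2 : Real.exp (t * ((μ.count j * (if K < (j : ℕ) then 0 else (j : ℕ)) : ℕ) : ℝ)) =
      Real.exp (t * (if K < (j : ℕ) then 0 else (j : ℕ) : ℕ)) ^ μ.count j := by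
    rw [← Real.exp_nat_mul]
    push_cast
    ring_nf
  rw [e1, e2, Multiset.toFinsupp_apply, ENNReal.ofReal_pow (Real.exp_pos _).le,
    ENNReal.ofReal_mul (q := Real.exp _) (by positivity), mul_pow, mul_assoc]

lemma tsum_siteWeight_tilt_le {w : ℝ} (hw : 0 ≤ w) (t : ℝ) (K : ℕ)
    (hs : Summable fun j : ℕ+ => (θ j : ℝ) / (j : ℕ) * w ^ (j : ℕ) *
        Real.exp (t * (if K < (j : ℕ) then 0 else (j : ℕ) : ℕ))) :
    ∑' μ : Multiset ℕ+, siteWeight θ μ * ENNReal.ofReal w ^ size μ *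
        ENNReal.ofReal (Real.exp (t * sizeUpTo K μ)) ≤
      ENNReal.ofReal (Real.exp (∑' j : ℕ+, (θ j : ℝ) / (j : ℕ) * w ^ (j : ℕ) *
        Real.exp (t * (if K < (j : ℕ) then 0 else (j : ℕ) : ℕ)))) := by
  simp only [siteWeight_tilt_eq hw]
  exact (Multiset.toFinsupp (α := ℕ+)).toEquiv.tsum_eq (fun r => poissonWeight
    (fun j : ℕ+ => ENNReal.ofReal ((θ j : ℝ) / (j : ℕ) * w ^ (j : ℕ) *
        Real.exp (t * (if K < (j : ℕ) then 0 else (j : ℕ) : ℕ)))) r) ▸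
    tsum_poissonWeight_le _ (fun j => by positivity) hs

lemma tsum_siteWeight_le {w : ℝ} (hw : 0 ≤ w)
    (hs : Summable fun j : ℕ+ => (θ j : ℝ) * w ^ (j : ℕ)) :
    ∑' μ : Multiset ℕ+, siteWeight θ μ * ENNReal.ofReal w ^ size μ ≤
      ENNReal.ofReal (Real.exp (logSite θ w)) := by
  have := tsum_siteWeight_tilt_le (θ := θ) hw 0 0 (by
    simpa using summable_div_mul_pow hw hs)
  simpa [logSite] using this

lemma summable_theta_mono {w y : ℝ} (hw : 0 ≤ w) (hwy : w ≤ y)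
    (hs : Summable fun j : ℕ+ => (θ j : ℝ) * y ^ (j : ℕ)) :
    Summable fun j : ℕ+ => (θ j : ℝ) * w ^ (j : ℕ) :=
  Summable.of_nonneg_of_le (fun j => by positivity) (fun j => by gcongr) hs

lemma PotentialAssumption.summable_theta' (hV : PotentialAssumption V) {w z : ℝ} (hw : 0 ≤ w)
    (hwz : w < z) (hz : Summable fun j : ℕ+ => densityCoeff V θ j * z ^ (j : ℕ)) :
    Summable fun j : ℕ+ => (θ j : ℝ) * w ^ (j : ℕ) :=
  summable_theta_mono hw (by linarith : w ≤ (w + z) / 2)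
    (hV.summable_theta (by linarith) (by linarith) hz)

/-- The component sizes `j ≤ K`. -/
def smallSizes (K : ℕ) : Finset ℕ+ :=
  ((Set.finite_le_nat K).preimage (f := fun j : ℕ+ => (j : ℕ))
    PNat.coe_injective.injOn).toFinset

@[simp] lemma mem_smallSizes {K : ℕ} {j : ℕ+} : j ∈ smallSizes K ↔ (j : ℕ) ≤ K := by
  simp [smallSizes]

lemma exp_le_one_add_add_sq {x : ℝ} (hx : |x| ≤ 1) : Real.exp x ≤ 1 + x + x ^ 2 := by
  have := (abs_le.1 (Real.abs_exp_sub_one_sub_id_le hx)).2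
  linarith

lemma abs_mul_natCast_le_one {t : ℝ} {K k : ℕ} (ht : |t| ≤ 1 / (K + 1)) (hk : k ≤ K) :
    |t * k| ≤ 1 := by
  rw [abs_mul, Nat.abs_cast]
  rw [le_div_iff₀ (by positivity)] at ht
  have : (k : ℝ) ≤ K := by exact_mod_cast hk
  nlinarith [abs_nonneg t]

lemma pow_le_mul_pow_sub_one {w z : ℝ} (hw : 0 ≤ w) (hwz : w ≤ z) {k : ℕ} (hk : k ≠ 0) :
    w ^ k ≤ z ^ (k - 1) * w := by
  obtain ⟨i, rfl⟩ : ∃ i, k = i + 1 := ⟨k - 1, by omega⟩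
  rw [Nat.add_sub_cancel, pow_succ]
  gcongr

/-- The mean density of the mass in the components of size at most `K`. -/
lemma PotentialAssumption.tendsto_expect_sizeUpTo (hV : PotentialAssumption V)
    (hd : 1 ≤ d) {ρ : ℝ≥0} (hρ : 0 < ρ) {z : ℝ} (hz : 0 < z)
    (hzs : Summable fun j : ℕ+ => densityCoeff V θ j * z ^ (j : ℕ))
    (hcase : (ρ : ℝ)⁻¹ * ∑' j : ℕ+, densityCoeff V θ j * z ^ (j : ℕ) = 1 ∨
        ((ρ : ℝ)⁻¹ * ∑' j : ℕ+, densityCoeff V θ j * z ^ (j : ℕ) < 1 ∧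
          ∀ ε : ℝ, 0 < ε → ∀ N : ℕ, ∃ J : ℕ+, N < J ∧
            Real.exp (-(ε * (J : ℕ))) ≤ (ρ : ℝ)⁻¹ * (densityCoeff V θ J * z ^ (J : ℕ))))
    (K : ℕ) :
    Tendsto (fun n : ℕ => (expect V θ (sideLength d ρ n) n
      (fun lam => (n : ℝ≥0∞)⁻¹ * siteSum (sizeUpTo K) lam)).toReal) (thermoLimit V θ ρ)
      (𝓝 ((ρ : ℝ)⁻¹ * ∑ j ∈ smallSizes K, densityCoeff V θ j * z ^ (j : ℕ))) := by
  refine hV.tendsto_expect hd hρ hz hzs hcase (ξ := sizeUpTo K)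
    (m := fun w => ∑ j ∈ smallSizes K, (θ j : ℝ) * w ^ (j : ℕ))
    (C := ∑ j ∈ smallSizes K, (θ j : ℝ) * (j : ℕ) * z ^ ((j : ℕ) - 1)) (t₀ := 1 / (K + 1))
    (fun μ => ?_) (Finset.sum_nonneg fun j _ => by positivity) (by positivity) ?_ ?_ ?_
  · rw [← sizeUpTo_add_sizeAbove K μ]
    exact Nat.le_add_right _ _
  · intro y _ _
    refine ⟨fun u => ∑ j ∈ smallSizes K, (θ j : ℝ) * y ^ (j : ℕ) * u ^ ((j : ℕ) - 1),
      by fun_prop, fun u _ => ?_⟩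
    rw [Finset.mul_sum]
    refine Finset.sum_congr rfl fun j _ => ?_
    obtain ⟨k, hk⟩ : ∃ k, (j : ℕ) = k + 1 := ⟨j - 1, by have := j.pos; omega⟩
    rw [hk, Nat.add_sub_cancel]
    ring
  · intro t ht w hw hwz
    have hs := summable_div_mul_pow hw (hV.summable_theta' hw hwz hzs)
    -- split the exponent of the tilted sum into `logSite` and a finite correction
    have e : ∀ j : ℕ+, (θ j : ℝ) / (j : ℕ) * w ^ (j : ℕ) *
        Real.exp (t * (if K < (j : ℕ) then 0 else (j : ℕ) : ℕ)) =
        (θ j : ℝ) / (j : ℕ) * w ^ (j : ℕ) + (if j ∈ smallSizes K then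
          (θ j : ℝ) / (j : ℕ) * w ^ (j : ℕ) * (Real.exp (t * (j : ℕ)) - 1) else 0) := fun j => by
      by_cases h : K < (j : ℕ)
      · simp [h, not_le.2 h]
      · rw [if_neg h, if_pos (mem_smallSizes.2 (not_lt.1 h))]
        ring
    set g : ℕ+ → ℝ := fun j => if j ∈ smallSizes K then
      (θ j : ℝ) / (j : ℕ) * w ^ (j : ℕ) * (Real.exp (t * (j : ℕ)) - 1) else 0 with hg
    have hcorr : HasSum g (∑ j ∈ smallSizes K, g j) :=
      hasSum_sum_of_ne_finset_zero fun j hj => if_neg hj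
    have hsum : HasSum (fun j : ℕ+ => (θ j : ℝ) / (j : ℕ) * w ^ (j : ℕ) *
        Real.exp (t * (if K < (j : ℕ) then 0 else (j : ℕ) : ℕ)))
        (logSite θ w + ∑ j ∈ smallSizes K, g j) := by
      rw [funext e]
      exact hs.hasSum.add hcorr
    refine (tsum_siteWeight_tilt_le hw t K hsum.summable).trans ?_
    rw [hsum.tsum_eq]
    refine ENNReal.ofReal_le_ofReal (Real.exp_le_exp.2 ?_)
    rw [add_assoc]
    refine add_le_add_right ?_ _
    rw [Finset.mul_sum, mul_assoc, Finset.sum_mul, ← Finset.sum_add_distrib]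
    refine Finset.sum_le_sum fun j hj => ?_
    rw [hg]
    beta_reduce
    rw [if_pos hj]
    have hj0 : (0 : ℝ) < (j : ℕ) := by exact_mod_cast j.pos
    have h1 := exp_le_one_add_add_sq (abs_mul_natCast_le_one ht (mem_smallSizes.1 hj))
    have h2 := pow_le_mul_pow_sub_one hw hwz.le j.pos.ne'
    calc (θ j : ℝ) / (j : ℕ) * w ^ (j : ℕ) * (Real.exp (t * (j : ℕ)) - 1)
        ≤ (θ j : ℝ) / (j : ℕ) * w ^ (j : ℕ) * (t * (j : ℕ) + (t * (j : ℕ)) ^ 2) := by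
          gcongr; linarith
      _ = t * ((θ j : ℝ) * w ^ (j : ℕ)) + (θ j : ℝ) * (j : ℕ) * t ^ 2 * w ^ (j : ℕ) := by
          field_simp
      _ ≤ t * ((θ j : ℝ) * w ^ (j : ℕ)) +
          (θ j : ℝ) * (j : ℕ) * t ^ 2 * (z ^ ((j : ℕ) - 1) * w) := by gcongr
      _ = _ := by ring
  · have e : ∀ y : ℝ, ∫ x, ∑ j ∈ smallSizes K, (θ j : ℝ) * (y * boltzFactor V x) ^ (j : ℕ) =
        ∑ j ∈ smallSizes K, densityCoeff V θ j * y ^ (j : ℕ) := fun y => by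
      simp only [mul_pow]
      rw [integral_finsetSum _ fun j _ => ((hV.integrable_pow j).const_mul _).const_mul _]
      refine Finset.sum_congr rfl fun j _ => ?_
      rw [integral_const_mul, integral_const_mul, densityCoeff]
      ring
    simp only [e]
    have hc : Continuous fun y : ℝ => ∑ j ∈ smallSizes K, densityCoeff V θ j * y ^ (j : ℕ) := by
      fun_prop
    exact hc.continuousAt.tendsto.mono_left nhdsWithin_le_nhds

/-! ### Mass at the sites of small occupation -/

/-- The grand-canonical partition function `∑_μ s(μ) w^{|μ|}` of a site. -/
def siteSeries (θ : ℕ+ → ℝ≥0) (w : ℝ) : ℝ :=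
  ∑' μ : Multiset ℕ+, (siteWeight θ μ).toReal * w ^ size μ

lemma finite_size_le (K : ℕ) : {μ : Multiset ℕ+ | size μ ≤ K}.Finite := by
  have h : {μ : Multiset ℕ+ | size μ ≤ K} ⊆ ⋃ k ∈ Finset.range (K + 1),
      (fun μ : Multiset ℕ+ => μ.map fun j : ℕ+ => (j : ℕ)) ⁻¹'
        (Set.range fun p : Nat.Partition k => p.parts) := by
    intro μ hμ
    refine Set.mem_iUnion₂.2 ⟨size μ, Finset.mem_range.2 (Nat.lt_succ_of_le hμ), ?_⟩
    refine ⟨⟨μ.map fun j : ℕ+ => (j : ℕ), fun {i} hi => ?_, rfl⟩, rfl⟩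
    obtain ⟨j, _, rfl⟩ := Multiset.mem_map.1 hi
    exact j.pos
  refine Set.Finite.subset (Set.Finite.biUnion (Finset.finite_toSet _) fun k _ => ?_) h
  exact (Set.finite_range _).preimage (Multiset.map_injective PNat.coe_injective).injOn

/-- The integer partitions of the integers up to `K`. -/
def smallPartitions (K : ℕ) : Finset (Multiset ℕ+) := (finite_size_le K).toFinset

@[simp] lemma mem_smallPartitions {K : ℕ} {μ : Multiset ℕ+} :
    μ ∈ smallPartitions K ↔ size μ ≤ K := by
  simp [smallPartitions]

lemma siteWeight_ne_top (μ : Multiset ℕ+) : siteWeight θ μ ≠ ⊤ := by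
  rw [siteWeight, poissonWeight_eq_prod _ _ subset_rfl]
  refine ENNReal.prod_ne_top fun j _ => ENNReal.mul_ne_top ?_ (ENNReal.pow_ne_top ?_)
  · simp [Nat.factorial_ne_zero]
  · exact ENNReal.div_ne_top ENNReal.coe_ne_top (by simp)

lemma siteWeight_mul_pow_eq {w : ℝ} (hw : 0 ≤ w) (μ : Multiset ℕ+) :
    siteWeight θ μ * ENNReal.ofReal w ^ size μ =
      ENNReal.ofReal ((siteWeight θ μ).toReal * w ^ size μ) := by
  rw [ENNReal.ofReal_mul ENNReal.toReal_nonneg, ENNReal.ofReal_toReal (siteWeight_ne_top μ),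
    ENNReal.ofReal_pow hw]

lemma summable_siteSeries {w : ℝ} (hw : 0 ≤ w)
    (hs : Summable fun j : ℕ+ => (θ j : ℝ) * w ^ (j : ℕ)) :
    Summable fun μ : Multiset ℕ+ => (siteWeight θ μ).toReal * w ^ size μ := by
  have h := ne_top_of_le_ne_top ENNReal.ofReal_ne_top (tsum_siteWeight_le hw hs)
  simp only [siteWeight_mul_pow_eq hw] at h
  refine (ENNReal.summable_toReal h).congr fun μ => ENNReal.toReal_ofReal (by positivity)

lemma tsum_siteWeight_eq {w : ℝ} (hw : 0 ≤ w)
    (hs : Summable fun j : ℕ+ => (θ j : ℝ) * w ^ (j : ℕ)) :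
    ∑' μ : Multiset ℕ+, siteWeight θ μ * ENNReal.ofReal w ^ size μ =
      ENNReal.ofReal (siteSeries θ w) := by
  simp only [siteWeight_mul_pow_eq hw]
  exact (ENNReal.ofReal_tsum_of_nonneg (fun μ => by positivity) (summable_siteSeries hw hs)).symm

lemma siteSeries_le {w : ℝ} (hw : 0 ≤ w)
    (hs : Summable fun j : ℕ+ => (θ j : ℝ) * w ^ (j : ℕ)) :
    siteSeries θ w ≤ Real.exp (logSite θ w) := by
  have h := tsum_siteWeight_le hw hs
  rw [tsum_siteWeight_eq hw hs] at h
  exact (ENNReal.ofReal_le_ofReal_iff (Real.exp_pos _).le).1 h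

lemma one_le_siteSeries {w : ℝ} (hw : 0 ≤ w)
    (hs : Summable fun j : ℕ+ => (θ j : ℝ) * w ^ (j : ℕ)) :
    1 ≤ siteSeries θ w := by
  have h := (summable_siteSeries hw hs).le_tsum 0 fun μ _ => by positivity
  unfold siteSeries
  simpa using h

lemma continuousOn_siteSeries {w : ℝ} (hw : 0 ≤ w)
    (hs : Summable fun j : ℕ+ => (θ j : ℝ) * w ^ (j : ℕ)) :
    ContinuousOn (siteSeries θ) (Set.Icc 0 w) := by
  refine continuousOn_tsum (fun μ => by fun_prop) (summable_siteSeries hw hs) fun μ u hu => ?_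
  rw [Real.norm_of_nonneg (mul_nonneg ENNReal.toReal_nonneg (pow_nonneg hu.1 _))]
  have := pow_le_pow_left₀ hu.1 hu.2 (size μ)
  gcongr

/-- The grand-canonical mean of the occupation of a site is `∑_j θ_j w^j`. -/
lemma hasSum_size_siteSeries {w : ℝ} (hw : 0 ≤ w)
    (hs : Summable fun j : ℕ+ => (θ j : ℝ) * w ^ (j : ℕ)) :
    HasSum (fun μ : Multiset ℕ+ => (size μ : ℝ) * ((siteWeight θ μ).toReal * w ^ size μ))
      ((∑' j : ℕ+, (θ j : ℝ) * w ^ (j : ℕ)) * siteSeries θ w) := by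
  have key : ∑' μ : Multiset ℕ+, (size μ : ℝ≥0∞) * (siteWeight θ μ * ENNReal.ofReal w ^ size μ) =
      ENNReal.ofReal ((∑' j : ℕ+, (θ j : ℝ) * w ^ (j : ℕ)) * siteSeries θ w) := by
    set b : ℕ+ → ℝ≥0∞ := fun j =>
      (θ j : ℝ≥0∞) / ((j : ℕ) : ℝ≥0∞) * ENNReal.ofReal w ^ (j : ℕ) with hb
    have e1 : ∀ μ : Multiset ℕ+, siteWeight θ μ * ENNReal.ofReal w ^ size μ =
        poissonWeight b (Multiset.toFinsupp μ) := fun μ => (poissonWeight_mul_pow _ _ _).symm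
    have e2 : ∀ μ : Multiset ℕ+, (size μ : ℝ≥0∞) =
        ∑' j : ℕ+, ((j : ℕ) : ℝ≥0∞) * (Multiset.toFinsupp μ j : ℝ≥0∞) := fun μ => by
      rw [size_eq_sum, Nat.cast_sum]
      symm
      rw [tsum_eq_sum (s := μ.toFinset)]
      · refine Finset.sum_congr rfl fun j _ => ?_
        rw [Multiset.toFinsupp_apply]
        push_cast
        ring
      · intro j hj
        rw [Multiset.toFinsupp_apply, Multiset.count_eq_zero.2 (by simpa using hj)]
        simp
    have e3 : ∑' r : ℕ+ →₀ ℕ, poissonWeight b r = ENNReal.ofReal (siteSeries θ w) := by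
      rw [← tsum_siteWeight_eq hw hs]
      simp only [e1]
      exact ((Multiset.toFinsupp (α := ℕ+)).toEquiv.tsum_eq _).symm
    have e4 : ∀ j : ℕ+, ((j : ℕ) : ℝ≥0∞) * b j = ENNReal.ofReal ((θ j : ℝ) * w ^ (j : ℕ)) :=
      fun j => by
        rw [ENNReal.ofReal_mul (NNReal.coe_nonneg _), ENNReal.ofReal_pow hw,
          ENNReal.ofReal_coe_nnreal, hb, ← mul_assoc,
          ENNReal.mul_div_cancel (by simp) (by simp)]
    calc ∑' μ : Multiset ℕ+, (size μ : ℝ≥0∞) * (siteWeight θ μ * ENNReal.ofReal w ^ size μ)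
        = ∑' μ : Multiset ℕ+, (fun r : ℕ+ →₀ ℕ => (∑' j : ℕ+, ((j : ℕ) : ℝ≥0∞) * (r j : ℝ≥0∞)) *
            poissonWeight b r) ((Multiset.toFinsupp (α := ℕ+)).toEquiv μ) :=
          tsum_congr fun μ => by rw [e1, e2]; rfl
      _ = ∑' r : ℕ+ →₀ ℕ, (∑' j : ℕ+, ((j : ℕ) : ℝ≥0∞) * (r j : ℝ≥0∞)) * poissonWeight b r :=
          (Multiset.toFinsupp (α := ℕ+)).toEquiv.tsum_eq (fun r : ℕ+ →₀ ℕ =>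
            (∑' j : ℕ+, ((j : ℕ) : ℝ≥0∞) * (r j : ℝ≥0∞)) * poissonWeight b r)
      _ = ∑' j : ℕ+, ((j : ℕ) : ℝ≥0∞) * ∑' r : ℕ+ →₀ ℕ, (r j : ℝ≥0∞) * poissonWeight b r * 1 := by
          simp only [← ENNReal.tsum_mul_right]
          rw [ENNReal.tsum_comm]
          refine tsum_congr fun j => ?_
          rw [← ENNReal.tsum_mul_left]
          exact tsum_congr fun r => by ring
      _ = ∑' j : ℕ+, ENNReal.ofReal ((θ j : ℝ) * w ^ (j : ℕ)) *
            ENNReal.ofReal (siteSeries θ w) := by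
          refine tsum_congr fun j => ?_
          rw [tsum_mul_poissonWeight b j fun _ => 1, ← mul_assoc, e4, ← e3]
          simp only [mul_one]
      _ = _ := by
          rw [ENNReal.tsum_mul_right, ENNReal.ofReal_mul (tsum_nonneg fun j => by positivity),
            ENNReal.ofReal_tsum_of_nonneg (fun j => by positivity) hs]
  have e5 : ∀ μ : Multiset ℕ+, (size μ : ℝ≥0∞) * (siteWeight θ μ * ENNReal.ofReal w ^ size μ) =
      ENNReal.ofReal ((size μ : ℝ) * ((siteWeight θ μ).toReal * w ^ size μ)) := fun μ => by
    rw [ENNReal.ofReal_mul (by positivity), ← siteWeight_mul_pow_eq hw, ENNReal.ofReal_natCast]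
  simp only [e5] at key
  have hsum : Summable fun μ : Multiset ℕ+ =>
      (size μ : ℝ) * ((siteWeight θ μ).toReal * w ^ size μ) :=
    (ENNReal.summable_toReal (key ▸ ENNReal.ofReal_ne_top)).congr fun μ =>
      ENNReal.toReal_ofReal (by positivity)
  have hpos : 0 ≤ (∑' j : ℕ+, (θ j : ℝ) * w ^ (j : ℕ)) * siteSeries θ w :=
    mul_nonneg (tsum_nonneg fun j => by positivity)
      (zero_le_one.trans (one_le_siteSeries hw hs))
  rw [← ENNReal.ofReal_tsum_of_nonneg (fun μ => by positivity) hsum] at key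
  have := (ENNReal.ofReal_eq_ofReal_iff (tsum_nonneg fun μ => by positivity) hpos).1 key
  exact this ▸ hsum.hasSum

end Observables

section Occupation

variable {d : ℕ} {V : (Fin d → ℝ) → ℝ≥0∞} {θ : ℕ+ → ℝ≥0}

/-- The grand-canonical mean, at fugacity `w`, of the occupation of a site restricted to the event
that it is at most `K`. -/
def smallOccMean (θ : ℕ+ → ℝ≥0) (K : ℕ) (w : ℝ) : ℝ :=
  (∑ μ ∈ smallPartitions K, (size μ : ℝ) * ((siteWeight θ μ).toReal * w ^ size μ)) /
    siteSeries θ w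

lemma sum_size_pow_le {w z : ℝ} (hw : 0 ≤ w) (hwz : w ≤ z) (K p : ℕ) (hp : p ≠ 0) :
    ∑ μ ∈ smallPartitions K, (size μ : ℝ) ^ p * ((siteWeight θ μ).toReal * w ^ size μ) ≤
      (∑ μ ∈ smallPartitions K,
        (size μ : ℝ) ^ p * ((siteWeight θ μ).toReal * z ^ (size μ - 1))) * w := by
  rw [Finset.sum_mul]
  refine Finset.sum_le_sum fun μ _ => ?_
  rcases eq_or_ne (size μ) 0 with h | h
  · simp [h, hp]
  · have := pow_le_mul_pow_sub_one hw hwz h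
    calc (size μ : ℝ) ^ p * ((siteWeight θ μ).toReal * w ^ size μ)
        ≤ (size μ : ℝ) ^ p * ((siteWeight θ μ).toReal * (z ^ (size μ - 1) * w)) := by gcongr
      _ = _ := by ring

lemma smallOccMean_nonneg {w : ℝ} (hw : 0 ≤ w) (K : ℕ) : 0 ≤ smallOccMean θ K w :=
  div_nonneg (Finset.sum_nonneg fun μ _ => by positivity) (tsum_nonneg fun μ => by positivity)

lemma smallOccMean_le {w : ℝ} (hw : 0 ≤ w)
    (hs : Summable fun j : ℕ+ => (θ j : ℝ) * w ^ (j : ℕ)) (K : ℕ) :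
    smallOccMean θ K w ≤ ∑' j : ℕ+, (θ j : ℝ) * w ^ (j : ℕ) := by
  rw [smallOccMean, div_le_iff₀ (zero_lt_one.trans_le (one_le_siteSeries hw hs))]
  exact sum_le_hasSum _ (fun μ _ => by positivity) (hasSum_size_siteSeries hw hs)

lemma smallOccMean_le_mul {w z : ℝ} (hw : 0 ≤ w) (hwz : w ≤ z)
    (hs : Summable fun j : ℕ+ => (θ j : ℝ) * w ^ (j : ℕ)) (K : ℕ) :
    smallOccMean θ K w ≤ (∑ μ ∈ smallPartitions K,
        (size μ : ℝ) * ((siteWeight θ μ).toReal * z ^ (size μ - 1))) * w := by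
  have h := sum_size_pow_le (θ := θ) hw hwz K 1 one_ne_zero
  simp only [pow_one] at h
  exact (div_le_self (Finset.sum_nonneg fun μ _ => by positivity)
    (one_le_siteSeries hw hs)).trans h

lemma tendsto_smallOccMean {w : ℝ} (hw : 0 ≤ w)
    (hs : Summable fun j : ℕ+ => (θ j : ℝ) * w ^ (j : ℕ)) :
    Tendsto (fun K => smallOccMean θ K w) atTop (𝓝 (∑' j : ℕ+, (θ j : ℝ) * w ^ (j : ℕ))) := by
  have h1 : Tendsto smallPartitions atTop atTop :=
    tendsto_atTop_finset_of_monotone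
      (fun K K' h μ hμ => mem_smallPartitions.2 ((mem_smallPartitions.1 hμ).trans h))
      fun μ => ⟨size μ, mem_smallPartitions.2 le_rfl⟩
  have h2 : Tendsto _ _ _ := hasSum_size_siteSeries hw hs
  have h3 := (h2.comp h1).div_const (siteSeries θ w)
  rwa [mul_div_cancel_right₀ _ (zero_lt_one.trans_le (one_le_siteSeries hw hs)).ne'] at h3

lemma continuousOn_smallOccMean {w : ℝ} (hw : 0 ≤ w)
    (hs : Summable fun j : ℕ+ => (θ j : ℝ) * w ^ (j : ℕ)) (K : ℕ) :
    ContinuousOn (smallOccMean θ K) (Set.Icc 0 w) := by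
  refine ContinuousOn.div (by fun_prop) (continuousOn_siteSeries hw hs) fun u hu => ?_
  exact (zero_lt_one.trans_le
    (one_le_siteSeries hu.1 (summable_theta_mono hu.1 hu.2 hs))).ne'

lemma exists_continuousOn_smallOccMean {y : ℝ} (hy : 0 < y)
    (hs : Summable fun j : ℕ+ => (θ j : ℝ) * y ^ (j : ℕ)) (K : ℕ) :
    ∃ φ : ℝ → ℝ, ContinuousOn φ (Set.Icc 0 1) ∧
      ∀ u ∈ Set.Icc (0 : ℝ) 1, smallOccMean θ K (y * u) = u * φ u := by
  have hmem : ∀ u ∈ Set.Icc (0 : ℝ) 1, y * u ∈ Set.Icc 0 y := fun u hu =>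
    ⟨mul_nonneg hy.le hu.1, mul_le_of_le_one_right hy.le hu.2⟩
  refine ⟨fun u => (∑ μ ∈ smallPartitions K,
    (size μ : ℝ) * ((siteWeight θ μ).toReal * (y ^ size μ * u ^ (size μ - 1)))) /
      siteSeries θ (y * u), ?_, fun u hu => ?_⟩
  · refine ContinuousOn.div (by fun_prop)
      ((continuousOn_siteSeries hy.le hs).comp (by fun_prop) hmem) fun u hu => ?_
    exact (zero_lt_one.trans_le (one_le_siteSeries (hmem u hu).1
      (summable_theta_mono (hmem u hu).1 (hmem u hu).2 hs))).ne'
  · rw [smallOccMean, ← mul_div_assoc, Finset.mul_sum]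
    congr 1
    refine Finset.sum_congr rfl fun μ _ => ?_
    rcases eq_or_ne (size μ) 0 with h | h
    · simp [h]
    · obtain ⟨k, hk⟩ : ∃ k, size μ = k + 1 := ⟨size μ - 1, by omega⟩
      rw [hk, Nat.add_sub_cancel]
      ring

/-- Exponential moments of the occupation of a site, cut off at `K`. -/
lemma tsum_siteWeight_occ_tilt_le {t w z : ℝ} (hw : 0 ≤ w) (hwz : w ≤ z)
    (hs : Summable fun j : ℕ+ => (θ j : ℝ) * w ^ (j : ℕ)) (K : ℕ) (ht : |t| ≤ 1 / (K + 1)) :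
    ∑' μ : Multiset ℕ+, siteWeight θ μ * ENNReal.ofReal w ^ size μ *
        ENNReal.ofReal (Real.exp (t * (if K < size μ then 0 else size μ : ℕ))) ≤
      ENNReal.ofReal (Real.exp (logSite θ w + t * smallOccMean θ K w +
        (∑ μ ∈ smallPartitions K,
          (size μ : ℝ) ^ 2 * ((siteWeight θ μ).toReal * z ^ (size μ - 1))) * t ^ 2 * w)) := by
  set g0 := siteSeries θ w with hg0
  have hg1 : 1 ≤ g0 := one_le_siteSeries hw hs
  set N1 := ∑ μ ∈ smallPartitions K, (size μ : ℝ) * ((siteWeight θ μ).toReal * w ^ size μ) with hN1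
  set N2 := ∑ μ ∈ smallPartitions K, (size μ : ℝ) ^ 2 * ((siteWeight θ μ).toReal * w ^ size μ)
    with hN2
  have hN20 : 0 ≤ N2 := Finset.sum_nonneg fun μ _ => by positivity
  set f : Multiset ℕ+ → ℝ := fun μ => (siteWeight θ μ).toReal * w ^ size μ +
    (if μ ∈ smallPartitions K then (t * ((size μ : ℝ) * ((siteWeight θ μ).toReal * w ^ size μ)) +
      t ^ 2 * ((size μ : ℝ) ^ 2 * ((siteWeight θ μ).toReal * w ^ size μ))) else 0) with hf
  have hcorr : HasSum (fun μ : Multiset ℕ+ => if μ ∈ smallPartitions K then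
      (t * ((size μ : ℝ) * ((siteWeight θ μ).toReal * w ^ size μ)) +
      t ^ 2 * ((size μ : ℝ) ^ 2 * ((siteWeight θ μ).toReal * w ^ size μ))) else 0)
      (t * N1 + t ^ 2 * N2) := by
    have h := hasSum_sum_of_ne_finset_zero (L := SummationFilter.unconditional _)
      (s := smallPartitions K) (f := fun μ : Multiset ℕ+ =>
      if μ ∈ smallPartitions K then (t * ((size μ : ℝ) * ((siteWeight θ μ).toReal * w ^ size μ)) +
      t ^ 2 * ((size μ : ℝ) ^ 2 * ((siteWeight θ μ).toReal * w ^ size μ))) else 0)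
      fun μ hμ => if_neg hμ
    rw [Finset.sum_congr rfl fun μ hμ => if_pos hμ, Finset.sum_add_distrib, ← Finset.mul_sum,
      ← Finset.mul_sum] at h
    exact h
  have hfs : HasSum f (g0 + (t * N1 + t ^ 2 * N2)) :=
    (summable_siteSeries hw hs).hasSum.add hcorr
  -- `exp x ≤ 1 + x + x ^ 2` in each term
  have hle : ∀ μ : Multiset ℕ+, (siteWeight θ μ).toReal * w ^ size μ *
      Real.exp (t * (if K < size μ then 0 else size μ : ℕ)) ≤ f μ := by
    intro μ
    by_cases h : K < size μ
    · simp [hf, h, not_le.2 h]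
    · rw [if_neg h, hf]
      beta_reduce
      rw [if_pos (mem_smallPartitions.2 (not_lt.1 h))]
      have h1 := exp_le_one_add_add_sq (abs_mul_natCast_le_one ht (not_lt.1 h))
      calc (siteWeight θ μ).toReal * w ^ size μ * Real.exp (t * (size μ : ℕ))
          ≤ (siteWeight θ μ).toReal * w ^ size μ * (1 + t * size μ + (t * size μ) ^ 2) := by gcongr
        _ = _ := by ring
  calc ∑' μ : Multiset ℕ+, siteWeight θ μ * ENNReal.ofReal w ^ size μ *
        ENNReal.ofReal (Real.exp (t * (if K < size μ then 0 else size μ : ℕ)))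
      ≤ ∑' μ, ENNReal.ofReal (f μ) := by
        refine ENNReal.tsum_le_tsum fun μ => ?_
        rw [siteWeight_mul_pow_eq hw, ← ENNReal.ofReal_mul (by positivity)]
        exact ENNReal.ofReal_le_ofReal (hle μ)
    _ = ENNReal.ofReal (g0 + (t * N1 + t ^ 2 * N2)) := by
        rw [← hfs.tsum_eq, ENNReal.ofReal_tsum_of_nonneg _ hfs.summable]
        exact fun μ => le_trans (by positivity) (hle μ)
    _ ≤ _ := by
        refine ENNReal.ofReal_le_ofReal ?_
        have h1 : N2 / g0 ≤ N2 := div_le_self hN20 hg1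
        have h2 : N2 ≤ _ * w := sum_size_pow_le (θ := θ) hw hwz K 2 two_ne_zero
        have h3 : g0 + (t * N1 + t ^ 2 * N2) =
            g0 * (t * smallOccMean θ K w + t ^ 2 * (N2 / g0) + 1) := by
          rw [smallOccMean, ← hg0, ← hN1]
          have : g0 ≠ 0 := by linarith
          field_simp
          ring
        rw [h3, add_assoc (logSite θ w), Real.exp_add]
        refine mul_le_mul (siteSeries_le hw hs) ?_ ?_ (Real.exp_pos _).le
        · refine (Real.add_one_le_exp _).trans (Real.exp_le_exp.2 ?_)
          have h4 : t ^ 2 * (N2 / g0) ≤ t ^ 2 * (_ * w) :=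
            mul_le_mul_of_nonneg_left (h1.trans h2) (sq_nonneg t)
          linarith
        · have h5 : 0 ≤ ∑' μ, f μ := tsum_nonneg fun μ => le_trans (by positivity) (hle μ)
          rw [hfs.tsum_eq, h3] at h5
          exact nonneg_of_mul_nonneg_right h5 (by linarith)

/-- At the fugacity `z`, the local density `∑_j θ_j z^j e^{-jV(x)}` is finite for almost every `x`
and integrable. -/
lemma PotentialAssumption.localDensity (hV : PotentialAssumption V) {z : ℝ} (hz : 0 ≤ z)
    (hzs : Summable fun j : ℕ+ => densityCoeff V θ j * z ^ (j : ℕ)) :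
    (∀ᵐ x, Summable fun j : ℕ+ => (θ j : ℝ) * (z * boltzFactor V x) ^ (j : ℕ)) ∧
    Integrable (fun x => ∑' j : ℕ+, (θ j : ℝ) * (z * boltzFactor V x) ^ (j : ℕ)) ∧
    ∫ x, ∑' j : ℕ+, (θ j : ℝ) * (z * boltzFactor V x) ^ (j : ℕ) =
      ∑' j : ℕ+, densityCoeff V θ j * z ^ (j : ℕ) := by
  have hnn : ∀ (j : ℕ+) x, 0 ≤ (θ j : ℝ) * (z * boltzFactor V x) ^ (j : ℕ) := fun j x =>
    mul_nonneg (NNReal.coe_nonneg _) (pow_nonneg (mul_nonneg hz (boltzFactor_nonneg V x)) _)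
  have hm : ∀ j : ℕ+, AEMeasurable
      (fun x => ENNReal.ofReal ((θ j : ℝ) * (z * boltzFactor V x) ^ (j : ℕ))) := fun j =>
    (((hV.aemeasurable_boltzFactor.const_mul z).pow_const _).const_mul _).ennreal_ofReal
  have hint : ∀ j : ℕ+, Integrable fun x => (θ j : ℝ) * (z * boltzFactor V x) ^ (j : ℕ) := by
    intro j
    simp only [mul_pow]
    exact ((hV.integrable_pow j).const_mul _).const_mul _
  have hval : ∀ j : ℕ+, ∫ x, (θ j : ℝ) * (z * boltzFactor V x) ^ (j : ℕ) =
      densityCoeff V θ j * z ^ (j : ℕ) := fun j => by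
    simp only [mul_pow]
    rw [integral_const_mul, integral_const_mul, densityCoeff]
    ring
  have hH : ∫⁻ x, ∑' j : ℕ+, ENNReal.ofReal ((θ j : ℝ) * (z * boltzFactor V x) ^ (j : ℕ)) =
      ENNReal.ofReal (∑' j : ℕ+, densityCoeff V θ j * z ^ (j : ℕ)) := by
    rw [lintegral_tsum hm, ENNReal.ofReal_tsum_of_nonneg
      (fun j => mul_nonneg (densityCoeff_nonneg j) (pow_nonneg hz _)) hzs]
    refine tsum_congr fun j => ?_
    rw [← hval j, ofReal_integral_eq_lintegral_ofReal (hint j)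
      (Eventually.of_forall fun x => hnn j x)]
  have hHm : AEMeasurable fun x =>
      ∑' j : ℕ+, ENNReal.ofReal ((θ j : ℝ) * (z * boltzFactor V x) ^ (j : ℕ)) :=
    AEMeasurable.tsum hm
  have hHt : ∫⁻ x, ∑' j : ℕ+, ENNReal.ofReal ((θ j : ℝ) * (z * boltzFactor V x) ^ (j : ℕ)) ≠ ⊤ := by
    rw [hH]; exact ENNReal.ofReal_ne_top
  have hfin := ae_lt_top' hHm hHt
  have he : ∀ x, (∑' j : ℕ+, ENNReal.ofReal
      ((θ j : ℝ) * (z * boltzFactor V x) ^ (j : ℕ))).toReal =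
      ∑' j : ℕ+, (θ j : ℝ) * (z * boltzFactor V x) ^ (j : ℕ) := fun x => by
    rw [ENNReal.tsum_toReal_eq fun j => ENNReal.ofReal_ne_top]
    exact tsum_congr fun j => ENNReal.toReal_ofReal (hnn j x)
  refine ⟨?_, ?_, ?_⟩
  · filter_upwards [hfin] with x hx
    exact (ENNReal.summable_toReal hx.ne).congr fun j => ENNReal.toReal_ofReal (hnn j x)
  · simp only [← he]
    exact integrable_toReal_of_lintegral_ne_top hHm hHt
  · simp only [← he]
    rw [integral_toReal hHm hfin, hH, ENNReal.toReal_ofReal]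
    exact tsum_nonneg fun j => mul_nonneg (densityCoeff_nonneg j) (pow_nonneg hz _)

lemma PotentialAssumption.aestronglyMeasurable_smallOccMean (hV : PotentialAssumption V) {y z : ℝ}
    (hy : 0 < y) (hyz : y < z) (hzs : Summable fun j : ℕ+ => densityCoeff V θ j * z ^ (j : ℕ))
    (K : ℕ) : AEStronglyMeasurable fun x => smallOccMean θ K (y * boltzFactor V x) := by
  obtain ⟨φ, hφ, h⟩ := exists_continuousOn_smallOccMean hy (hV.summable_theta hy hyz hzs) K
  simp only [fun x => h _ (boltzFactor_mem V x)]
  exact hV.aestronglyMeasurable_mul_comp hφ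

/-- Left continuity at `z`, almost everywhere in space. -/
lemma PotentialAssumption.ae_tendsto_smallOccMean (hV : PotentialAssumption V) {z : ℝ} (hz : 0 < z)
    (hzs : Summable fun j : ℕ+ => densityCoeff V θ j * z ^ (j : ℕ)) (K : ℕ) :
    ∀ᵐ x, Tendsto (fun y => smallOccMean θ K (y * boltzFactor V x)) (𝓝[<] z)
      (𝓝 (smallOccMean θ K (z * boltzFactor V x))) := by
  filter_upwards [(hV.localDensity hz.le hzs).1] with x hx
  have hu := boltzFactor_nonneg V x
  have hzu : 0 ≤ z * boltzFactor V x := mul_nonneg hz.le hu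
  have hc : Tendsto (fun y => y * boltzFactor V x) (𝓝[<] z)
      (𝓝[Set.Icc 0 (z * boltzFactor V x)] (z * boltzFactor V x)) := by
    refine tendsto_nhdsWithin_iff.2 ⟨?_, ?_⟩
    · exact ((continuous_id.mul continuous_const).tendsto z).mono_left nhdsWithin_le_nhds
    · filter_upwards [Ioo_mem_nhdsLT hz] with y hy
      exact ⟨mul_nonneg hy.1.le hu, mul_le_mul_of_nonneg_right hy.2.le hu⟩
  exact ((continuousOn_smallOccMean hzu hx K) _ ⟨hzu, le_rfl⟩).tendsto.comp hc

lemma PotentialAssumption.tendsto_integral_smallOccMean (hV : PotentialAssumption V) {z : ℝ}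
    (hz : 0 < z) (hzs : Summable fun j : ℕ+ => densityCoeff V θ j * z ^ (j : ℕ)) (K : ℕ) :
    Tendsto (fun y => ∫ x, smallOccMean θ K (y * boltzFactor V x)) (𝓝[<] z)
      (𝓝 (∫ x, smallOccMean θ K (z * boltzFactor V x))) := by
  refine tendsto_integral_filter_of_dominated_convergence
    (fun x => (∑ μ ∈ smallPartitions K,
        (size μ : ℝ) * ((siteWeight θ μ).toReal * z ^ (size μ - 1))) * (z * boltzFactor V x))
    ?_ ?_ ((hV.integrable.const_mul z).const_mul _) (hV.ae_tendsto_smallOccMean hz hzs K)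
  · filter_upwards [Ioo_mem_nhdsLT hz] with y hy
    exact hV.aestronglyMeasurable_smallOccMean hy.1 hy.2 hzs K
  · filter_upwards [Ioo_mem_nhdsLT hz] with y hy
    refine Eventually.of_forall fun x => ?_
    have hu := boltzFactor_nonneg V x
    have hyu : 0 ≤ y * boltzFactor V x := mul_nonneg hy.1.le hu
    have hyuz : y * boltzFactor V x < z :=
      (mul_le_of_le_one_right hy.1.le (boltzFactor_le_one V x)).trans_lt hy.2
    rw [Real.norm_of_nonneg (smallOccMean_nonneg hyu K)]
    refine (smallOccMean_le_mul hyu hyuz.le (hV.summable_theta' hyu hyuz hzs) K).trans ?_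
    refine mul_le_mul_of_nonneg_left (mul_le_mul_of_nonneg_right hy.2.le hu) ?_
    exact Finset.sum_nonneg fun μ _ => by positivity

lemma PotentialAssumption.tendsto_integral_smallOccMean_atTop (hV : PotentialAssumption V) {z : ℝ}
    (hz : 0 < z) (hzs : Summable fun j : ℕ+ => densityCoeff V θ j * z ^ (j : ℕ)) :
    Tendsto (fun K => ∫ x, smallOccMean θ K (z * boltzFactor V x)) atTop
      (𝓝 (∑' j : ℕ+, densityCoeff V θ j * z ^ (j : ℕ))) := by
  obtain ⟨h1, h2, h3⟩ := hV.localDensity hz.le hzs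
  rw [← h3]
  refine tendsto_integral_of_dominated_convergence _ (fun K => ?_) h2 (fun K => ?_) ?_
  · -- the function is an almost everywhere limit of the measurable functions at `y < z`
    obtain ⟨y, _, hy, hyz⟩ := exists_seq_strictMono_tendsto' (show (0 : ℝ) < z from hz)
    refine aestronglyMeasurable_of_tendsto_ae (u := atTop)
      (f := fun n x => smallOccMean θ K (y n * boltzFactor V x))
      (fun n => hV.aestronglyMeasurable_smallOccMean (hy n).1 (hy n).2 hzs K) ?_
    have hyz' : Tendsto y atTop (𝓝[<] z) :=
      tendsto_nhdsWithin_iff.2 ⟨hyz, Eventually.of_forall fun n => (hy n).2⟩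
    filter_upwards [hV.ae_tendsto_smallOccMean hz hzs K] with x hx using hx.comp hyz'
  · filter_upwards [h1] with x hx
    have hzu := mul_nonneg hz.le (boltzFactor_nonneg V x)
    rw [Real.norm_of_nonneg (smallOccMean_nonneg hzu K)]
    exact smallOccMean_le hzu hx K
  · filter_upwards [h1] with x hx
    exact tendsto_smallOccMean (mul_nonneg hz.le (boltzFactor_nonneg V x)) hx

/-- The mean density of the mass at the sites with occupation at most `K`. -/
lemma PotentialAssumption.tendsto_expect_smallOcc (hV : PotentialAssumption V)
    (hd : 1 ≤ d) {ρ : ℝ≥0} (hρ : 0 < ρ) {z : ℝ} (hz : 0 < z)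
    (hzs : Summable fun j : ℕ+ => densityCoeff V θ j * z ^ (j : ℕ))
    (hcase : (ρ : ℝ)⁻¹ * ∑' j : ℕ+, densityCoeff V θ j * z ^ (j : ℕ) = 1 ∨
        ((ρ : ℝ)⁻¹ * ∑' j : ℕ+, densityCoeff V θ j * z ^ (j : ℕ) < 1 ∧
          ∀ ε : ℝ, 0 < ε → ∀ N : ℕ, ∃ J : ℕ+, N < J ∧
            Real.exp (-(ε * (J : ℕ))) ≤ (ρ : ℝ)⁻¹ * (densityCoeff V θ J * z ^ (J : ℕ))))
    (K : ℕ) :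
    Tendsto (fun n : ℕ => (expect V θ (sideLength d ρ n) n
      (fun lam => (n : ℝ≥0∞)⁻¹ *
        siteSum (fun μ => if K < size μ then 0 else size μ) lam)).toReal) (thermoLimit V θ ρ)
      (𝓝 ((ρ : ℝ)⁻¹ * ∫ x, smallOccMean θ K (z * boltzFactor V x))) := by
  refine hV.tendsto_expect hd hρ hz hzs hcase (m := smallOccMean θ K)
    (C := ∑ μ ∈ smallPartitions K,
      (size μ : ℝ) ^ 2 * ((siteWeight θ μ).toReal * z ^ (size μ - 1))) (t₀ := 1 / (K + 1))
    (fun μ => ?_) (Finset.sum_nonneg fun μ _ => by positivity) (by positivity)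
    (fun y hy hyz => exists_continuousOn_smallOccMean hy (hV.summable_theta hy hyz hzs) K)
    (fun t ht w hw hwz => tsum_siteWeight_occ_tilt_le hw hwz.le (hV.summable_theta' hw hwz hzs) K
      ht) (hV.tendsto_integral_smallOccMean hz hzs K)
  split_ifs
  · exact Nat.zero_le _
  · exact le_rfl

/-! ### The condensate -/

/-- The measure is defined for infinitely many `n`, such as the large multiples of a size `j` with
`θ_j ≠ 0`. -/
lemma PotentialAssumption.thermoLimit_neBot (hV : PotentialAssumption V) (hd : 1 ≤ d)
    (hθ : ∃ j, θ j ≠ 0) {ρ : ℝ≥0} (hρ : 0 < ρ) {z : ℝ} (hz : 0 < z)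
    (hzs : Summable fun j : ℕ+ => densityCoeff V θ j * z ^ (j : ℕ)) :
    (thermoLimit V θ ρ).NeBot := by
  obtain ⟨j, hj⟩ := hθ
  have hy : 0 < z / 2 := by positivity
  have hθs := hV.summable_theta hy (half_lt_self hz) hzs
  obtain ⟨φ, hφ, hGφ⟩ := exists_continuousOn_logSite hy hθs
  obtain ⟨B, hB⟩ := isCompact_Icc.exists_bound_of_continuousOn hφ
  rw [thermoLimit, ← frequently_mem_iff_neBot]
  have hfin : ∀ᶠ n : ℕ in atTop, partitionFunction V θ (sideLength d ρ n) n ≠ ⊤ := by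
    filter_upwards [hV.eventually_summable hd hρ] with n hn
    have hyu : ∀ x, 0 ≤ z / 2 * boltzFactor V (scaledPoint (sideLength d ρ n) x) := fun x =>
      mul_nonneg hy.le (boltzFactor_nonneg V _)
    have h := tsum_weight_tilt_le V θ (sideLength d ρ n) n (ξ := fun _ => 0) rfl 0 hy
      (fun x => logSite θ (z / 2 * boltzFactor V (scaledPoint (sideLength d ρ n) x)))
      (fun x => tsum_nonneg fun j => by have := hyu x; positivity)
      (Summable.of_norm_bounded (hn.mul_right B) fun x => by
        rw [hGφ _ (boltzFactor_mem V _), norm_mul, Real.norm_of_nonneg (boltzFactor_nonneg V _)]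
        exact mul_le_mul_of_nonneg_left (hB _ (boltzFactor_mem V _)) (boltzFactor_nonneg V _))
      (fun x => by
        rw [← ofReal_boltzFactor, ← ENNReal.ofReal_mul hy.le]
        simpa using tsum_siteWeight_le (hyu x) (summable_theta_mono (hyu x)
          (mul_le_of_le_one_right hy.le (boltzFactor_le_one V _)) hθs))
    simp only [zero_mul, Real.exp_zero, ENNReal.ofReal_one, mul_one] at h
    exact ne_top_of_le_ne_top ENNReal.ofReal_ne_top h
  have hpos : ∃ᶠ n : ℕ in atTop, partitionFunction V θ (sideLength d ρ n) n ≠ 0 := by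
    refine frequently_atTop.2 fun N => ⟨N * j, Nat.le_mul_of_pos_right _ j.pos, ?_⟩
    have h := poissonWeight_le_partitionFunction V θ (sideLength d ρ (N * j : ℕ))
      (Finsupp.single j N)
    rw [mass_single] at h
    refine (lt_of_lt_of_le (pos_iff_ne_zero.2 ?_) h).ne'
    rw [poissonWeight_eq_prod _ _ subset_rfl, Finset.prod_ne_zero_iff]
    intro i hi
    have hij : i = j := Finset.mem_singleton.1 (Finsupp.support_single_subset hi)
    subst hij
    refine mul_ne_zero (by simp) (pow_ne_zero _ (mul_ne_zero ?_ ?_))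
    · exact (ENNReal.div_pos (by simpa using hj) (by simp)).ne'
    · exact (zero_lt_one.trans_le (hV.one_le_latticeSum _ _)).ne'
  exact (hpos.and_eventually hfin).mono fun n hn => hn

/-- Passing from the mass in small units to the mass in large units. -/
lemma tendsto_expect_large {ρ : ℝ≥0} {ξ ζ : Multiset ℕ+ → ℕ}
    (h : ∀ μ, ξ μ + ζ μ = size μ) {a : ℝ}
    (ha : Tendsto (fun n : ℕ => (expect V θ (sideLength d ρ n) n
      (fun lam => (n : ℝ≥0∞)⁻¹ * siteSum ξ lam)).toReal) (thermoLimit V θ ρ) (𝓝 a)) :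
    Tendsto (fun n : ℕ => expect V θ (sideLength d ρ n) n
      (fun lam => (n : ℝ≥0∞)⁻¹ * siteSum ζ lam)) (thermoLimit V θ ρ)
      (𝓝 (1 - ENNReal.ofReal a)) := by
  have h1 := ENNReal.Tendsto.sub (tendsto_const_nhds (x := (1 : ℝ≥0∞)))
    (ENNReal.tendsto_ofReal ha) (Or.inl ENNReal.one_ne_top)
  refine h1.congr' ?_
  filter_upwards [eventually_thermoLimit ρ,
    (thermoLimit_le (V := V) (θ := θ) ρ) (eventually_ne_atTop 0)] with n hn hn0
  obtain ⟨h2, h3⟩ := expect_eq_one_sub V θ (sideLength d ρ n) hn0 hn.1 hn.2 h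
  rw [h2, ENNReal.ofReal_toReal (ne_top_of_le_ne_top ENNReal.one_ne_top h3)]

end Occupation

end SpatialPartition

end

theorem theorem4p1 {d : ℕ} (hd : 1 ≤ d) (V : (Fin d → ℝ) → ℝ≥0∞)
    (hV : SpatialPartition.PotentialAssumption V)
    (θ : ℕ+ → ℝ≥0) (hθ : ∃ j, θ j ≠ 0)
    (hz : 0 < SpatialPartition.criticalFugacity V θ)
    (ρ : ℝ≥0) (hρ : 0 < ρ) :
    (SpatialPartition.thermoLimit V θ ρ).NeBot ∧
    ∃ ν μ : ℝ≥0∞,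
      SpatialPartition.IsNuInfty V θ ρ ν ∧ SpatialPartition.IsMuInfty V θ ρ μ ∧
      ν = μ ∧
      (μ : EReal) =
        max 0 (1 - ((SpatialPartition.criticalDensity V θ / (ρ : ℝ≥0∞) : ℝ≥0∞) : EReal)) := by
  obtain ⟨z, hz0, hzs, hcase, hval⟩ := hV.exists_fugacity hθ hz hρ
  have hlim : ∀ M : ℕ → ℝ,
      Tendsto M atTop (𝓝 (∑' j : ℕ+, SpatialPartition.densityCoeff V θ j * z ^ (j : ℕ))) →
      Tendsto (fun K => 1 - ENNReal.ofReal ((ρ : ℝ)⁻¹ * M K)) atTop (𝓝 (1 - ENNReal.ofReal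
        ((ρ : ℝ)⁻¹ * ∑' j : ℕ+, SpatialPartition.densityCoeff V θ j * z ^ (j : ℕ)))) :=
    fun M hM => ENNReal.Tendsto.sub tendsto_const_nhds (ENNReal.tendsto_ofReal (hM.const_mul _))
      (Or.inl ENNReal.one_ne_top)
  refine ⟨hV.thermoLimit_neBot hd hθ hρ hz0 hzs, _, _,
    ⟨_, fun K => ?_, hlim (fun K => ∑ j ∈ SpatialPartition.smallSizes K,
      SpatialPartition.densityCoeff V θ j * z ^ (j : ℕ)) ?_⟩,
    ⟨_, fun K => ?_, hlim (fun K => ∫ x, SpatialPartition.smallOccMean θ K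
      (z * SpatialPartition.boltzFactor V x)) ?_⟩, rfl, hval⟩
  · simp only [SpatialPartition.largeCompMass_eq]
    exact SpatialPartition.tendsto_expect_large (SpatialPartition.sizeUpTo_add_sizeAbove K)
      (hV.tendsto_expect_sizeUpTo hd hρ hz0 hzs hcase K)
  · have h1 : Tendsto SpatialPartition.smallSizes atTop atTop :=
      tendsto_atTop_finset_of_monotone (fun K K' h j hj => SpatialPartition.mem_smallSizes.2
        ((SpatialPartition.mem_smallSizes.1 hj).trans h))
      fun j => ⟨j, SpatialPartition.mem_smallSizes.2 le_rfl⟩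
    have h2 : Tendsto (fun s : Finset ℕ+ =>
        ∑ j ∈ s, SpatialPartition.densityCoeff V θ j * z ^ (j : ℕ)) atTop
        (𝓝 (∑' j : ℕ+, SpatialPartition.densityCoeff V θ j * z ^ (j : ℕ))) := hzs.hasSum
    exact h2.comp h1
  · simp only [SpatialPartition.largeSiteMass_eq]
    exact SpatialPartition.tendsto_expect_large (fun μ => by split_ifs <;> simp)
      (hV.tendsto_expect_smallOcc hd hρ hz0 hzs hcase K)
  · exact hV.tendsto_integral_smallOccMean_atTop hz0 hzs
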